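/- Let $n\ge 1$ and let $F\subset \mathrm{Sym}(\mathbb R^n)$ be a non-empty closed set of real symmetric $n\times n$ matrices such that $F+P\subset F$ for every positive semidefinite $P$, such that $tF\subset F$ for all $t\ge 0$, and such that $gFg^{T}\subset F$ for all $g$ in some subgroup $G\subset \mathrm O(n)$ acting transitively on the unit sphere $S^{n-1}$. For a unit vector $e$ let $P_e=ee^{T}$ and $P_{e^\perp}=I-P_e$, and assume that the Riesz characteristic $$p=p_F=\sup\{q\in\mathbb R : P_{e^\perp}-(q-1)P_e\in F\}$$ (which does not depend on $e$) is finite. Let $K(t)=t^{2-p}$ if $1\le p<2$, $K(t)=\log t$ if $p=2$, and $K(t)=-t^{-(p-2)}$ if $p>2$. Let $X\subset\mathbb R^n$ be open and let $u:X\to[-\infty,\infty)$ be $F$-subharmonic in the viscosity sense: $u$ is upper semi-continuous, and $D^2\varphi(x)\in F$ whenever $x\in X$, $\varphi$ is $C^2$ near $x$, $u\le\varphi$ near $x$ and $u(x)=\varphi(x)$. Assume that $u$ is not identically $-\infty$ on any connected component of $X$. With $S$ and $B$ the unit sphere and the closed unit ball of $\mathbb R^n$ (with surface measure, which is counting measure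 when $n=1$, and Lebesgue measure), put, for $x\in X$ and small $r>0$, $$M(u,x;r)=\sup_{\sigma\in S}u(x+r\sigma),\qquad S(u,x;r)=\frac1{|S|}\int_S u(x+r\sigma)\,d\sigma,\qquad V(u,x;r)=\frac1{|B|}\int_B u(x+ry)\,dy .$$ For $\Psi\in\{M,S,V\}$ define the density $$\Theta^{\Psi}(u,x)=\lim_{\substack{s,t\to0\\ 0<s<t}}\frac{\Psi(u,x;t)-\Psi(u,x;s)}{K(t)-K(s)} .$$ Then the following holds for $\Psi=M$, and, if $F$ is convex, also for $\Psi=S$ and $\Psi=V$. For each $x\in X$ the number $\Psi(u,x;r)$ is finite for all sufficiently small $r>0$ and the limit $\Theta^{\Psi}(u,x)$ exists in $\mathbb R$; the function $x\mapsto\Theta^{\Psi}(u,x)$ is upper semi-continuous on $X$; and for every $c\ge 0$ the set $$E_c=\{x\in X:\Theta^{\Psi}(u,x)\ge c\}$$ is closed in $X$. -/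

import Mathlib

open MeasureTheory Filter Topology

namespace RieszDensity

noncomputable section

/-- Euclidean space `ℝⁿ`. -/
abbrev E (n : ℕ) : Type := EuclideanSpace ℝ (Fin n)

/-- Orthogonal projection `P_e = e eᵀ` onto the line spanned by the unit vector `e`. -/
def lineProj {n : ℕ} (e : E n) : Matrix (Fin n) (Fin n) ℝ :=
  Matrix.vecMulVec e.ofLp e.ofLp

/-- An ST-invariant cone subequation: a non-empty closed set `F` of symmetric matrices with
`F + 𝒫 ⊆ F` (`𝒫` the positive semidefinite matrices), `t F ⊆ F` for `t ≥ 0`, which is invariant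
under a subgroup of `O(n)` that acts transitively on the unit sphere. -/
structure IsSTConeSubequation {n : ℕ} (F : Set (Matrix (Fin n) (Fin n) ℝ)) : Prop where
  nonempty : F.Nonempty
  symm : ∀ A ∈ F, A.IsSymm
  isClosed : IsClosed F
  positivity : ∀ A ∈ F, ∀ P : Matrix (Fin n) (Fin n) ℝ, P.PosSemidef → A + P ∈ F
  cone : ∀ A ∈ F, ∀ t : ℝ, 0 ≤ t → t • A ∈ F
  invariant : ∃ G : Subgroup (Matrix.orthogonalGroup (Fin n) ℝ),
    (∀ e e' : E n, ‖e‖ = 1 → ‖e'‖ = 1 →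
      ∃ g ∈ G, Matrix.mulVec (g : Matrix (Fin n) (Fin n) ℝ) e.ofLp = e'.ofLp) ∧
    ∀ g ∈ G, ∀ A ∈ F,
      (g : Matrix (Fin n) (Fin n) ℝ) * A * (g : Matrix (Fin n) (Fin n) ℝ).transpose ∈ F

/-- The (increasing) Riesz characteristic `p_F = sup {q : P_{e^⊥} - (q - 1) P_e ∈ F}`, an extended
real number. For ST-invariant `F` membership does not depend on the unit vector `e`. -/
def rieszChar {n : ℕ} (F : Set (Matrix (Fin n) (Fin n) ℝ)) : EReal :=
  sSup ((fun q : ℝ => (q : EReal)) ''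
    {q : ℝ | ∀ e : E n, ‖e‖ = 1 → (1 - lineProj e) - (q - 1) • lineProj e ∈ F})

/-- The Hessian matrix `D²φ(x)`. -/
def hessian {n : ℕ} (φ : E n → ℝ) (x : E n) : Matrix (Fin n) (Fin n) ℝ :=
  Matrix.of fun i j =>
    fderiv ℝ (fderiv ℝ φ) x (EuclideanSpace.single i 1) (EuclideanSpace.single j 1)

/-- `u` is (viscosity) `F`-subharmonic on `X`: it is upper semi-continuous on `X` with values in
`[-∞, ∞)`, and `D²φ(x) ∈ F` whenever `φ` is `C²` near a point `x ∈ X` and touches `u` from above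
at `x`. Only the values of `u` on `X` matter when `X` is open. -/
structure IsSubharmonicOn {n : ℕ} (F : Set (Matrix (Fin n) (Fin n) ℝ)) (X : Set (E n))
    (u : E n → EReal) : Prop where
  usc : UpperSemicontinuousOn u X
  ne_top : ∀ x ∈ X, u x ≠ ⊤
  viscosity : ∀ x ∈ X, ∀ φ : E n → ℝ, ContDiffAt ℝ 2 φ x → u x = (φ x : EReal) →
    (∀ᶠ y in 𝓝 x, u y ≤ (φ y : EReal)) → hessian φ x ∈ F

/-- The Riesz kernel `K_p(t)`, `t > 0`. -/
def rieszKernel (p t : ℝ) : ℝ :=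
  if p < 2 then t ^ (2 - p) else if p = 2 then Real.log t else -(1 / t ^ (p - 2))

/-- Spherical maximum `M(u, x; r)`. -/
def sphereMax {n : ℕ} (u : E n → EReal) (x : E n) (r : ℝ) : EReal :=
  ⨆ σ : Metric.sphere (0 : E n) 1, u (x + r • (σ : E n))

/-- Integral `∫ f⁺ - ∫ f⁻` of an extended real valued function. It is only used for measurable
functions that are bounded above and for finite measures, where the first term is finite. -/
def extIntegral {α : Type*} [MeasurableSpace α] (μ : Measure α) (f : α → EReal) : EReal :=
  ((∫⁻ a, (f a).toENNReal ∂μ : ENNReal) : EReal) - ((∫⁻ a, (-f a).toENNReal ∂μ : ENNReal) : EReal)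

/-- The probability measure on the unit sphere proportional to surface measure. -/
def sphereMeasure (n : ℕ) : Measure (Metric.sphere (0 : E n) 1) :=
  ((volume : Measure (E n)).toSphere Set.univ)⁻¹ • (volume : Measure (E n)).toSphere

/-- The probability measure proportional to Lebesgue measure on the closed unit ball. -/
def ballMeasure (n : ℕ) : Measure (E n) :=
  (volume (Metric.closedBall (0 : E n) 1))⁻¹ • volume.restrict (Metric.closedBall (0 : E n) 1)

/-- Spherical average `S(u, x; r)`. -/
def sphereAvg {n : ℕ} (u : E n → EReal) (x : E n) (r : ℝ) : EReal :=
  extIntegral (sphereMeasure n) fun σ => u (x + r • (σ : E n))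

/-- Volume average `V(u, x; r)`. -/
def ballAvg {n : ℕ} (u : E n → EReal) (x : E n) (r : ℝ) : EReal :=
  extIntegral (ballMeasure n) fun y => u (x + r • y)

/-- The quotient `(ψ(t) - ψ(s)) / (K_p(t) - K_p(s))` at the pair `(s, t)`. -/
def kernelQuotient (p : ℝ) (ψ : ℝ → EReal) (q : ℝ × ℝ) : ℝ :=
  ((ψ q.2).toReal - (ψ q.1).toReal) / (rieszKernel p q.2 - rieszKernel p q.1)

/-- The pairs `(s, t)` with `0 < s < t`, tending to `(0, 0)`. -/
def pairsToZero : Filter (ℝ × ℝ) :=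
  𝓝[{q : ℝ × ℝ | 0 < q.1 ∧ q.1 < q.2}] (0, 0)

/-- The density `Θ^ψ = lim_{0 < s < t → 0} (ψ(t) - ψ(s)) / (K_p(t) - K_p(s))`. -/
def density (p : ℝ) (ψ : ℝ → EReal) : ℝ :=
  limUnder pairsToZero (kernelQuotient p ψ)

/-- The density of `ψ` exists: `ψ(r)` is finite for all small `r > 0` and the limit defining
`Θ^ψ` exists as a real number. -/
def DensityExists (p : ℝ) (ψ : ℝ → EReal) : Prop :=
  (∀ᶠ r in 𝓝[>] (0 : ℝ), ψ r ≠ ⊥ ∧ ψ r ≠ ⊤) ∧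
    Tendsto (kernelQuotient p ψ) pairsToZero (𝓝 (density p ψ))

/-- The assertion that the density function `x ↦ Θ^Ψ(x)` of the family of averages
`Ψ(x; ·)` is defined at every point of `X`, is upper semi-continuous on `X`, and that all its
superlevel sets `E_c = {x ∈ X : Θ^Ψ(x) ≥ c}`, `c ≥ 0`, are closed in `X`. -/
def UpperSemicontinuousDensity {n : ℕ} (p : ℝ) (X : Set (E n)) (Ψ : E n → ℝ → EReal) : Prop :=
  (∀ x ∈ X, DensityExists p (Ψ x)) ∧
    UpperSemicontinuousOn (fun x => density p (Ψ x)) X ∧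
    ∀ c : ℝ, 0 ≤ c → IsClosed {x : X | c ≤ density p (Ψ x)}

end

end RieszDensity

/-! The density is a one-sided derivative with respect to `rieszKernel p`, written K below. If Ψ(u,
x; r) is nondecreasing in r and convex as a function of K(r), its difference quotients are
nonnegative and monotone in both endpoints, so the limit exists and is the infimum of all quotients.
An infimum of quantities varying almost continuously with x is upper semi-continuous, and closed
superlevel sets follow. Thus `upperSemicontinuousDensity_of_isKernelConvex` asks only for
finiteness, kernel convexity and a weak continuity in x.

For spherical maxima, the Hessian of K(|y - x|) is a nonnegative multiple of I - p P_e. By the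
choice of p, subtracting any positive multiple of I expels it from F (`notMem`). Hence a K + b - ε|y
- x|² with a ≥ 0 is a strict barrier, and comparison on annuli is a three circles theorem
(`le_on_annulus`, `isKernelConvex_sphereMax`). Letting a grow shows that a sphere on which u = -∞
forces u = -∞ on a full ball, so finiteness comes from the assumption on the components of X.

For averages, convexity makes F, within the symmetric matrices, an intersection of half spaces ℓ ≥ 0
with ℓ degenerate elliptic. For each such ℓ a probability measure on the sphere represents the value
at the centre of polynomial solutions of ℓ(D²h) = 0. The mean value inequality against it holds for
F-subharmonic functions and, conversely, gives ℓ(D²φ) ≥ 0 for test functions. Mean value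
inequalities survive averaging by Tonelli, so averages of F-subharmonic functions are F-subharmonic
(`isSubharmonicOn_average`). Averaging u about x over Haar measure on the closure of the transitive
group, and over radii, yields a radial F-subharmonic function whose value at |y| = r is the
spherical or volume average. A radial function is its own spherical maximum, so the first case gives
kernel convexity. Continuity in x comes from local integrability of u and averages over shells. -/

namespace RieszDensity

/-! ### Hessians: Taylor expansion, minima, affine changes of variable. -/

section Calculus

variable {n : ℕ}

theorem sum_single_smul (v : E n) : ∑ i, v i • EuclideanSpace.single i (1 : ℝ) = v := by
  ext j
  simp [Pi.single_apply]

theorem dotProduct_hessian_mulVec (φ : E n → ℝ) (x v w : E n) :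
    v.ofLp ⬝ᵥ (hessian φ x).mulVec w.ofLp = fderiv ℝ (fderiv ℝ φ) x v w := by
  conv_rhs => rw [← sum_single_smul v, ← sum_single_smul w]
  simp only [map_sum, map_smul, sum_apply, smul_apply,
    dotProduct, Matrix.mulVec, hessian, Matrix.of_apply, smul_eq_mul, Finset.mul_sum]
  rw [Finset.sum_comm]
  refine Finset.sum_congr rfl fun i _ => Finset.sum_congr rfl fun j _ => ?_
  ring

theorem isSymm_hessian {φ : E n → ℝ} {x : E n} (h : ContDiffAt ℝ 2 φ x) :
    (hessian φ x).IsSymm := by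
  ext i j
  simpa [hessian] using (h.isSymmSndFDerivAt (by simp)) (EuclideanSpace.single j 1)
    (EuclideanSpace.single i 1)

theorem differentiableAt_fderiv_of_contDiffAt {φ : E n → ℝ} {x : E n} (h : ContDiffAt ℝ 2 φ x) :
    DifferentiableAt ℝ (fderiv ℝ φ) x :=
  (h.fderiv_right (m := 1) (by norm_num)).differentiableAt (by norm_num)

theorem eventually_differentiableAt_of_contDiffAt {φ : E n → ℝ} {x : E n}
    (h : ContDiffAt ℝ 2 φ x) : ∀ᶠ y in 𝓝 x, DifferentiableAt ℝ φ y :=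
  (h.eventually (by simp)).mono fun _ hy => hy.differentiableAt (by norm_num)

/-- Second order Taylor expansion. -/
theorem taylor_two {φ : E n → ℝ} {x : E n} (h : ContDiffAt ℝ 2 φ x) {ε : ℝ} (hε : 0 < ε) :
    ∀ᶠ y in 𝓝 x, |φ y - φ x - fderiv ℝ φ x (y - x) -
      1 / 2 * fderiv ℝ (fderiv ℝ φ) x (y - x) (y - x)| ≤ ε * ‖y - x‖ ^ 2 := by
  set A := fderiv ℝ φ x
  set H := fderiv ℝ (fderiv ℝ φ) x
  have hsymm : ∀ v w, H v w = H w v := h.isSymmSndFDerivAt (by simp)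
  -- The remainder has derivative Dφ(y) - A - H(y - x), which is o(|y - x|); the mean value
  -- inequality on the ball of radius |y - x| then gains the second factor |y - x|.
  set ψ : E n → ℝ := fun y => φ y - A (y - x) - 1 / 2 * H (y - x) (y - x) with hψ
  have hd : ∀ y, DifferentiableAt ℝ φ y →
      HasFDerivAt ψ (fderiv ℝ φ y - A - H (y - x)) y := by
    intro y hy
    have h1 : HasFDerivAt (fun y : E n => y - x) (ContinuousLinearMap.id ℝ (E n)) y :=
      (hasFDerivAt_id y).sub_const x
    have h2 := A.hasFDerivAt.comp y h1
    have h3 := (H.hasFDerivAt.comp y h1).clm_apply h1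
    have h4 := (hy.hasFDerivAt.sub h2).sub (h3.const_mul (1 / 2 : ℝ))
    refine h4.congr_fderiv ?_
    ext v
    have hs := hsymm v (y - x)
    simp only [map_sub, sub_apply] at hs
    simp
    linarith
  have hlit := (differentiableAt_fderiv_of_contDiffAt h).hasFDerivAt.isLittleO.def hε
  have hball := hlit.and (eventually_differentiableAt_of_contDiffAt h)
  obtain ⟨δ, hδ, hsub⟩ := Metric.eventually_nhds_iff_ball.1 hball
  filter_upwards [Metric.ball_mem_nhds x hδ] with y hy
  have hmem : ∀ z ∈ Metric.closedBall x ‖y - x‖, z ∈ Metric.ball x δ := by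
    intro z hz
    rw [Metric.mem_closedBall] at hz
    rw [Metric.mem_ball, dist_eq_norm] at hy
    exact Metric.mem_ball.2 (hz.trans_lt hy)
  have hmv := (convex_closedBall x ‖y - x‖).norm_image_sub_le_of_norm_hasFDerivWithin_le
    (f := ψ) (C := ε * ‖y - x‖) (x := x) (y := y)
    (fun z hz => (hd z (hsub z (hmem z hz)).2).hasFDerivWithinAt)
    (fun z hz => by
      refine (hsub z (hmem z hz)).1.trans ?_
      gcongr
      simpa [dist_eq_norm] using hz)
    (by simp) (by simp [dist_eq_norm])
  have : ψ y - ψ x = φ y - φ x - A (y - x) - 1 / 2 * H (y - x) (y - x) := by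
    simp [hψ]; ring
  rw [this, Real.norm_eq_abs] at hmv
  calc _ ≤ _ := hmv
    _ = _ := by ring

theorem fderiv_fderiv_nonneg_of_isLocalMin {φ : E n → ℝ} {x : E n} (h : ContDiffAt ℝ 2 φ x)
    (hm : IsLocalMin φ x) (v : E n) : 0 ≤ fderiv ℝ (fderiv ℝ φ) x v v := by
  have hz : fderiv ℝ φ x = 0 := hm.fderiv_eq_zero
  refine le_of_forall_pos_le_add fun η hη => ?_
  obtain ⟨ε, hε, hεη⟩ : ∃ ε : ℝ, 0 < ε ∧ 2 * ε * ‖v‖ ^ 2 ≤ η := by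
    refine ⟨η / (2 * (‖v‖ ^ 2 + 1)), by positivity, ?_⟩
    rw [← sub_nonneg]
    have : η - 2 * (η / (2 * (‖v‖ ^ 2 + 1))) * ‖v‖ ^ 2 = η / (‖v‖ ^ 2 + 1) := by
      field_simp; ring
    rw [this]; positivity
  have hc : Tendsto (fun t : ℝ => x + t • v) (𝓝[>] 0) (𝓝 x) := by
    have : Tendsto (fun t : ℝ => x + t • v) (𝓝 0) (𝓝 (x + (0 : ℝ) • v)) :=
      (continuous_const.add (continuous_id.smul continuous_const)).tendsto 0
    simpa using this.mono_left nhdsWithin_le_nhds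
  obtain ⟨t, ht, h1, h2⟩ := ((eventually_mem_nhdsWithin (a := (0 : ℝ)) (s := Set.Ioi 0)).and
    ((hc.eventually (taylor_two h hε)).and (hc.eventually hm))).exists
  have ht' : (0 : ℝ) < t := ht
  simp only [add_sub_cancel_left, hz, zero_apply, map_smul,
    smul_apply, smul_eq_mul, norm_smul, Real.norm_eq_abs] at h1
  have h3 := (abs_le.1 h1).2
  rw [mul_pow, sq_abs] at h3
  have h5 : 0 ≤ t ^ 2 * (1 / 2 * fderiv ℝ (fderiv ℝ φ) x v v + ε * ‖v‖ ^ 2) := by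
    nlinarith
  have h6 := nonneg_of_mul_nonneg_right h5 (by positivity : 0 < t ^ 2)
  linarith

theorem posSemidef_hessian_of_isLocalMin {φ : E n → ℝ} {x : E n} (h : ContDiffAt ℝ 2 φ x)
    (hm : IsLocalMin φ x) : (hessian φ x).PosSemidef := by
  refine Matrix.PosSemidef.of_dotProduct_mulVec_nonneg ?_ fun v => ?_
  · rw [Matrix.IsHermitian, Matrix.conjTranspose_eq_transpose_of_trivial]
    exact isSymm_hessian h
  · have := fderiv_fderiv_nonneg_of_isLocalMin h hm (WithLp.toLp 2 v)
    rw [← dotProduct_hessian_mulVec] at this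
    simpa using this

theorem hessian_eq_of_hasFDerivAt {φ : E n → ℝ} {φ' : E n → E n →L[ℝ] ℝ} {x : E n}
    {φ'' : E n →L[ℝ] E n →L[ℝ] ℝ} (h1 : ∀ᶠ y in 𝓝 x, HasFDerivAt φ (φ' y) y)
    (h2 : HasFDerivAt φ' φ'' x) :
    hessian φ x = Matrix.of fun i j =>
      φ'' (EuclideanSpace.single i 1) (EuclideanSpace.single j 1) := by
  have : fderiv ℝ φ =ᶠ[𝓝 x] φ' := h1.mono fun y hy => hy.fderiv
  rw [hessian, this.fderiv_eq, h2.fderiv]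

theorem hessian_add {φ ψ : E n → ℝ} {x : E n} (hφ : ContDiffAt ℝ 2 φ x)
    (hψ : ContDiffAt ℝ 2 ψ x) : hessian (fun y => φ y + ψ y) x = hessian φ x + hessian ψ x := by
  rw [hessian_eq_of_hasFDerivAt (φ' := fun y => fderiv ℝ φ y + fderiv ℝ ψ y)
    (φ'' := fderiv ℝ (fderiv ℝ φ) x + fderiv ℝ (fderiv ℝ ψ) x)]
  · ext i j; simp [hessian]
  · filter_upwards [eventually_differentiableAt_of_contDiffAt hφ,
      eventually_differentiableAt_of_contDiffAt hψ] with y h1 h2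
    exact h1.hasFDerivAt.add h2.hasFDerivAt
  · exact (differentiableAt_fderiv_of_contDiffAt hφ).hasFDerivAt.add
      (differentiableAt_fderiv_of_contDiffAt hψ).hasFDerivAt

theorem hessian_const_mul {φ : E n → ℝ} {x : E n} (hφ : ContDiffAt ℝ 2 φ x) (c : ℝ) :
    hessian (fun y => c * φ y) x = c • hessian φ x := by
  rw [hessian_eq_of_hasFDerivAt (φ' := fun y => c • fderiv ℝ φ y)
    (φ'' := c • fderiv ℝ (fderiv ℝ φ) x)]
  · ext i j; simp [hessian]
  · filter_upwards [eventually_differentiableAt_of_contDiffAt hφ] with y h1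
    exact h1.hasFDerivAt.const_mul c
  · exact (differentiableAt_fderiv_of_contDiffAt hφ).hasFDerivAt.const_smul c

theorem hessian_add_const (φ : E n → ℝ) (c : ℝ) (x : E n) :
    hessian (fun y => φ y + c) x = hessian φ x := by
  have : fderiv ℝ (fun y => φ y + c) = fderiv ℝ φ := by
    ext y v; simp
  simp [hessian, this]

/-- The chain rule without a first order term, since the inner map is affine. It serves both the
translation of barriers and the invariance of subharmonicity under rotations and dilations. -/
theorem hessian_comp_affine {φ : E n → ℝ} (M : Matrix (Fin n) (Fin n) ℝ) (L : E n →L[ℝ] E n)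
    (hL : ∀ v, (L v).ofLp = M.mulVec v.ofLp) (c x : E n) (h : ContDiffAt ℝ 2 φ (L x + c)) :
    hessian (fun y => φ (L y + c)) x = M.transpose * hessian φ (L x + c) * M := by
  have hA : ∀ y, HasFDerivAt (fun y => L y + c) L y := fun y => L.hasFDerivAt.add_const c
  rw [hessian_eq_of_hasFDerivAt (φ' := fun y => (fderiv ℝ φ (L y + c)).comp L)
    (φ'' := ((ContinuousLinearMap.compL ℝ (E n) (E n) ℝ).flip L).comp
      ((fderiv ℝ (fderiv ℝ φ) (L x + c)).comp L))]
  · ext i j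
    simp only [Matrix.of_apply, ContinuousLinearMap.comp_apply, ContinuousLinearMap.flip_apply,
      ContinuousLinearMap.compL_apply]
    rw [← dotProduct_hessian_mulVec, hL, hL, PiLp.ofLp_single,
      PiLp.ofLp_single, Matrix.mulVec_single_one, Matrix.mulVec_single_one]
    rw [Matrix.mul_assoc]
    simp [Matrix.mul_apply, dotProduct, Matrix.mulVec, Matrix.col]
  · have hc : Tendsto (fun y => L y + c) (𝓝 x) (𝓝 (L x + c)) :=
      (L.continuous.add continuous_const).tendsto x
    filter_upwards [hc.eventually (eventually_differentiableAt_of_contDiffAt h)] with y hy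
    exact hy.hasFDerivAt.comp y (hA y)
  · exact ((ContinuousLinearMap.compL ℝ (E n) (E n) ℝ).flip L).hasFDerivAt.comp x
      ((differentiableAt_fderiv_of_contDiffAt h).hasFDerivAt.comp x (hA x))

end Calculus

/-! ### Matrices in F and the Riesz characteristic. -/

section Algebra

variable {n : ℕ} {F : Set (Matrix (Fin n) (Fin n) ℝ)}

theorem posSemidef_lineProj (e : E n) : (lineProj e).PosSemidef := by
  simpa [lineProj] using Matrix.posSemidef_vecMulVec_self_star e.ofLp

theorem norm_sq_eq_dotProduct (v : E n) : ‖v‖ ^ 2 = v.ofLp ⬝ᵥ v.ofLp := by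
  rw [EuclideanSpace.real_norm_sq_eq]
  simp [dotProduct, sq]

theorem posSemidef_one_sub_lineProj {e : E n} (he : ‖e‖ = 1) : (1 - lineProj e).PosSemidef := by
  refine Matrix.PosSemidef.of_dotProduct_mulVec_nonneg
    (Matrix.isHermitian_one.sub (posSemidef_lineProj e).1) fun v => ?_
  have h := real_inner_mul_inner_self_le (WithLp.toLp 2 v) e
  rw [real_inner_self_eq_norm_sq, real_inner_self_eq_norm_sq, he,
    norm_sq_eq_dotProduct] at h
  simp only [EuclideanSpace.inner_eq_star_dotProduct, star_trivial] at h
  simp only [star_trivial, Matrix.sub_mulVec, Matrix.one_mulVec, dotProduct_sub, lineProj,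
    Matrix.vecMulVec_mulVec, dotProduct_smul, MulOpposite.smul_eq_mul_unop,
    MulOpposite.unop_op]
  rw [dotProduct_comm v e.ofLp]
  linarith

namespace IsSTConeSubequation

theorem zero_mem (hF : IsSTConeSubequation F) : (0 : Matrix (Fin n) (Fin n) ℝ) ∈ F := by
  obtain ⟨A, hA⟩ := hF.nonempty
  simpa using hF.cone A hA 0 le_rfl

theorem mem_of_posSemidef (hF : IsSTConeSubequation F) {P : Matrix (Fin n) (Fin n) ℝ}
    (hP : P.PosSemidef) : P ∈ F := by
  simpa using hF.positivity 0 hF.zero_mem P hP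

theorem conj_lineProj (g : Matrix.orthogonalGroup (Fin n) ℝ) {e e' : E n}
    (h : Matrix.mulVec (g : Matrix (Fin n) (Fin n) ℝ) e.ofLp = e'.ofLp) :
    (g : Matrix (Fin n) (Fin n) ℝ) * lineProj e *
      (g : Matrix (Fin n) (Fin n) ℝ).transpose = lineProj e' := by
  rw [lineProj, Matrix.mul_vecMulVec, Matrix.vecMulVec_mul, Matrix.vecMul_transpose, h, lineProj]

/-- `rieszChar` demands membership for all unit vectors at once. Conjugation by the transitive group
carries membership from one direction to every other, so a single e suffices. -/
theorem le_of_mem (hF : IsSTConeSubequation F) {p : ℝ} (hp : rieszChar F = (p : EReal)) {q : ℝ}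
    {e : E n} (he : ‖e‖ = 1) (h : (1 - lineProj e) - (q - 1) • lineProj e ∈ F) : q ≤ p := by
  have : (q : EReal) ≤ rieszChar F := by
    refine le_sSup ⟨q, fun e' he' => ?_, rfl⟩
    obtain ⟨G, hG, hinv⟩ := hF.invariant
    obtain ⟨g, hg, hge⟩ := hG e e' he he'
    have h1 := hinv g hg _ h
    have h2 : (g : Matrix (Fin n) (Fin n) ℝ) * (g : Matrix (Fin n) (Fin n) ℝ).transpose = 1 := by
      simpa [Matrix.star_eq_conjTranspose] using
        (Matrix.mem_orthogonalGroup_iff (Fin n) ℝ).1 g.2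
    rwa [Matrix.mul_sub, Matrix.sub_mul, Matrix.mul_sub, Matrix.sub_mul, Matrix.mul_one, h2,
      Matrix.mul_smul, Matrix.smul_mul, conj_lineProj g hge] at h1
  rw [hp] at this
  exact_mod_cast this

theorem one_le (hF : IsSTConeSubequation F) {p : ℝ} (hp : rieszChar F = (p : EReal))
    {e : E n} (he : ‖e‖ = 1) : 1 ≤ p :=
  hF.le_of_mem hp he (by simpa using hF.mem_of_posSemidef (posSemidef_one_sub_lineProj he))

/-- The Hessian of an increasing Riesz kernel, shifted by a negative multiple of the identity,
is not in `F`. -/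
theorem notMem (hF : IsSTConeSubequation F) {p : ℝ} (hp : rieszChar F = (p : EReal))
    {e : E n} (he : ‖e‖ = 1) {s ε : ℝ} (hs : 0 ≤ s) (hε : 0 < ε) :
    s • (1 - p • lineProj e) - ε • (1 : Matrix (Fin n) (Fin n) ℝ) ∉ F := by
  intro h
  have hp1 := hF.one_le hp he
  -- Any δ > 0 with δ p < ε would do. It keeps s + δ positive even when s = 0, so that the division
  -- below is legitimate.
  set δ := ε / (2 * p) with hδ
  have hδ0 : 0 < δ := by positivity
  have hδp : δ * p < ε := by
    have : δ * p = ε / 2 := by rw [hδ]; field_simp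
    linarith
  -- Adding (ε + δ)(I - P_e) raises the tangential eigenvalue to s + δ and leaves the radial one
  -- alone. After normalization the exponent is q = (s p + ε + δ)/(s + δ), which exceeds p.
  have h1 := hF.positivity _ h _
    ((posSemidef_one_sub_lineProj he).smul (by positivity : (0 : ℝ) ≤ ε + δ))
  have h2 := hF.cone _ h1 (s + δ)⁻¹ (by positivity)
  have h3 : (s + δ)⁻¹ • (s • (1 - p • lineProj e) - ε • (1 : Matrix (Fin n) (Fin n) ℝ) +
      (ε + δ) • (1 - lineProj e)) =
      (1 - lineProj e) - ((s * p + ε + δ) / (s + δ) - 1) • lineProj e := by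
    rw [inv_smul_eq_iff₀ (by positivity)]
    have : (s + δ) * ((s * p + ε + δ) / (s + δ) - 1) = s * p + ε - s := by
      field_simp; ring
    rw [smul_sub (s + δ), smul_smul, this]
    module
  rw [h3] at h2
  have h4 := hF.le_of_mem hp he h2
  rw [div_le_iff₀ (by positivity)] at h4
  nlinarith

theorem neg_smul_one_notMem (hF : IsSTConeSubequation F) {p : ℝ} (hp : rieszChar F = (p : EReal))
    {e : E n} (he : ‖e‖ = 1) {ε : ℝ} (hε : 0 < ε) :
    (-ε) • (1 : Matrix (Fin n) (Fin n) ℝ) ∉ F := by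
  simpa using hF.notMem hp he (s := 0) le_rfl hε

end IsSTConeSubequation

end Algebra

/-! ### The Riesz kernel and Hessians of radial functions. -/

section Kernel

/-- All three kernels have derivative a positive constant times t^(1 - p). Together with C²
regularity this is all that is needed of K, and the distinction of cases ends there. -/
theorem exists_hasDerivAt_rieszKernel (p : ℝ) :
    ∃ c : ℝ, 0 < c ∧ ∀ t : ℝ, 0 < t → HasDerivAt (rieszKernel p) (c * t ^ (1 - p)) t := by
  rcases lt_trichotomy p 2 with h | h | h
  · refine ⟨2 - p, by linarith, fun t ht => ?_⟩
    have : rieszKernel p = fun t => t ^ (2 - p) := by ext t; simp [rieszKernel, h]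
    rw [this]
    convert Real.hasDerivAt_rpow_const (p := 2 - p) (Or.inl ht.ne') using 3
    ring
  · refine ⟨1, one_pos, fun t ht => ?_⟩
    have : rieszKernel p = Real.log := by ext t; simp [rieszKernel, h]
    rw [this]
    convert Real.hasDerivAt_log ht.ne' using 1
    rw [h, one_mul, ← Real.rpow_neg_one]
    norm_num
  · refine ⟨p - 2, by linarith, fun t ht => ?_⟩
    have : rieszKernel p =ᶠ[𝓝 t] fun t => -(t ^ (2 - p)) := by
      filter_upwards [lt_mem_nhds ht] with s hs
      have h2 : 2 - p = -(p - 2) := by ring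
      rw [rieszKernel, if_neg (by linarith), if_neg (by linarith), h2, Real.rpow_neg hs.le,
        one_div]
    refine HasDerivAt.congr_of_eventuallyEq ?_ this
    convert (Real.hasDerivAt_rpow_const (p := 2 - p) (Or.inl ht.ne')).fun_neg using 1
    rw [show 2 - p - 1 = 1 - p by ring]
    ring

theorem contDiffAt_rieszKernel (p : ℝ) {t : ℝ} (ht : 0 < t) :
    ContDiffAt ℝ 2 (rieszKernel p) t := by
  rcases lt_trichotomy p 2 with h | h | h
  · have : rieszKernel p = fun t => t ^ (2 - p) := by ext t; simp [rieszKernel, h]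
    rw [this]
    exact Real.contDiffAt_rpow_const_of_ne ht.ne'
  · have : rieszKernel p = Real.log := by ext t; simp [rieszKernel, h]
    rw [this]
    exact Real.contDiffAt_log.2 ht.ne'
  · have : rieszKernel p = fun t => -(1 / t ^ (p - 2)) := by
      ext t; rw [rieszKernel, if_neg (by linarith), if_neg (by linarith)]
    rw [this]
    exact (contDiffAt_const.div (Real.contDiffAt_rpow_const_of_ne ht.ne')
      (Real.rpow_pos_of_pos ht _).ne').neg

theorem continuousOn_rieszKernel (p : ℝ) : ContinuousOn (rieszKernel p) (Set.Ioi 0) := by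
  obtain ⟨c, -, h⟩ := exists_hasDerivAt_rieszKernel p
  exact fun t ht => (h t ht).continuousAt.continuousWithinAt

theorem strictMonoOn_rieszKernel (p : ℝ) : StrictMonoOn (rieszKernel p) (Set.Ioi 0) := by
  obtain ⟨c, hc, h⟩ := exists_hasDerivAt_rieszKernel p
  refine strictMonoOn_of_deriv_pos (convex_Ioi 0) (continuousOn_rieszKernel p) fun t ht => ?_
  rw [interior_Ioi] at ht
  rw [(h t ht).deriv]
  exact mul_pos hc (Real.rpow_pos_of_pos ht _)

theorem rieszKernel_lt (p : ℝ) {s t : ℝ} (hs : 0 < s) (hst : s < t) :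
    rieszKernel p s < rieszKernel p t :=
  strictMonoOn_rieszKernel p hs (hs.trans hst) hst

/-- The Hessian of a smooth function of `‖y‖ ^ 2`. -/
theorem hessian_radial {n : ℕ} {f f' : ℝ → ℝ} {f'' : ℝ} {x : E n}
    (h1 : ∀ᶠ s in 𝓝 (‖x‖ ^ 2), HasDerivAt f (f' s) s) (h2 : HasDerivAt f' f'' (‖x‖ ^ 2)) :
    hessian (fun y => f (‖y‖ ^ 2)) x =
      (2 * f' (‖x‖ ^ 2)) • (1 : Matrix (Fin n) (Fin n) ℝ) + (4 * f'') • lineProj x := by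
  have hsq : ∀ y : E n, HasFDerivAt (fun y : E n => ‖y‖ ^ 2) (2 • innerSL ℝ y) y :=
    fun y => (hasStrictFDerivAt_norm_sq y).hasFDerivAt
  have hc : Tendsto (fun y : E n => ‖y‖ ^ 2) (𝓝 x) (𝓝 (‖x‖ ^ 2)) :=
    (continuous_norm.pow 2).tendsto x
  rw [hessian_eq_of_hasFDerivAt (φ' := fun y => f' (‖y‖ ^ 2) • (2 • innerSL ℝ y))
    (φ'' := f' (‖x‖ ^ 2) • (2 • innerSL ℝ) +
      (f'' • (2 • innerSL ℝ x)).smulRight (2 • innerSL ℝ x))]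
  · ext i j
    have hij : innerSL ℝ (EuclideanSpace.single i (1 : ℝ)) (EuclideanSpace.single j (1 : ℝ)) =
        if i = j then 1 else 0 := by
      simp [innerSL_apply_apply, EuclideanSpace.inner_single_left]
    simp [lineProj, Matrix.vecMulVec_apply, Matrix.one_apply, hij,
      EuclideanSpace.inner_single_right]
    split_ifs <;> ring
  · filter_upwards [hc.eventually h1] with y hy
    exact hy.comp_hasFDerivAt y (hsq y)
  · have h3 : HasFDerivAt (fun y : E n => 2 • innerSL ℝ y)
        (2 • innerSL ℝ : E n →L[ℝ] E n →L[ℝ] ℝ) x :=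
      (2 • innerSL ℝ : E n →L[ℝ] E n →L[ℝ] ℝ).hasFDerivAt
    exact (h2.comp_hasFDerivAt x (hsq x)).smul h3

end Kernel

/-! ### Radial barriers and their Hessians. -/

section Barrier

variable {n : ℕ} {F : Set (Matrix (Fin n) (Fin n) ℝ)}

theorem lineProj_smul (t : ℝ) (e : E n) : lineProj (t • e) = t ^ 2 • lineProj e := by
  ext i j
  simp [lineProj, Matrix.vecMulVec_apply]
  ring

/-- The radial barrier `a K_p(|y - x|) + b - ε |y - x|²`. -/
noncomputable def barrier (p a b ε : ℝ) (x y : E n) : ℝ :=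
  a * rieszKernel p ‖y - x‖ + b - ε * ‖y - x‖ ^ 2

theorem contDiffAt_barrier (p a b ε : ℝ) {x y : E n} (h : y ≠ x) :
    ContDiffAt ℝ 2 (barrier p a b ε x) y := by
  have h0 : y - x ≠ 0 := sub_ne_zero.2 h
  have h1 : ContDiffAt ℝ 2 (fun y : E n => y - x) y := contDiffAt_id.sub contDiffAt_const
  have h2 : ContDiffAt ℝ 2 (fun y : E n => ‖y - x‖) y := h1.norm ℝ h0
  have h3 : ContDiffAt ℝ 2 (fun y : E n => rieszKernel p ‖y - x‖) y :=
    ContDiffAt.comp (g := rieszKernel p) y (contDiffAt_rieszKernel p (norm_pos_iff.2 h0)) h2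
  exact ((contDiffAt_const.mul h3).add contDiffAt_const).sub (contDiffAt_const.mul (h2.pow 2))

theorem contDiffAt_barrier_zero (p b ε : ℝ) (x y : E n) :
    ContDiffAt ℝ 2 (barrier p 0 b ε x) y := by
  have h1 : ContDiffAt ℝ 2 (fun y : E n => y - x) y := contDiffAt_id.sub contDiffAt_const
  have : barrier p 0 b ε x = fun y => b - ε * ‖y - x‖ ^ 2 := by ext y; simp [barrier]
  rw [this]
  exact contDiffAt_const.sub (contDiffAt_const.mul (h1.norm_sq ℝ))

theorem hessian_sub_const_right {φ : E n → ℝ} (x y : E n)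
    (h : ContDiffAt ℝ 2 φ (y - x)) : hessian (fun y => φ (y - x)) y = hessian φ (y - x) := by
  have := hessian_comp_affine (φ := φ) 1 (ContinuousLinearMap.id ℝ (E n)) (by simp) (-x) y
    (by simpa [← sub_eq_add_neg] using h)
  simpa [← sub_eq_add_neg] using this

/-- The tangential eigenvalue of D² K(|z|) is K'(|z|)/|z| and the radial one is K''(|z|) = (1 - p)
K'(|z|)/|z|, because K' is a multiple of t^(1 - p). This gives the form s(I - p P_e) excluded by
`notMem` once the quadratic term is subtracted. -/
theorem exists_hessian_barrier (p b ε : ℝ) {a : ℝ} (ha : 0 ≤ a) {x y : E n} (h : y ≠ x) :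
    ∃ s : ℝ, 0 ≤ s ∧ ∃ e : E n, ‖e‖ = 1 ∧ hessian (barrier p a b ε x) y =
      s • (1 - p • lineProj e) - (2 * ε) • (1 : Matrix (Fin n) (Fin n) ℝ) := by
  obtain ⟨c, hc, hK⟩ := exists_hasDerivAt_rieszKernel p
  have h0 : 0 < ‖y - x‖ := norm_pos_iff.2 (sub_ne_zero.2 h)
  set z := y - x with hz
  set e := ‖z‖⁻¹ • z with he
  have hze : z = ‖z‖ • e := by rw [he, smul_smul, mul_inv_cancel₀ h0.ne', one_smul]
  refine ⟨a * (c * (‖z‖ ^ 2) ^ (-p / 2)), by positivity, e,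
    by rw [he, norm_smul, norm_inv, norm_norm, inv_mul_cancel₀ h0.ne'], ?_⟩
  -- Written in terms of |y|², so that only a smooth function of a quadratic form has to be
  -- differentiated.
  have hfun : (fun y : E n => a * rieszKernel p (√(‖y‖ ^ 2)) + b - ε * ‖y‖ ^ 2) =
      barrier p a b ε 0 := by
    ext y; simp [barrier, Real.sqrt_sq]
  have htr : barrier p a b ε x = fun y => barrier p a b ε 0 (y - x) := by
    ext y; simp [barrier]
  rw [htr, hessian_sub_const_right x y (contDiffAt_barrier p a b ε (norm_pos_iff.1 h0)), ← hz,
    ← hfun]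
  have hs0 : (0 : ℝ) < ‖z‖ ^ 2 := by positivity
  have h1 : ∀ s : ℝ, 0 < s → HasDerivAt (fun s => a * rieszKernel p (√s) + b - ε * s)
      (a * (c / 2 * s ^ (-p / 2)) - ε) s := by
    intro s hs
    have h2 := (hK _ (Real.sqrt_pos.2 hs)).comp s (Real.hasDerivAt_sqrt hs.ne')
    have h3 := ((h2.const_mul a).add_const b).sub ((hasDerivAt_id s).const_mul ε)
    refine h3.congr_deriv ?_
    have : s ^ (-p / 2) = √s ^ (1 - p) / √s := by
      rw [Real.sqrt_eq_rpow, ← Real.rpow_mul hs.le, ← Real.rpow_sub hs]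
      ring_nf
    rw [this]; ring
  have h2 : HasDerivAt (fun s : ℝ => a * (c / 2 * s ^ (-p / 2)) - ε)
      (a * (c / 2 * ((-p / 2) * (‖z‖ ^ 2) ^ (-p / 2 - 1)))) (‖z‖ ^ 2) :=
    (((Real.hasDerivAt_rpow_const (Or.inl hs0.ne')).const_mul (c / 2)).const_mul a).sub_const ε
  rw [hessian_radial (f := fun s => a * rieszKernel p (√s) + b - ε * s)
    ((lt_mem_nhds hs0).mono h1) h2]
  have h4 : lineProj z = ‖z‖ ^ 2 • lineProj e := by rw [← lineProj_smul, ← hze]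
  have h5 : (‖z‖ ^ 2) ^ (-p / 2 - 1) * ‖z‖ ^ 2 = (‖z‖ ^ 2) ^ (-p / 2) := by
    rw [Real.rpow_sub_one hs0.ne', div_mul_cancel₀ _ hs0.ne']
  rw [h4, smul_smul]
  have h6 : 4 * (a * (c / 2 * (-p / 2 * (‖z‖ ^ 2) ^ (-p / 2 - 1)))) * ‖z‖ ^ 2 =
      - (p * (a * (c * (‖z‖ ^ 2) ^ (-p / 2)))) := by
    rw [← h5]; ring
  rw [h6]
  module

theorem hessian_barrier_zero (p b ε : ℝ) (x y : E n) :
    hessian (barrier p 0 b ε x) y = (-(2 * ε)) • (1 : Matrix (Fin n) (Fin n) ℝ) := by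
  have hfun : barrier p 0 b ε (0 : E n) = fun y => (fun s => b - ε * s) (‖y‖ ^ 2) := by
    ext y; simp [barrier]
  have htr : barrier p 0 b ε x = fun y => barrier p 0 b ε 0 (y - x) := by
    ext y; simp [barrier]
  have h1 : ∀ s : ℝ, HasDerivAt (fun s => b - ε * s) (-ε) s := fun s => by
    simpa using ((hasDerivAt_id s).const_mul ε).const_sub b
  rw [htr, hessian_sub_const_right x y (contDiffAt_barrier_zero _ _ _ _ _), hfun,
    hessian_radial (f' := fun _ => -ε) (Eventually.of_forall h1) (hasDerivAt_const _ _)]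
  simp

end Barrier

/-! ### Comparison principle on annuli and balls. -/

section Comparison

variable {n : ℕ} {F : Set (Matrix (Fin n) (Fin n) ℝ)} {X : Set (E n)} {u : E n → EReal}

/-- The upper semi-continuous function u - h attains its maximum on K. If the maximum is positive it
is attained in O, where a vertical translate of h touches u from above; the viscosity condition then
puts the Hessian of h into F. -/
theorem IsSubharmonicOn.le_of_hessian_notMem (hu : IsSubharmonicOn F X u) {K O : Set (E n)}
    (hK : IsCompact K) (hKX : K ⊆ X) (hO : IsOpen O) (hOK : O ⊆ K) {h : E n → ℝ}
    (hc : ContinuousOn h K) (hd : ∀ y ∈ O, ContDiffAt ℝ 2 h y) (hh : ∀ y ∈ O, hessian h y ∉ F)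
    (hb : ∀ y ∈ K, y ∉ O → u y ≤ h y) : ∀ y ∈ K, u y ≤ h y := by
  intro y₁ hy₁
  by_contra hlt
  rw [not_le] at hlt
  have husc : UpperSemicontinuousOn (fun y => u y + ((-h y : ℝ) : EReal)) K := by
    refine UpperSemicontinuousOn.add' (hu.usc.mono hKX) ?_ fun y hy => ?_
    · exact (continuous_coe_real_ereal.comp_continuousOn hc.neg).upperSemicontinuousOn
    · exact EReal.continuousAt_add (Or.inr (EReal.coe_ne_bot _)) (Or.inr (EReal.coe_ne_top _))
  obtain ⟨y₀, hy₀, hmax⟩ := husc.exists_isMaxOn ⟨y₁, hy₁⟩ hK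
  have hmax' : ∀ y ∈ K, u y + ((-h y : ℝ) : EReal) ≤ u y₀ + ((-h y₀ : ℝ) : EReal) := hmax
  have htop := hu.ne_top y₀ (hKX hy₀)
  have hpos := hmax' y₁ hy₁
  have key : ∀ y ∈ K, ∀ c : ℝ, u y₀ = c → u y ≤ ((h y + (c - h y₀) : ℝ) : EReal) := by
    intro y hy c hc
    have h1 := hmax' y hy
    rw [hc] at h1
    induction hy' : u y with
    | bot => exact bot_le
    | top => exact absurd hy' (hu.ne_top y (hKX hy))
    | coe d =>
      rw [hy'] at h1
      have h2 : d + -h y ≤ c + -h y₀ := by exact_mod_cast h1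
      exact_mod_cast (by linarith : d ≤ h y + (c - h y₀))
  induction hy₀' : u y₀ with
  | top => exact htop hy₀'
  | bot =>
    rw [hy₀', EReal.bot_add] at hpos
    have := le_bot_iff.1 hpos
    rw [EReal.add_eq_bot_iff] at this
    rcases this with h1 | h1
    · rw [h1] at hlt; exact not_lt_bot hlt
    · exact EReal.coe_ne_bot _ h1
  | coe c =>
    have h1 := lt_of_lt_of_le hlt (key y₁ hy₁ c hy₀')
    have h2 : h y₁ < h y₁ + (c - h y₀) := by exact_mod_cast h1
    by_cases hmem : y₀ ∈ O
    · refine hh y₀ hmem ?_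
      rw [← hessian_add_const h (c - h y₀)]
      refine hu.viscosity y₀ (hKX hy₀) _ ((hd y₀ hmem).add contDiffAt_const) ?_ ?_
      · rw [hy₀']; congr 1; ring
      · filter_upwards [hO.mem_nhds hmem] with y hy
        exact key y (hOK hy) c hy₀'
    · have h3 := hb y₀ hy₀ hmem
      rw [hy₀'] at h3
      have : c ≤ h y₀ := by exact_mod_cast h3
      linarith

theorem ereal_le_coe_of_forall_pos {a : EReal} {b : ℝ} (C : ℝ)
    (h : ∀ ε : ℝ, 0 < ε → a ≤ ((b + ε * C : ℝ) : EReal)) : a ≤ b := by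
  have hc : Tendsto (fun ε : ℝ => ((b + ε * C : ℝ) : EReal)) (𝓝[>] 0) (𝓝 (b : EReal)) := by
    have : Tendsto (fun ε : ℝ => b + ε * C) (𝓝 0) (𝓝 (b + 0 * C)) :=
      (continuous_const.add (continuous_id.mul continuous_const)).tendsto 0
    rw [zero_mul, add_zero] at this
    exact (continuous_coe_real_ereal.tendsto b).comp (this.mono_left nhdsWithin_le_nhds)
  exact ge_of_tendsto hc (eventually_mem_nhdsWithin.mono fun ε hε => h ε hε)

theorem IsSubharmonicOn.le_on_annulus (hF : IsSTConeSubequation F) {p : ℝ}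
    (hp : rieszChar F = (p : EReal)) (hu : IsSubharmonicOn F X u) {x : E n} {r₁ r₂ : ℝ}
    (hr₁ : 0 < r₁) (hX : Metric.closedBall x r₂ ⊆ X) {a b : ℝ} (ha : 0 ≤ a)
    (h₁ : ∀ y, ‖y - x‖ = r₁ → u y ≤ ((a * rieszKernel p r₁ + b : ℝ) : EReal))
    (h₂ : ∀ y, ‖y - x‖ = r₂ → u y ≤ ((a * rieszKernel p r₂ + b : ℝ) : EReal))
    {y : E n} (hy₁ : r₁ ≤ ‖y - x‖) (hy₂ : ‖y - x‖ ≤ r₂) :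
    u y ≤ ((a * rieszKernel p ‖y - x‖ + b : ℝ) : EReal) := by
  refine ereal_le_coe_of_forall_pos (r₂ ^ 2 - ‖y - x‖ ^ 2) fun ε hε => ?_
  have hcn : Continuous fun y : E n => ‖y - x‖ := by fun_prop
  have hne : ∀ y : E n, r₁ ≤ ‖y - x‖ → y ≠ x := fun y hy h => by
    rw [h, sub_self, norm_zero] at hy; linarith
  -- The constant ε r₂² keeps the perturbed barrier above a K + b on the whole annulus, while -ε|y -
  -- x|² makes it strict. Letting ε → 0 removes the perturbation.
  have hcmp := hu.le_of_hessian_notMem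
    (K := Metric.closedBall x r₂ ∩ {y | r₁ ≤ ‖y - x‖})
    (O := {y | ‖y - x‖ < r₂} ∩ {y | r₁ < ‖y - x‖})
    (h := barrier p a (b + ε * r₂ ^ 2) ε x)
    ((isCompact_closedBall x r₂).inter_right (isClosed_le continuous_const hcn))
    (Set.inter_subset_left.trans hX)
    ((isOpen_lt hcn continuous_const).inter (isOpen_lt continuous_const hcn))
    (fun y hy => ⟨by simpa [dist_eq_norm] using le_of_lt hy.1, (show r₁ < ‖y - x‖ from hy.2).le⟩)
    (fun y hy => (contDiffAt_barrier p _ _ _ (hne y hy.2)).continuousAt.continuousWithinAt)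
    (fun y hy => contDiffAt_barrier p _ _ _ (hne y hy.2.le))
    (fun y hy => by
      obtain ⟨s, hs, e, he, hH⟩ :=
        exists_hessian_barrier p (b + ε * r₂ ^ 2) ε ha (hne y hy.2.le)
      rw [hH]
      exact hF.notMem hp he hs (by positivity))
    (fun y hy hyO => by
      have hy2 : ‖y - x‖ ≤ r₂ := by simpa [dist_eq_norm] using hy.1
      have hy1 : r₁ ≤ ‖y - x‖ := hy.2
      have hbd : ‖y - x‖ = r₁ ∨ ‖y - x‖ = r₂ := by
        by_contra! hcon
        exact hyO ⟨lt_of_le_of_ne hy2 hcon.2, lt_of_le_of_ne hy1 (Ne.symm hcon.1)⟩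
      have hsq : ‖y - x‖ ^ 2 ≤ r₂ ^ 2 := by gcongr
      have hle : a * rieszKernel p ‖y - x‖ + b ≤ barrier p a (b + ε * r₂ ^ 2) ε x y := by
        rw [barrier]; nlinarith
      refine le_trans ?_ (EReal.coe_le_coe_iff.2 hle)
      rcases hbd with h | h
      · rw [h]; exact h₁ y h
      · rw [h]; exact h₂ y h)
    y ⟨by simpa [dist_eq_norm] using hy₂, hy₁⟩
  refine hcmp.trans (EReal.coe_le_coe_iff.2 (le_of_eq ?_))
  rw [barrier]; ring

/-- Same argument with a = 0: the barrier is then smooth at the centre too, and no inner sphere has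
to be removed. -/
theorem IsSubharmonicOn.le_on_closedBall (hF : IsSTConeSubequation F) {p : ℝ}
    (hp : rieszChar F = (p : EReal)) (hn : 1 ≤ n) (hu : IsSubharmonicOn F X u) {x : E n} {r : ℝ}
    (hX : Metric.closedBall x r ⊆ X) {b : ℝ} (h : ∀ y, ‖y - x‖ = r → u y ≤ (b : EReal))
    {y : E n} (hy : ‖y - x‖ ≤ r) : u y ≤ (b : EReal) := by
  obtain ⟨e, he⟩ : ∃ e : E n, ‖e‖ = 1 := ⟨EuclideanSpace.single ⟨0, hn⟩ 1, by simp⟩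
  refine ereal_le_coe_of_forall_pos (r ^ 2 - ‖y - x‖ ^ 2) fun ε hε => ?_
  have hcn : Continuous fun y : E n => ‖y - x‖ := by fun_prop
  have hcmp := hu.le_of_hessian_notMem (K := Metric.closedBall x r) (O := {y | ‖y - x‖ < r})
    (h := barrier p 0 (b + ε * r ^ 2) ε x) (isCompact_closedBall x r) hX
    (isOpen_lt hcn continuous_const) (fun y hy => by simpa [dist_eq_norm] using hy.le)
    (fun y _ => (contDiffAt_barrier_zero p _ _ _ y).continuousAt.continuousWithinAt)
    (fun y _ => contDiffAt_barrier_zero p _ _ _ y)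
    (fun y _ => by
      rw [hessian_barrier_zero]
      exact hF.neg_smul_one_notMem hp he (by positivity))
    (fun y hy hyO => by
      have hy2 : ‖y - x‖ ≤ r := by simpa [dist_eq_norm] using hy
      have hyr : ‖y - x‖ = r := le_antisymm hy2 (not_lt.1 hyO)
      refine (h y hyr).trans (EReal.coe_le_coe_iff.2 (le_of_eq ?_))
      rw [barrier, hyr]; ring)
    y (by simpa [dist_eq_norm] using hy)
  refine hcmp.trans (EReal.coe_le_coe_iff.2 (le_of_eq ?_))
  rw [barrier]; ring

end Comparison

/-! ### Functions of one variable that are convex in the Riesz kernel. -/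

section OneVariable

/-- `m` is nondecreasing and a convex function of `rieszKernel p` on `(0, R)`. -/
structure IsKernelConvex (p R : ℝ) (m : ℝ → ℝ) : Prop where
  mono : ∀ s t : ℝ, 0 < s → s ≤ t → t < R → m s ≤ m t
  conv : ∀ r₁ r r₂ : ℝ, 0 < r₁ → r₁ < r → r < r₂ → r₂ < R →
    (m r - m r₁) * (rieszKernel p r₂ - rieszKernel p r₁) ≤
      (m r₂ - m r₁) * (rieszKernel p r - rieszKernel p r₁)

/-- The slope of `m` with respect to `rieszKernel p`. -/
noncomputable def kernelSlope (p : ℝ) (m : ℝ → ℝ) (s t : ℝ) : ℝ :=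
  (m t - m s) / (rieszKernel p t - rieszKernel p s)

namespace IsKernelConvex

variable {p R : ℝ} {m : ℝ → ℝ}

theorem kernelSlope_nonneg (h : IsKernelConvex p R m) {s t : ℝ} (hs : 0 < s) (hst : s < t)
    (ht : t < R) : 0 ≤ kernelSlope p m s t :=
  div_nonneg (sub_nonneg.2 (h.mono s t hs hst.le ht)) (sub_nonneg.2 (rieszKernel_lt p hs hst).le)

theorem kernelSlope_le_right (h : IsKernelConvex p R m) {s t t' : ℝ} (hs : 0 < s) (hst : s < t)
    (htt : t ≤ t') (ht : t' < R) : kernelSlope p m s t ≤ kernelSlope p m s t' := by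
  rcases htt.eq_or_lt with rfl | htt
  · rfl
  rw [kernelSlope, kernelSlope, div_le_div_iff₀ (sub_pos.2 (rieszKernel_lt p hs hst))
    (sub_pos.2 (rieszKernel_lt p hs (hst.trans htt)))]
  exact h.conv s t t' hs hst htt ht

theorem kernelSlope_le_left (h : IsKernelConvex p R m) {s s' t : ℝ} (hs : 0 < s) (hss : s ≤ s')
    (hst : s' < t) (ht : t < R) : kernelSlope p m s t ≤ kernelSlope p m s' t := by
  rcases hss.eq_or_lt with rfl | hss
  · rfl
  rw [kernelSlope, kernelSlope, div_le_div_iff₀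
    (sub_pos.2 (rieszKernel_lt p hs (hss.trans hst)))
    (sub_pos.2 (rieszKernel_lt p (hs.trans hss) hst))]
  have := h.conv s s' t hs hss hst ht
  nlinarith

theorem kernelSlope_mono (h : IsKernelConvex p R m) {s t s' t' : ℝ} (hs : 0 < s) (hst : s < t)
    (hss : s ≤ s') (htt : t ≤ t') (hst' : s' < t') (ht : t' < R) :
    kernelSlope p m s t ≤ kernelSlope p m s' t' :=
  (h.kernelSlope_le_right hs hst htt ht).trans (h.kernelSlope_le_left hs hss hst' ht)

theorem continuousAt (h : IsKernelConvex p R m) {r : ℝ} (hr : 0 < r) (hrR : r < R) :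
    ContinuousAt m r := by
  obtain ⟨t₂, ht₂, ht₂R⟩ := exists_between hrR
  obtain ⟨t₁, ht₁, ht₁₂⟩ := exists_between ht₂
  -- By monotonicity of slopes, S bounds every slope over pairs in (0, t₁]. So m is Lipschitz as a
  -- function of K near r, and continuity follows from that of K.
  set S := kernelSlope p m t₁ t₂
  have hlt : ∀ s t, 0 < s → s < t → t ≤ t₁ →
      |m t - m s| ≤ S * |rieszKernel p t - rieszKernel p s| := by
    intro s t hs hst ht
    have hK := sub_pos.2 (rieszKernel_lt p hs hst)
    rw [abs_of_nonneg (sub_nonneg.2 (h.mono s t hs hst.le (by linarith))), abs_of_pos hK,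
      ← div_le_iff₀ hK]
    exact h.kernelSlope_mono hs hst (by linarith) (by linarith) ht₁₂ ht₂R
  have hle : ∀ s, 0 < s → s < t₁ → |m s - m r| ≤ S * |rieszKernel p s - rieszKernel p r| := by
    intro s hs hst
    rcases lt_trichotomy s r with h' | h' | h'
    · rw [abs_sub_comm, abs_sub_comm (rieszKernel p s)]
      exact hlt s r hs h' ht₁.le
    · simp [h']
    · exact hlt r s hr h' hst.le
  have hKc : ContinuousAt (rieszKernel p) r :=
    (continuousOn_rieszKernel p).continuousAt (Ioi_mem_nhds hr)
  rw [ContinuousAt, tendsto_iff_norm_sub_tendsto_zero]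
  refine squeeze_zero' (Eventually.of_forall fun _ => norm_nonneg _)
    (g := fun s => S * |rieszKernel p s - rieszKernel p r|) ?_ ?_
  · filter_upwards [Ioo_mem_nhds hr ht₁] with s hs using hle s hs.1 hs.2
  · have : ContinuousAt (fun s => S * |rieszKernel p s - rieszKernel p r|) r :=
      continuousAt_const.mul (hKc.sub continuousAt_const).abs
    simpa [ContinuousAt] using this

end IsKernelConvex

theorem mem_pairsToZero {δ : ℝ} (hδ : 0 < δ) :
    {q : ℝ × ℝ | 0 < q.1 ∧ q.1 < q.2 ∧ q.2 < δ} ∈ pairsToZero := by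
  have h1 : {q : ℝ × ℝ | q.2 < δ} ∈ 𝓝 ((0 : ℝ), (0 : ℝ)) :=
    (isOpen_lt continuous_snd continuous_const).mem_nhds hδ
  filter_upwards [self_mem_nhdsWithin, mem_nhdsWithin_of_mem_nhds h1] with q hq hq'
  exact ⟨hq.1, hq.2, hq'⟩

instance pairsToZero_neBot : pairsToZero.NeBot := by
  have hc : Tendsto (fun t : ℝ => (t, 2 * t)) (𝓝[>] 0) pairsToZero := by
    refine tendsto_nhdsWithin_iff.2 ⟨?_, ?_⟩
    · have : Continuous fun t : ℝ => (t, 2 * t) := by fun_prop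
      simpa using (this.tendsto 0).mono_left (nhdsWithin_le_nhds (s := Set.Ioi 0))
    · filter_upwards [self_mem_nhdsWithin] with t ht
      have ht' : (0 : ℝ) < t := ht
      exact ⟨ht', show t < 2 * t by linarith⟩
  exact hc.neBot

/-- Slopes increase in both endpoints, so the limit at (0, 0) is their infimum over all pairs below
R. Both halves of the infimum property are recorded, because upper semi-continuity in x uses them
rather than the limit. -/
theorem IsKernelConvex.exists_tendsto {p R : ℝ} {m : ℝ → ℝ} (h : IsKernelConvex p R m)
    (hR : 0 < R) : ∃ L, Tendsto (fun q : ℝ × ℝ => kernelSlope p m q.1 q.2) pairsToZero (𝓝 L) ∧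
      (∀ s t, 0 < s → s < t → t < R → L ≤ kernelSlope p m s t) ∧
      ∀ c, L < c → ∃ s t, 0 < s ∧ s < t ∧ t < R ∧ kernelSlope p m s t < c := by
  set A : Set ℝ := {a | ∃ s t, 0 < s ∧ s < t ∧ t < R ∧ kernelSlope p m s t = a} with hA
  have hne : A.Nonempty := ⟨_, R / 3, R / 2, by linarith, by linarith, by linarith, rfl⟩
  have hbdd : BddBelow A := ⟨0, by
    rintro a ⟨s, t, hs, hst, ht, rfl⟩
    exact h.kernelSlope_nonneg hs hst ht⟩
  have hle : ∀ s t, 0 < s → s < t → t < R → sInf A ≤ kernelSlope p m s t :=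
    fun s t hs hst ht => csInf_le hbdd ⟨s, t, hs, hst, ht, rfl⟩
  have hlt : ∀ c, sInf A < c → ∃ s t, 0 < s ∧ s < t ∧ t < R ∧ kernelSlope p m s t < c := by
    intro c hc
    obtain ⟨a, ⟨s, t, hs, hst, ht, rfl⟩, hac⟩ := exists_lt_of_csInf_lt hne hc
    exact ⟨s, t, hs, hst, ht, hac⟩
  refine ⟨sInf A, ?_, hle, hlt⟩
  refine tendsto_order.2 ⟨fun a ha => ?_, fun c hc => ?_⟩
  · filter_upwards [mem_pairsToZero hR] with q hq
    exact ha.trans_le (hle _ _ hq.1 hq.2.1 hq.2.2)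
  · obtain ⟨s, t, hs, hst, ht, hc'⟩ := hlt c hc
    filter_upwards [mem_pairsToZero hs] with q hq
    exact (h.kernelSlope_mono hq.1 hq.2.1 (hq.2.1.trans hq.2.2).le (hq.2.2.trans hst).le hst
      ht).trans_lt hc'

theorem IsKernelConvex.tendsto_density {p R : ℝ} {ψ : ℝ → EReal}
    (h : IsKernelConvex p R fun r => (ψ r).toReal) (hR : 0 < R) :
    Tendsto (kernelQuotient p ψ) pairsToZero (𝓝 (density p ψ)) := by
  obtain ⟨L, hL, -⟩ := h.exists_tendsto hR
  exact tendsto_nhds_limUnder ⟨L, hL⟩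

theorem IsKernelConvex.density_spec {p R : ℝ} {ψ : ℝ → EReal}
    (h : IsKernelConvex p R fun r => (ψ r).toReal) (hR : 0 < R) :
    (∀ s t, 0 < s → s < t → t < R → density p ψ ≤ kernelSlope p (fun r => (ψ r).toReal) s t) ∧
      ∀ c, density p ψ < c →
        ∃ s t, 0 < s ∧ s < t ∧ t < R ∧ kernelSlope p (fun r => (ψ r).toReal) s t < c := by
  obtain ⟨L, hL, h1⟩ := h.exists_tendsto hR
  rwa [tendsto_nhds_unique (h.tendsto_density hR) hL]

end OneVariable

/-! ### From kernel convexity to upper semi-continuous densities. -/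

section Semicontinuity

variable {n : ℕ} {X : Set (E n)} {p : ℝ} {Ψ : E n → ℝ → EReal}

/-- A strict upper bound for one slope at x persists at nearby points and bounds the infimum there.
The averages need not be known to be continuous in x at a fixed radius: `hloc` compares nearby
centres at slightly different radii, and continuity in the radius absorbs the difference. -/
theorem upperSemicontinuousOn_density (hX : IsOpen X)
    (hconv : ∀ x R, Metric.closedBall x R ⊆ X → IsKernelConvex p R fun r => (Ψ x r).toReal)
    (hloc : ∀ x ∈ X, ∃ R > 0, ∀ r r', 0 < r → r < r' → r' < R → ∀ ε > 0, ∀ᶠ x' in 𝓝 x,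
      (Ψ x' r).toReal ≤ (Ψ x r').toReal + ε ∧ (Ψ x r).toReal ≤ (Ψ x' r').toReal + ε) :
    UpperSemicontinuousOn (fun x => density p (Ψ x)) X := by
  intro x hx c hc
  obtain ⟨R₀, hR₀, hloc⟩ := hloc x hx
  obtain ⟨R₁, hR₁, hball⟩ := Metric.nhds_basis_closedBall.mem_iff.1 (hX.mem_nhds hx)
  -- Half of R₁, so that balls of radius R about all centres within R of x stay in X.
  set R := min R₀ (R₁ / 2) with hRdef
  have hR : 0 < R := lt_min hR₀ (half_pos hR₁)
  have hRR₀ : R ≤ R₀ := min_le_left _ _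
  have hRR₁ : R ≤ R₁ / 2 := min_le_right _ _
  have hx' : ∀ x' ∈ Metric.ball x R, IsKernelConvex p R fun r => (Ψ x' r).toReal := by
    intro x' hx'
    refine hconv x' R (Set.Subset.trans ?_ hball)
    refine Metric.closedBall_subset_closedBall' ?_
    have := Metric.mem_ball.1 hx'
    linarith
  have hcx := hx' x (Metric.mem_ball_self hR)
  obtain ⟨s, t, hs, hst, ht, hlt⟩ := (hcx.density_spec hR).2 c hc
  have hK := sub_pos.2 (rieszKernel_lt p hs hst)
  rw [kernelSlope, div_lt_iff₀ hK] at hlt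
  -- The slack in the inequality slope < c. Moving the two radii costs η/4 each and moving the
  -- centre η/8 each, in total less than η.
  set η := c * (rieszKernel p t - rieszKernel p s) - ((Ψ x t).toReal - (Ψ x s).toReal) with hη
  have hη0 : 0 < η := by linarith
  have hct := (hcx.continuousAt (hs.trans hst) ht).eventually_lt continuousAt_const
    (show (Ψ x t).toReal < (Ψ x t).toReal + η / 4 by linarith)
  have hcs := continuousAt_const.eventually_lt (hcx.continuousAt hs (hst.trans ht))
    (show (Ψ x s).toReal - η / 4 < (Ψ x s).toReal by linarith)
  obtain ⟨t', ht', ht't, ht'R⟩ : ∃ t', (Ψ x t').toReal < (Ψ x t).toReal + η / 4 ∧ t' ∈ Set.Ioo t R :=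
    ((hct.filter_mono nhdsWithin_le_nhds).and (Ioo_mem_nhdsGT ht)).exists
  obtain ⟨s', hs', hs'0, hs's⟩ : ∃ s', (Ψ x s).toReal - η / 4 < (Ψ x s').toReal ∧ s' ∈ Set.Ioo 0 s :=
    ((hcs.filter_mono nhdsWithin_le_nhds).and (Ioo_mem_nhdsLT hs)).exists
  have e1 := hloc t t' (hs.trans hst) ht't (ht'R.trans_le hRR₀) (η / 8) (by linarith)
  have e2 := hloc s' s hs'0 hs's ((hst.trans ht).trans_le hRR₀) (η / 8) (by linarith)
  refine mem_nhdsWithin_of_mem_nhds ?_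
  filter_upwards [e1, e2, Metric.ball_mem_nhds x hR] with y hy1 hy2 hy3
  refine ((hx' y hy3).density_spec hR).1 s t hs hst ht |>.trans_lt ?_
  rw [kernelSlope, div_lt_iff₀ hK]
  linarith [hy1.1, hy2.2]

theorem upperSemicontinuousDensity_of_isKernelConvex (hX : IsOpen X)
    (hfin : ∀ x R, Metric.closedBall x R ⊆ X → ∀ r, 0 < r → r < R → Ψ x r ≠ ⊥ ∧ Ψ x r ≠ ⊤)
    (hconv : ∀ x R, Metric.closedBall x R ⊆ X → IsKernelConvex p R fun r => (Ψ x r).toReal)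
    (hloc : ∀ x ∈ X, ∃ R > 0, ∀ r r', 0 < r → r < r' → r' < R → ∀ ε > 0, ∀ᶠ x' in 𝓝 x,
      (Ψ x' r).toReal ≤ (Ψ x r').toReal + ε ∧ (Ψ x r).toReal ≤ (Ψ x' r').toReal + ε) :
    UpperSemicontinuousDensity p X Ψ := by
  have husc := upperSemicontinuousOn_density hX hconv hloc
  refine ⟨fun x hx => ?_, husc, fun c _ => ?_⟩
  · obtain ⟨R, hR, hball⟩ := Metric.nhds_basis_closedBall.mem_iff.1 (hX.mem_nhds hx)
    refine ⟨?_, (hconv x R hball).tendsto_density hR⟩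
    filter_upwards [Ioo_mem_nhdsGT hR] with r hr using hfin x R hball r hr.1 hr.2
  · exact (upperSemicontinuousOn_iff_restrict.2 husc).isClosed_preimage c

end Semicontinuity

/-! ### Spherical maxima: finiteness, convexity and density. -/

section SphereMax

variable {n : ℕ} {F : Set (Matrix (Fin n) (Fin n) ℝ)} {X : Set (E n)} {u : E n → EReal}
  {x : E n} {p r R : ℝ}

theorem le_sphereMax (u : E n → EReal) (hr : 0 < r) {y : E n} (hy : ‖y - x‖ = r) :
    u y ≤ sphereMax u x r := by
  have hmem : r⁻¹ • (y - x) ∈ Metric.sphere (0 : E n) 1 := by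
    rw [mem_sphere_zero_iff_norm, norm_smul, hy, Real.norm_eq_abs, abs_of_pos (inv_pos.2 hr),
      inv_mul_cancel₀ hr.ne']
  have h := le_iSup (fun σ : Metric.sphere (0 : E n) 1 => u (x + r • (σ : E n))) ⟨_, hmem⟩
  simpa [sphereMax, smul_smul, mul_inv_cancel₀ hr.ne'] using h

theorem sphereMax_le (hr : 0 ≤ r) {c : EReal} (h : ∀ y, ‖y - x‖ = r → u y ≤ c) :
    sphereMax u x r ≤ c :=
  iSup_le fun σ => h _ (by
    rw [add_sub_cancel_left, norm_smul, mem_sphere_zero_iff_norm.1 σ.2, mul_one,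
      Real.norm_eq_abs, abs_of_nonneg hr])

theorem IsSubharmonicOn.exists_le_coe (hu : IsSubharmonicOn F X u) {K : Set (E n)}
    (hK : IsCompact K) (hKX : K ⊆ X) : ∃ C : ℝ, 0 ≤ C ∧ ∀ y ∈ K, u y ≤ (C : EReal) := by
  rcases K.eq_empty_or_nonempty with rfl | hne
  · exact ⟨0, le_rfl, by simp⟩
  obtain ⟨y₀, hy₀, hmax⟩ := (hu.usc.mono hKX).exists_isMaxOn hne hK
  refine ⟨max 0 (u y₀).toReal, le_max_left _ _, fun y hy => (hmax hy).trans ?_⟩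
  refine (EReal.le_coe_toReal (hu.ne_top y₀ (hKX hy₀))).trans ?_
  exact EReal.coe_le_coe_iff.2 (le_max_right _ _)

theorem IsSubharmonicOn.sphereMax_ne_top (hu : IsSubharmonicOn F X u)
    (hX : Metric.closedBall x R ⊆ X) (hr : 0 ≤ r) (hrR : r ≤ R) : sphereMax u x r ≠ ⊤ := by
  obtain ⟨C, -, hC⟩ := hu.exists_le_coe (isCompact_closedBall x R) hX
  refine ne_top_of_le_ne_top (EReal.coe_ne_top C) (sphereMax_le hr fun y hy => hC y ?_)
  rw [Metric.mem_closedBall, dist_eq_norm, hy]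
  exact hrR

theorem IsSubharmonicOn.le_sphereMax_of_norm_le (hF : IsSTConeSubequation F)
    (hp : rieszChar F = (p : EReal)) (hn : 1 ≤ n) (hu : IsSubharmonicOn F X u)
    (hX : Metric.closedBall x r ⊆ X) (hr : 0 < r) {y : E n} (hy : ‖y - x‖ ≤ r) :
    u y ≤ sphereMax u x r := by
  refine EReal.le_of_forall_lt_iff_le.1 fun b hb => ?_
  exact hu.le_on_closedBall hF hp hn hX (fun z hz => (le_sphereMax u hr hz).trans hb.le) hy

/-- The maximum principle on the larger ball, which contains the smaller one. With equal centres it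
is monotonicity in the radius; with different centres it is the comparison required by `hloc`. -/
theorem IsSubharmonicOn.sphereMax_mono (hF : IsSTConeSubequation F)
    (hp : rieszChar F = (p : EReal)) (hn : 1 ≤ n) (hu : IsSubharmonicOn F X u) {x' : E n} {r' : ℝ}
    (hX : Metric.closedBall x' r' ⊆ X) (hr : 0 < r) (hr' : ‖x - x'‖ + r ≤ r') :
    sphereMax u x r ≤ sphereMax u x' r' := by
  have h0 := norm_nonneg (x - x')
  refine sphereMax_le hr.le fun y hy =>
    hu.le_sphereMax_of_norm_le hF hp hn hX (by linarith) ?_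
  calc ‖y - x'‖ = ‖(y - x) + (x - x')‖ := by congr 1; abel
    _ ≤ ‖y - x‖ + ‖x - x'‖ := norm_add_le _ _
    _ ≤ r' := by rw [hy]; linarith

/-- Where u = -∞ on the inner sphere, comparison imposes no condition there. The coefficient a of
the barrier is therefore free, and letting it grow drives the bound at an intermediate point to -∞.
-/
theorem IsSubharmonicOn.eq_bot_of_sphereMax_eq_bot (hF : IsSTConeSubequation F)
    (hp : rieszChar F = (p : EReal)) (hn : 1 ≤ n) (hu : IsSubharmonicOn F X u)
    (hX : Metric.closedBall x R ⊆ X) (hr : 0 < r) (hrR : r < R) (hbot : sphereMax u x r = ⊥) {y : E n}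
    (hy : ‖y - x‖ < R) : u y = ⊥ := by
  rcases le_or_gt ‖y - x‖ r with hyr | hyr
  · have := hu.le_sphereMax_of_norm_le hF hp hn
      ((Metric.closedBall_subset_closedBall hrR.le).trans hX) hr hyr
    rwa [hbot, le_bot_iff] at this
  · obtain ⟨r₂, hr₂, hr₂R⟩ := exists_between hy
    have hX₂ : Metric.closedBall x r₂ ⊆ X :=
      (Metric.closedBall_subset_closedBall hr₂R.le).trans hX
    obtain ⟨C, hC0, hC⟩ := hu.exists_le_coe (isCompact_closedBall x r₂) hX₂
    have hK := sub_pos.2 (rieszKernel_lt p (hr.trans hyr) hr₂)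
    refine (EReal.eq_bot_iff_forall_lt _).2 fun b => ?_
    -- Chosen so that the barrier with value C on the outer sphere equals -|b| - 1 at y.
    set a : ℝ := (C + |b| + 1) / (rieszKernel p r₂ - rieszKernel p ‖y - x‖) with ha
    have ha0 : 0 ≤ a := by positivity
    have := hu.le_on_annulus hF hp hr hX₂ ha0 (b := C - a * rieszKernel p r₂)
      (fun z hz => by
        have := le_sphereMax u hr hz
        rw [hbot, le_bot_iff] at this
        rw [this]; exact bot_le)
      (fun z hz => (hC z (by rw [Metric.mem_closedBall, dist_eq_norm, hz])).trans
        (EReal.coe_le_coe_iff.2 (by linarith)))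
      hyr.le hr₂.le
    refine this.trans_lt (EReal.coe_lt_coe_iff.2 ?_)
    have h1 : a * (rieszKernel p r₂ - rieszKernel p ‖y - x‖) = C + |b| + 1 := by
      rw [ha, div_mul_cancel₀ _ hK.ne']
    have := neg_abs_le b
    nlinarith

theorem IsSubharmonicOn.sphereMax_ne_bot (hF : IsSTConeSubequation F)
    (hp : rieszChar F = (p : EReal)) (hn : 1 ≤ n) (hu : IsSubharmonicOn F X u)
    (hX : Metric.closedBall x R ⊆ X) (hne : ∃ y, ‖y - x‖ < R ∧ u y ≠ ⊥) (hr : 0 < r)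
    (hrR : r < R) :
    sphereMax u x r ≠ ⊥ := by
  obtain ⟨y, hy, hyb⟩ := hne
  exact fun h => hyb (hu.eq_bot_of_sphereMax_eq_bot hF hp hn hX hr hrR h hy)

/-- A three circles theorem: the affine function of K through the values at r₁ and r₂ dominates u on
the annulus. Its slope a is nonnegative by monotonicity, as the barrier requires. -/
theorem IsSubharmonicOn.isKernelConvex_sphereMax (hF : IsSTConeSubequation F)
    (hp : rieszChar F = (p : EReal)) (hn : 1 ≤ n) (hu : IsSubharmonicOn F X u)
    (hX : Metric.closedBall x R ⊆ X) (hne : ∃ y, ‖y - x‖ < R ∧ u y ≠ ⊥) :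
    IsKernelConvex p R fun r => (sphereMax u x r).toReal := by
  have hsub : ∀ {r}, r < R → Metric.closedBall x r ⊆ X := fun hr =>
    (Metric.closedBall_subset_closedBall hr.le).trans hX
  have hbot : ∀ {r}, 0 < r → r < R → sphereMax u x r ≠ ⊥ := fun hr hrR =>
    hu.sphereMax_ne_bot hF hp hn hX hne hr hrR
  have htop : ∀ {r}, 0 < r → r < R → sphereMax u x r ≠ ⊤ := fun hr hrR =>
    hu.sphereMax_ne_top hX hr.le hrR.le
  have hmono : ∀ s t : ℝ, 0 < s → s ≤ t → t < R →
      (sphereMax u x s).toReal ≤ (sphereMax u x t).toReal := fun s t hs hst ht =>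
    EReal.toReal_le_toReal (hu.sphereMax_mono hF hp hn (hsub ht) hs (by simpa using hst))
      (hbot hs (hst.trans_lt ht)) (htop (hs.trans_le hst) ht)
  refine ⟨hmono, fun r₁ r r₂ h1 h2 h3 h4 => ?_⟩
  have hr : 0 < r := h1.trans h2
  have hr₂ : 0 < r₂ := hr.trans h3
  have hK := sub_pos.2 (rieszKernel_lt p h1 (h2.trans h3))
  have e1 := EReal.coe_toReal (htop h1 ((h2.trans h3).trans h4)) (hbot h1 ((h2.trans h3).trans h4))
  have e := EReal.coe_toReal (htop hr (h3.trans h4)) (hbot hr (h3.trans h4))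
  have e2 := EReal.coe_toReal (htop hr₂ h4) (hbot hr₂ h4)
  have h12 := hmono r₁ r₂ h1 (h2.trans h3).le h4
  set m₁ := (sphereMax u x r₁).toReal
  set m := (sphereMax u x r).toReal
  set m₂ := (sphereMax u x r₂).toReal
  set a := (m₂ - m₁) / (rieszKernel p r₂ - rieszKernel p r₁) with ha
  have ha0 : 0 ≤ a := div_nonneg (by linarith) hK.le
  have haK : a * (rieszKernel p r₂ - rieszKernel p r₁) = m₂ - m₁ := by
    rw [ha, div_mul_cancel₀ _ hK.ne']
  have key : sphereMax u x r ≤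
      ((a * rieszKernel p r + (m₁ - a * rieszKernel p r₁) : ℝ) : EReal) := by
    refine sphereMax_le hr.le fun y hy => ?_
    have := hu.le_on_annulus hF hp h1 (hsub h4) ha0 (b := m₁ - a * rieszKernel p r₁) (y := y)
      (fun z hz => (le_sphereMax u h1 hz).trans
        (by rw [← e1]; exact EReal.coe_le_coe_iff.2 (by linarith)))
      (fun z hz => (le_sphereMax u hr₂ hz).trans
        (by rw [← e2]; exact EReal.coe_le_coe_iff.2 (by linarith)))
      (by rw [hy]; exact h2.le) (by rw [hy]; exact h3.le)
    rwa [hy] at this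
  rw [← e, EReal.coe_le_coe_iff] at key
  have h5 : m - m₁ ≤ a * (rieszKernel p r - rieszKernel p r₁) := by linarith
  calc (m - m₁) * (rieszKernel p r₂ - rieszKernel p r₁)
      ≤ a * (rieszKernel p r - rieszKernel p r₁) * (rieszKernel p r₂ - rieszKernel p r₁) := by
        gcongr
    _ = (m₂ - m₁) * (rieszKernel p r - rieszKernel p r₁) := by rw [← haK]; ring

/-- The set of points near which u is identically -∞ is open. It is also relatively closed in X,
since `eq_bot_of_sphereMax_eq_bot` spreads -∞ to balls of a size independent of the small sphere
used. If it met a component it would contain it. -/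
theorem IsSubharmonicOn.exists_ne_bot (hF : IsSTConeSubequation F)
    (hp : rieszChar F = (p : EReal)) (hn : 1 ≤ n) (hu : IsSubharmonicOn F X u) (hXo : IsOpen X)
    (hfin : ∀ x ∈ X, ∃ y ∈ connectedComponentIn X x, u y ≠ ⊥)
    (hX : Metric.closedBall x R ⊆ X) (hR : 0 < R) : ∃ y, ‖y - x‖ < R ∧ u y ≠ ⊥ := by
  by_contra! hcon
  have hxX : x ∈ X := hX (Metric.mem_closedBall_self hR.le)
  obtain ⟨y₀, hy₀, hy₀b⟩ := hfin x hxX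
  set Z : Set (E n) := {z | ∀ᶠ y in 𝓝 z, u y = ⊥} with hZ
  have hZo : IsOpen Z := isOpen_iff_mem_nhds.2 fun z hz => hz.eventually_nhds
  have hxZ : x ∈ Z := by
    filter_upwards [Metric.ball_mem_nhds x hR] with y hy
    exact hcon y (by simpa [dist_eq_norm] using hy)
  have hsub : connectedComponentIn X x ⊆ Z := by
    refine isPreconnected_connectedComponentIn.subset_of_closure_inter_subset hZo
      ⟨x, mem_connectedComponentIn hxX, hxZ⟩ ?_
    rintro y ⟨hyc, hyX⟩
    have hyX := connectedComponentIn_subset X x hyX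
    obtain ⟨ρ, hρ, hball⟩ := Metric.nhds_basis_closedBall.mem_iff.1 (hXo.mem_nhds hyX)
    obtain ⟨z, hzZ, hyz⟩ := Metric.mem_closure_iff.1 hyc (ρ / 2) (by linarith)
    have hzball : Metric.closedBall z (ρ / 2) ⊆ X := by
      refine (Metric.closedBall_subset_closedBall' ?_).trans hball
      rw [dist_comm]; linarith
    obtain ⟨δ, hδ, hδz⟩ := Metric.eventually_nhds_iff_ball.1 hzZ
    have hr0 : 0 < min (δ / 2) (ρ / 4) := lt_min (by linarith) (by linarith)
    have hbot : sphereMax u z (min (δ / 2) (ρ / 4)) = ⊥ := le_bot_iff.1 <| sphereMax_le hr0.le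
      fun w hw => (hδz w (by
        rw [Metric.mem_ball, dist_eq_norm, hw]
        exact (min_le_left _ _).trans_lt (by linarith))).le
    filter_upwards [Metric.isOpen_ball.mem_nhds (Metric.mem_ball.2 hyz)] with w hw
    exact hu.eq_bot_of_sphereMax_eq_bot hF hp hn hzball hr0
      ((min_le_right _ _).trans_lt (by linarith)) hbot
      (by simpa [dist_eq_norm] using hw)
  exact hy₀b (hsub hy₀).self_of_nhds

theorem IsSubharmonicOn.upperSemicontinuousDensity_sphereMax (hF : IsSTConeSubequation F)
    (hp : rieszChar F = (p : EReal)) (hn : 1 ≤ n) (hu : IsSubharmonicOn F X u) (hXo : IsOpen X)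
    (hfin : ∀ x ∈ X, ∃ y ∈ connectedComponentIn X x, u y ≠ ⊥) :
    UpperSemicontinuousDensity p X (sphereMax u) := by
  have hne : ∀ {x R r}, Metric.closedBall x R ⊆ X → 0 < r → r < R →
      sphereMax u x r ≠ ⊥ ∧ sphereMax u x r ≠ ⊤ := fun hX hr hrR =>
    ⟨hu.sphereMax_ne_bot hF hp hn hX
      (hu.exists_ne_bot hF hp hn hXo hfin hX (hr.trans hrR)) hr hrR,
      hu.sphereMax_ne_top hX hr.le hrR.le⟩
  refine upperSemicontinuousDensity_of_isKernelConvex hXo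
    (fun x R hX r hr hrR => hne hX hr hrR) (fun x R hX => ?_) fun x hx => ?_
  · rcases le_or_gt R 0 with hR | hR
    · exact ⟨fun s t hs hst ht => by linarith, fun r₁ r r₂ h1 h2 h3 h4 => by linarith⟩
    · exact hu.isKernelConvex_sphereMax hF hp hn hX (hu.exists_ne_bot hF hp hn hXo hfin hX hR)
  · obtain ⟨R, hR, hball⟩ := Metric.nhds_basis_closedBall.mem_iff.1 (hXo.mem_nhds hx)
    refine ⟨R / 2, by linarith, fun r r' hr hrr' hr' ε hε => ?_⟩
    filter_upwards [Metric.ball_mem_nhds x (sub_pos.2 hrr'),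
      Metric.ball_mem_nhds x (half_pos hR)] with x' hx' hx'R
    rw [Metric.mem_ball, dist_eq_norm] at hx'
    have hball' : Metric.closedBall x' (R / 2) ⊆ X := by
      refine (Metric.closedBall_subset_closedBall' ?_).trans hball
      have := Metric.mem_ball.1 hx'R
      linarith
    have hr0 := hr.trans hrr'
    constructor
    · have h := EReal.toReal_le_toReal (hu.sphereMax_mono hF hp hn (x := x') (x' := x) (r' := r')
        ((Metric.closedBall_subset_closedBall (by linarith)).trans hball) hr (by linarith))
        (hne hball' hr (hrr'.trans hr')).1 (hne hball hr0 (by linarith)).2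
      linarith
    · rw [norm_sub_rev] at hx'
      have h := EReal.toReal_le_toReal (hu.sphereMax_mono hF hp hn (x := x) (x' := x') (r' := r')
        ((Metric.closedBall_subset_closedBall hr'.le).trans hball') hr (by linarith))
        (hne hball hr (by linarith)).1 (hne hball' hr0 hr').2
      linarith

end SphereMax

/-! ### Polynomial solutions of the Dirichlet problem for linear operators. -/

section Polynomial

open MvPolynomial

variable {n : ℕ}

/-- A polynomial as a function on Euclidean space. -/
noncomputable def polyEval (q : MvPolynomial (Fin n) ℝ) (y : E n) : ℝ := eval y.ofLp q

theorem contDiff_polyEval (q : MvPolynomial (Fin n) ℝ) : ContDiff ℝ 2 (polyEval q) := by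
  have h := AnalyticOnNhd.eval_continuousLinearMap (𝕜 := ℝ)
    (EuclideanSpace.equiv (Fin n) ℝ).toContinuousLinearMap q
  exact h.contDiff

theorem hasFDerivAt_polyEval (q : MvPolynomial (Fin n) ℝ) (y : E n) :
    HasFDerivAt (polyEval q)
      (∑ i, polyEval (pderiv i q) y • (EuclideanSpace.proj i : E n →L[ℝ] ℝ)) y := by
  induction q using MvPolynomial.induction_on with
  | C a =>
    have : polyEval (C a : MvPolynomial (Fin n) ℝ) = fun _ => a := by ext; simp [polyEval]
    rw [this]
    refine (hasFDerivAt_const a y).congr_fderiv ?_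
    simp [polyEval]
  | add f g hf hg =>
    have : polyEval (f + g) = fun y => polyEval f y + polyEval g y := by ext; simp [polyEval]
    rw [this]
    refine (hf.add hg).congr_fderiv ?_
    rw [← Finset.sum_add_distrib]
    exact Finset.sum_congr rfl fun i _ => by simp [polyEval, add_smul]
  | mul_X f j hf =>
    have : polyEval (f * X j) = fun y => polyEval f y * y j := by ext; simp [polyEval]
    rw [this]
    refine (hf.mul (EuclideanSpace.proj j : E n →L[ℝ] ℝ).hasFDerivAt).congr_fderiv ?_
    ext v
    simp [polyEval, pderiv_X, Finset.sum_add_distrib, add_mul, Finset.mul_sum, Pi.single_apply,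
      apply_ite (eval y.ofLp)]
    exact Finset.sum_congr rfl fun i _ => by ring

theorem hessian_polyEval (q : MvPolynomial (Fin n) ℝ) (y : E n) :
    hessian (polyEval q) y = Matrix.of fun i j => polyEval (pderiv i (pderiv j q)) y := by
  rw [hessian_eq_of_hasFDerivAt (Eventually.of_forall (hasFDerivAt_polyEval q))
    (HasFDerivAt.fun_sum fun j _ => (hasFDerivAt_polyEval (pderiv j q) y).smul_const
      (EuclideanSpace.proj j : E n →L[ℝ] ℝ))]
  ext i j
  simp

theorem totalDegree_pderiv_le (i : Fin n) (q : MvPolynomial (Fin n) ℝ) :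
    (pderiv i q).totalDegree ≤ q.totalDegree - 1 := by
  conv_lhs => rw [q.as_sum, map_sum]
  refine totalDegree_finsetSum_le fun s hs => ?_
  rw [pderiv_monomial]
  rcases Nat.eq_zero_or_pos (s i) with h | h
  · simp [h]
  refine (totalDegree_monomial_le _ _).trans ?_
  have h1 : (s - Finsupp.single i 1) + Finsupp.single i 1 = s := by
    refine tsub_add_cancel_of_le ?_
    rw [Finsupp.single_le_iff]; exact h
  have h2 := le_totalDegree hs
  have h3 : (s.sum fun _ e => e) = ((s - Finsupp.single i 1).sum fun _ e => e) + 1 := by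
    conv_lhs => rw [← h1]
    rw [Finsupp.sum_add_index' (by simp) (by simp), Finsupp.sum_single_index rfl]
  have h4 : (s - Finsupp.single i 1).sum (fun _ => id) =
      (s - Finsupp.single i 1).sum fun _ e => e := rfl
  simp only [Function.id_def] at *
  omega

/-- The constant coefficient operator `q ↦ ℓ(D² q)` on polynomials. -/
noncomputable def polyOp (ℓ : Matrix (Fin n) (Fin n) ℝ →ₗ[ℝ] ℝ) :
    MvPolynomial (Fin n) ℝ →ₗ[ℝ] MvPolynomial (Fin n) ℝ :=
  ∑ i, ∑ j, ℓ (Matrix.single i j 1) •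
    ((pderiv i).toLinearMap.comp (pderiv j).toLinearMap :
      MvPolynomial (Fin n) ℝ →ₗ[ℝ] MvPolynomial (Fin n) ℝ)

theorem polyEval_polyOp (ℓ : Matrix (Fin n) (Fin n) ℝ →ₗ[ℝ] ℝ) (q : MvPolynomial (Fin n) ℝ)
    (y : E n) : polyEval (polyOp ℓ q) y = ℓ (hessian (polyEval q) y) := by
  rw [hessian_polyEval, Matrix.matrix_eq_sum_single (Matrix.of _)]
  simp only [polyOp, polyEval, map_sum, LinearMap.sum_apply, LinearMap.smul_apply,
    LinearMap.comp_apply, Derivation.coeFn_coe, smul_eval, Matrix.of_apply]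
  refine Finset.sum_congr rfl fun i _ => Finset.sum_congr rfl fun j _ => ?_
  have : ∀ c : ℝ, Matrix.single i j c = c • Matrix.single i j (1 : ℝ) := fun c => by
    rw [Matrix.smul_single, smul_eq_mul, mul_one]
  rw [this (eval y.ofLp ((pderiv i) ((pderiv j) q))), map_smul, smul_eq_mul, mul_comm]

theorem totalDegree_polyOp_le (ℓ : Matrix (Fin n) (Fin n) ℝ →ₗ[ℝ] ℝ)
    (q : MvPolynomial (Fin n) ℝ) : (polyOp ℓ q).totalDegree ≤ q.totalDegree - 2 := by
  simp only [polyOp, LinearMap.sum_apply, LinearMap.smul_apply, LinearMap.comp_apply,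
    Derivation.coeFn_coe]
  refine totalDegree_finsetSum_le fun i _ => totalDegree_finsetSum_le fun j _ => ?_
  refine (totalDegree_smul_le _ _).trans ((totalDegree_pderiv_le _ _).trans ?_)
  have := totalDegree_pderiv_le j q
  omega

/-- A linear functional on matrices defining a degenerate elliptic operator. -/
structure IsElliptic (ℓ : Matrix (Fin n) (Fin n) ℝ →ₗ[ℝ] ℝ) : Prop where
  nonneg : ∀ P : Matrix (Fin n) (Fin n) ℝ, P.PosSemidef → 0 ≤ ℓ P
  one_pos : 0 < ℓ 1

theorem hessian_norm_sq (y : E n) :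
    hessian (fun y : E n => ‖y‖ ^ 2) y = (2 : ℝ) • (1 : Matrix (Fin n) (Fin n) ℝ) := by
  have h := hessian_radial (n := n) (x := y) (f := fun s => s) (f' := fun _ => 1) (f'' := 0)
    (Eventually.of_forall fun s => hasDerivAt_id s) (hasDerivAt_const _ _)
  simpa using h

/-- The weak maximum principle on the unit ball. -/
theorem IsElliptic.le_of_le_on_sphere {ℓ : Matrix (Fin n) (Fin n) ℝ →ₗ[ℝ] ℝ} (hℓ : IsElliptic ℓ)
    {h : E n → ℝ} (hh : ContDiff ℝ 2 h) (hL : ∀ y, ‖y‖ < 1 → 0 ≤ ℓ (hessian h y)) {c : ℝ}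
    (hc : ∀ y, ‖y‖ = 1 → h y ≤ c) {y : E n} (hy : ‖y‖ ≤ 1) : h y ≤ c := by
  refine le_of_forall_pos_le_add fun ε hε => ?_
  -- The quadratic term makes h strictly subharmonic, because ℓ(I) > 0, and so excludes an interior
  -- maximum.
  set g : E n → ℝ := fun y => h y + ε * ‖y‖ ^ 2 with hg
  have hsq : ContDiff ℝ 2 (fun y : E n => ‖y‖ ^ 2) := contDiff_norm_sq ℝ
  have hgc : ContDiff ℝ 2 g := hh.add (contDiff_const.mul hsq)
  obtain ⟨y₀, hy₀, hmax⟩ := (isCompact_closedBall (0 : E n) 1).exists_isMaxOn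
    ⟨0, by simp⟩ hgc.continuous.continuousOn
  have hy₀' : ‖y₀‖ ≤ 1 := by simpa using hy₀
  have hgy : g y ≤ g y₀ := hmax (by simpa using hy)
  have hsph : ‖y₀‖ = 1 := by
    by_contra hne
    have hlt : ‖y₀‖ < 1 := lt_of_le_of_ne hy₀' hne
    have hmin : IsLocalMin (fun y => (-1) * g y) y₀ := by
      filter_upwards [Metric.isOpen_ball.mem_nhds (mem_ball_zero_iff.2 hlt)] with z hz
      have : g z ≤ g y₀ := hmax (Metric.ball_subset_closedBall hz)
      linarith
    have hpos := hℓ.nonneg _ (posSemidef_hessian_of_isLocalMin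
      (contDiff_const.mul hgc).contDiffAt hmin)
    rw [hessian_const_mul hgc.contDiffAt, hg, hessian_add hh.contDiffAt
      (contDiff_const.mul hsq).contDiffAt, hessian_const_mul hsq.contDiffAt, hessian_norm_sq,
      map_smul, map_add, map_smul, map_smul] at hpos
    have h1 := hL y₀ hlt
    have h2 := hℓ.one_pos
    simp only [smul_eq_mul] at hpos
    nlinarith [mul_pos hε h2]
  have h1 := hc y₀ hsph
  have h2 : 0 ≤ ε * ‖y‖ ^ 2 := by positivity
  simp only [hg, hsph] at hgy
  linarith

/-- The polynomial `1 - |y|²`. -/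
noncomputable def ballPoly (n : ℕ) : MvPolynomial (Fin n) ℝ := 1 - ∑ i, X i ^ 2

theorem polyEval_ballPoly (y : E n) : polyEval (ballPoly n) y = 1 - ‖y‖ ^ 2 := by
  simp [polyEval, ballPoly, EuclideanSpace.real_norm_sq_eq]

theorem totalDegree_ballPoly_le : (ballPoly n).totalDegree ≤ 2 := by
  refine (totalDegree_sub _ _).trans (max_le (by simp) (totalDegree_finsetSum_le fun i _ => ?_))
  simp

/-- The unit ball contains a cube, and a polynomial vanishing on a product of infinite sets is zero.
-/
theorem polyEval_eq_of_forall_ball {q : MvPolynomial (Fin n) ℝ}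
    (h : ∀ y : E n, ‖y‖ < 1 → polyEval q y = 0) : q = 0 := by
  obtain ⟨δ, hδ, hsub⟩ : ∃ δ > 0, ∀ f : Fin n → ℝ, (∀ i, |f i| ≤ δ) → ‖WithLp.toLp 2 f‖ < 1 := by
    have hc : Continuous fun f : Fin n → ℝ => ‖(WithLp.toLp 2 f : E n)‖ :=
      (PiLp.continuous_toLp 2 _).norm
    have h0 : {f : Fin n → ℝ | ‖(WithLp.toLp 2 f : E n)‖ < 1} ∈ 𝓝 (0 : Fin n → ℝ) :=
      (isOpen_lt hc continuous_const).mem_nhds (by simp)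
    obtain ⟨δ, hδ, hb⟩ := Metric.nhds_basis_closedBall.mem_iff.1 h0
    refine ⟨δ, hδ, fun f hf => hb ?_⟩
    rw [mem_closedBall_zero_iff, pi_norm_le_iff_of_nonneg hδ.le]
    exact hf
  refine funext_set (fun _ => Set.Icc (-δ) δ) (fun _ => Set.Icc_infinite (by linarith))
    fun f hf => ?_
  have := h (WithLp.toLp 2 f) (hsub f fun i => abs_le.2 (hf i trivial))
  simpa [polyEval] using this

/-- The Dirichlet problem on the unit ball with polynomial boundary values has a polynomial
solution. -/
theorem IsElliptic.exists_dirichlet {ℓ : Matrix (Fin n) (Fin n) ℝ →ₗ[ℝ] ℝ} (hℓ : IsElliptic ℓ)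
    (f : MvPolynomial (Fin n) ℝ) :
    ∃ h, polyOp ℓ h = 0 ∧ ∀ y : E n, ‖y‖ = 1 → polyEval h y = polyEval f y := by
  set V := restrictTotalDegree (Fin n) ℝ f.totalDegree
  -- Multiplication by 1 - |y|² raises the degree by at most 2 and the operator lowers it by 2, so q
  -- ↦ ℓ(D²((1 - |y|²) q)) is an endomorphism of a finite dimensional space.
  have hdeg : ∀ q ∈ V, polyOp ℓ (ballPoly n * q) ∈ V := by
    intro q hq
    rw [mem_restrictTotalDegree] at hq ⊢
    have h1 := totalDegree_polyOp_le ℓ (ballPoly n * q)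
    have h2 := totalDegree_mul (ballPoly n) q
    have h3 := totalDegree_ballPoly_le (n := n)
    omega
  set T : V →ₗ[ℝ] V :=
    ((polyOp ℓ).comp (LinearMap.mulLeft ℝ (ballPoly n))).restrict hdeg with hT
  -- A solution of the form (1 - |y|²) q vanishes on the sphere, hence in the ball by the maximum
  -- principle applied to it and its negative. Injectivity then gives surjectivity, and subtracting
  -- such a product from f corrects it without changing boundary values.
  have hinj : Function.Injective T := by
    rw [← LinearMap.ker_eq_bot, LinearMap.ker_eq_bot']
    rintro ⟨q, hq⟩ hTq
    have h0 : polyOp ℓ (ballPoly n * q) = 0 := congrArg Subtype.val hTq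
    have hev : ∀ y : E n, polyEval (ballPoly n * q) y = (1 - ‖y‖ ^ 2) * polyEval q y := by
      intro y
      rw [← polyEval_ballPoly]; simp [polyEval]
    have hL : ∀ y, ℓ (hessian (polyEval (ballPoly n * q)) y) = 0 := fun y => by
      rw [← polyEval_polyOp, h0]; simp [polyEval]
    have hcd := contDiff_polyEval (ballPoly n * q)
    have hle : ∀ y : E n, ‖y‖ ≤ 1 → polyEval (ballPoly n * q) y ≤ 0 := fun y hy =>
      hℓ.le_of_le_on_sphere hcd (fun y _ => (hL y).ge) (fun y hy => by simp [hev, hy]) hy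
    have hge : ∀ y : E n, ‖y‖ ≤ 1 → (-1) * polyEval (ballPoly n * q) y ≤ 0 := fun y hy =>
      hℓ.le_of_le_on_sphere (contDiff_const.mul hcd)
        (fun y _ => by rw [hessian_const_mul hcd.contDiffAt, map_smul, hL, smul_zero])
        (fun y hy => by simp [hev, hy]) hy
    have hq0 : q = 0 := polyEval_eq_of_forall_ball fun y hy => by
      have h1 := hle y hy.le
      have h2 := hge y hy.le
      have h3 : (1 - ‖y‖ ^ 2) * polyEval q y = 0 := by rw [← hev]; linarith
      have h4 : 1 - ‖y‖ ^ 2 ≠ 0 := by nlinarith [norm_nonneg y]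
      exact (mul_eq_zero.1 h3).resolve_left h4
    exact Subtype.ext hq0
  have hsurj := LinearMap.injective_iff_surjective.1 hinj
  have hf : polyOp ℓ f ∈ V := by
    rw [mem_restrictTotalDegree]
    have := totalDegree_polyOp_le ℓ f
    omega
  obtain ⟨⟨q, hq⟩, hTq⟩ := hsurj ⟨_, hf⟩
  have h1 : polyOp ℓ (ballPoly n * q) = polyOp ℓ f := congrArg Subtype.val hTq
  refine ⟨f - ballPoly n * q, by rw [map_sub, h1, sub_self], fun y hy => ?_⟩
  have : polyEval (f - ballPoly n * q) y = polyEval f y - polyEval (ballPoly n) y * polyEval q y := by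
    simp [polyEval]
  rw [this, polyEval_ballPoly, hy]
  simp

end Polynomial

/-! ### Harmonic measure at the centre of the ball. -/

section HarmonicMeasure

open MvPolynomial

variable {n : ℕ}

/-- Restriction of polynomials to the unit sphere. -/
noncomputable def sphereRestrict (n : ℕ) :
    MvPolynomial (Fin n) ℝ →ₐ[ℝ] C(Metric.sphere (0 : E n) 1, ℝ) :=
  aeval fun i => ⟨fun σ => (σ : E n) i, by fun_prop⟩

theorem sphereRestrict_apply (q : MvPolynomial (Fin n) ℝ) (σ : Metric.sphere (0 : E n) 1) :
    sphereRestrict n q σ = polyEval q σ := by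
  induction q using MvPolynomial.induction_on with
  | C a => simp [sphereRestrict, polyEval, Algebra.algebraMap_eq_smul_one]
  | add f g hf hg => rw [map_add, ContinuousMap.add_apply, hf, hg]; simp [polyEval]
  | mul_X f i hf =>
    rw [map_mul, ContinuousMap.mul_apply, hf]
    simp [polyEval, sphereRestrict]

theorem exists_polynomial_near (g : C(Metric.sphere (0 : E n) 1, ℝ)) {ε : ℝ} (hε : 0 < ε) :
    ∃ q : MvPolynomial (Fin n) ℝ, ∀ σ : Metric.sphere (0 : E n) 1, |polyEval q σ - g σ| < ε := by
  have hsep : (sphereRestrict n).range.SeparatesPoints := by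
    intro σ τ hne
    obtain ⟨i, hi⟩ : ∃ i, (σ : E n) i ≠ (τ : E n) i := by
      by_contra! h
      exact hne (Subtype.ext (PiLp.ext h))
    refine ⟨sphereRestrict n (X i), ⟨sphereRestrict n (X i), ⟨X i, rfl⟩, rfl⟩, ?_⟩
    simpa [sphereRestrict_apply, polyEval] using hi
  obtain ⟨⟨_, q, rfl⟩, hq⟩ :=
    ContinuousMap.exists_mem_subalgebra_near_continuousMap_of_separatesPoints _ hsep g ε hε
  refine ⟨q, fun σ => ?_⟩
  have := (ContinuousMap.norm_lt_iff _ hε).1 hq σ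
  simpa [← sphereRestrict_apply] using this

/-- By the maximum principle a polynomial solution is determined by its boundary values, and its
value at 0 is at most their sup norm. Hahn-Banach extends this evaluation to all continuous
functions. -/
theorem IsElliptic.exists_functional {ℓ : Matrix (Fin n) (Fin n) ℝ →ₗ[ℝ] ℝ} (hℓ : IsElliptic ℓ) :
    ∃ Λ : C(Metric.sphere (0 : E n) 1, ℝ) →ₗ[ℝ] ℝ, (∀ g, 0 ≤ g → 0 ≤ Λ g) ∧
      ∀ h, polyOp ℓ h = 0 → Λ (sphereRestrict n h) = polyEval h 0 := by
  set ρ : LinearMap.ker (polyOp ℓ) →ₗ[ℝ] C(Metric.sphere (0 : E n) 1, ℝ) :=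
    (sphereRestrict n).toLinearMap.comp (LinearMap.ker (polyOp ℓ)).subtype with hρ
  have hρ_apply : ∀ h : LinearMap.ker (polyOp ℓ), ∀ σ, ρ h σ = polyEval h.1 σ := fun h σ => by
    simp [hρ, sphereRestrict_apply]
  have hle : ∀ h : LinearMap.ker (polyOp ℓ), ∀ c : ℝ, (∀ σ, ρ h σ ≤ c) →
      ∀ y : E n, ‖y‖ ≤ 1 → polyEval h.1 y ≤ c := by
    intro h c hc y hy
    refine hℓ.le_of_le_on_sphere (contDiff_polyEval h.1) (fun y _ => ?_)
      (fun y hy => ?_) hy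
    · rw [← polyEval_polyOp, LinearMap.mem_ker.1 h.2]; simp [polyEval]
    · have := hc ⟨y, by simpa using hy⟩
      rwa [hρ_apply] at this
  have hinj : Function.Injective ρ := by
    rw [← LinearMap.ker_eq_bot, LinearMap.ker_eq_bot']
    intro h h0
    refine Subtype.ext (polyEval_eq_of_forall_ball fun y hy => le_antisymm ?_ ?_)
    · exact hle h 0 (fun σ => by rw [h0]; simp) y hy.le
    · have := hle (-h) 0 (fun σ => by rw [map_neg, h0]; simp) y hy.le
      simp only [NegMemClass.coe_neg, polyEval, map_neg] at this
      simp only [polyEval]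
      linarith
  set e := LinearEquiv.ofInjective ρ hinj with he
  set ev : LinearMap.ker (polyOp ℓ) →ₗ[ℝ] ℝ :=
    { toFun := fun h => polyEval h.1 0
      map_add' := fun a b => by simp [polyEval]
      map_smul' := fun a b => by simp [polyEval] } with hev
  have hrho : ∀ x : LinearMap.range ρ, ρ (e.symm x) = x := fun x =>
    congrArg Subtype.val (e.apply_symm_apply x)
  obtain ⟨Λ, hΛ, hΛN⟩ := exists_extension_of_le_sublinear
    ⟨LinearMap.range ρ, ev.comp e.symm.toLinearMap⟩
    (fun g : C(Metric.sphere (0 : E n) 1, ℝ) => ‖g‖)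
    (fun c hc g => by rw [norm_smul, Real.norm_eq_abs, abs_of_pos hc])
    (fun f g => norm_add_le f g)
    (fun x => hle (e.symm x) _ (fun σ => by
      rw [hrho]
      exact (le_abs_self _).trans (ContinuousMap.norm_coe_le_norm (x : C(Metric.sphere (0 : E n) 1, ℝ)) σ)) 0 (by simp))
  have hval : ∀ h, polyOp ℓ h = 0 → Λ (sphereRestrict n h) = polyEval h 0 := by
    intro h hh
    have h1 := hΛ ⟨ρ ⟨h, hh⟩, ⟨h, hh⟩, rfl⟩
    have h2 : e.symm ⟨ρ ⟨h, hh⟩, ⟨h, hh⟩, rfl⟩ = ⟨h, hh⟩ := by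
      rw [LinearEquiv.symm_apply_eq]; rfl
    simp only [LinearPMap.mk_apply, LinearMap.comp_apply, LinearEquiv.coe_coe, h2] at h1
    exact h1
  refine ⟨Λ, fun g hg => ?_, hval⟩
  have h1 : Λ 1 = 1 := by
    have : polyOp ℓ (1 : MvPolynomial (Fin n) ℝ) = 0 := by
      simp [polyOp, LinearMap.sum_apply]
    have := hval 1 this
    rw [map_one (sphereRestrict n)] at this
    simpa [polyEval] using this
  -- A functional bounded by the norm with Λ 1 = 1 is positive: for g ≥ 0 the function ‖g‖ - g has
  -- norm at most ‖g‖, so ‖g‖ - Λ g ≤ ‖g‖.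
  have h2 := hΛN (‖g‖ • 1 - g)
  rw [map_sub, map_smul, h1, smul_eq_mul, mul_one] at h2
  have h3 : ‖‖g‖ • (1 : C(Metric.sphere (0 : E n) 1, ℝ)) - g‖ ≤ ‖g‖ := by
    refine (ContinuousMap.norm_le _ (norm_nonneg g)).2 fun σ => ?_
    have h4 : 0 ≤ g σ := hg σ
    have h5 := (le_abs_self _).trans (g.norm_coe_le_norm σ)
    simp only [ContinuousMap.sub_apply, ContinuousMap.smul_apply, ContinuousMap.one_apply,
      smul_eq_mul, mul_one, Real.norm_eq_abs]
    rw [abs_le]; constructor <;> linarith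
  linarith

/-- Harmonic measure of the unit ball at the centre for a constant coefficient degenerate
elliptic operator. -/
theorem IsElliptic.exists_harmonicMeasure {ℓ : Matrix (Fin n) (Fin n) ℝ →ₗ[ℝ] ℝ}
    (hℓ : IsElliptic ℓ) : ∃ ν : Measure (Metric.sphere (0 : E n) 1), IsProbabilityMeasure ν ∧
      ∀ h, polyOp ℓ h = 0 → ∫ σ, polyEval h (σ : E n) ∂ν = polyEval h 0 := by
  obtain ⟨Λ, hpos, hΛ⟩ := hℓ.exists_functional
  set Λ₀ : CompactlySupportedContinuousMap (Metric.sphere (0 : E n) 1) ℝ →ₚ[ℝ] ℝ :=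
    PositiveLinearMap.mk₀
      { toFun := fun f => Λ f.toContinuousMap
        map_add' := fun f g => by rw [← map_add]; rfl
        map_smul' := fun c f => by
          rw [RingHom.id_apply, ← map_smul]; rfl }
      (fun f hf => hpos _ fun σ => hf σ) with hΛ₀
  have hint : ∀ g : C(Metric.sphere (0 : E n) 1, ℝ),
      ∫ σ, g σ ∂(RealRMK.rieszMeasure Λ₀) = Λ g := fun g =>
    RealRMK.integral_rieszMeasure Λ₀ (CompactlySupportedContinuousMap.continuousMapEquiv g)
  have hval : ∀ h, polyOp ℓ h = 0 →
      ∫ σ, polyEval h (σ : E n) ∂(RealRMK.rieszMeasure Λ₀) = polyEval h 0 := fun h hh => by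
    rw [← hΛ h hh, ← hint]
    exact integral_congr_ae (Eventually.of_forall fun σ => (sphereRestrict_apply h σ).symm)
  refine ⟨RealRMK.rieszMeasure Λ₀, ⟨?_⟩, hval⟩
  have h1 := hval 1 (by simp [polyOp, LinearMap.sum_apply])
  simp only [polyEval, map_one, integral_const, smul_eq_mul, mul_one, Measure.real] at h1
  exact (ENNReal.toReal_eq_one_iff _).1 h1

/-- Second moments of the harmonic measure. -/
theorem integral_quadratic {ℓ : Matrix (Fin n) (Fin n) ℝ →ₗ[ℝ] ℝ} (hℓ : IsElliptic ℓ)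
    {ν : Measure (Metric.sphere (0 : E n) 1)}
    (hν : ∀ h, polyOp ℓ h = 0 → ∫ σ, polyEval h (σ : E n) ∂ν = polyEval h 0)
    (b : E n →L[ℝ] ℝ) {B : E n →L[ℝ] E n →L[ℝ] ℝ} (hB : ∀ v w, B v w = B w v)
    {A : Matrix (Fin n) (Fin n) ℝ}
    (hA : ∀ v w : E n, v.ofLp ⬝ᵥ A.mulVec w.ofLp = B v w) :
    ∫ σ, (b (σ : E n) + 1 / 2 * B (σ : E n) σ) ∂ν = ℓ A / (2 * ℓ 1) := by
  set κ := ℓ A / (2 * ℓ 1) with hκ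
  -- The added term κ(1 - |y|²) is zero on the sphere and equals κ at the centre; κ is chosen so
  -- that ℓ(A) - 2κ ℓ(I) = 0, making q a solution.
  set q : MvPolynomial (Fin n) ℝ := ∑ i, C (b (EuclideanSpace.single i 1)) * X i +
    C (1 / 2) * ∑ i, X i * ∑ j, C (A i j) * X j + C κ * ballPoly n with hq
  have hev : ∀ y, polyEval q y = b y + 1 / 2 * B y y + κ * (1 - ‖y‖ ^ 2) := by
    intro y
    have h1 : polyEval q y = ∑ i, b (EuclideanSpace.single i 1) * y i +
        1 / 2 * (∑ i, y i * ∑ j, A i j * y j) + κ * polyEval (ballPoly n) y := by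
      simp [polyEval, hq]
    rw [h1, polyEval_ballPoly, ← hA]
    congr 2
    conv_rhs => rw [← sum_single_smul y]
    simp [map_sum, mul_comm]
  have hqf : polyEval q = fun y => (b y + 1 / 2 * B y y + κ) + (-κ) * ‖y‖ ^ 2 := by
    ext y; rw [hev]; ring
  have hsqc : ContDiff ℝ 2 (fun y : E n => ‖y‖ ^ 2) := contDiff_norm_sq ℝ
  have hBc : ContDiff ℝ 2 fun y : E n => b y + 1 / 2 * B y y + κ :=
    (b.contDiff.add (contDiff_const.mul (B.contDiff.clm_apply contDiff_id))).add contDiff_const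
  have hhess : ∀ y, hessian (polyEval q) y = A + (-κ * 2) • (1 : Matrix (Fin n) (Fin n) ℝ) := by
    intro y
    rw [hqf, hessian_add hBc.contDiffAt (contDiff_const.mul hsqc).contDiffAt,
      hessian_const_mul hsqc.contDiffAt, hessian_norm_sq, smul_smul]
    congr 1
    have h1 : ∀ y : E n, HasFDerivAt (fun y : E n => b y + 1 / 2 * B y y + κ) (b + B y) y := by
      intro y
      have h2 : HasFDerivAt (fun y : E n => B y y) (B y + B.flip y) y := by
        have := B.hasFDerivAt (x := y) |>.clm_apply (hasFDerivAt_id y)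
        refine this.congr_fderiv ?_
        ext v; simp
      refine ((b.hasFDerivAt.add (h2.const_mul (1 / 2))).add_const κ).congr_fderiv ?_
      ext v
      simp [hB v y]
      ring
    rw [hessian_eq_of_hasFDerivAt (φ'' := B) (Eventually.of_forall h1)
      (B.hasFDerivAt.const_add b)]
    ext i j
    rw [Matrix.of_apply, ← hA]
    simp
  have hop : polyOp ℓ q = 0 := by
    refine polyEval_eq_of_forall_ball fun y _ => ?_
    rw [polyEval_polyOp, hhess, map_add, map_smul, smul_eq_mul, hκ]
    have := hℓ.one_pos
    field_simp
    ring
  have h1 := hν q hop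
  rw [hev 0] at h1
  have h2 : ∀ σ : Metric.sphere (0 : E n) 1,
      polyEval q (σ : E n) = b (σ : E n) + 1 / 2 * B (σ : E n) σ := fun σ => by
    rw [hev, mem_sphere_zero_iff_norm.1 σ.2]; ring
  simp only [h2] at h1
  rw [h1]
  simp

end HarmonicMeasure

/-! ### Functions bounded above, encoded by their nonnegative defect. -/

section Gap

/-- The defect `C - a ∈ [0, ∞]` of an extended real number `a ≤ C`. -/
noncomputable def gap (C : ℝ) (a : EReal) : ENNReal := ((C : EReal) - a).toENNReal

variable {C : ℝ}

theorem gap_antitone (C : ℝ) : Antitone (gap C) := fun _ _ h =>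
  EReal.toENNReal_le_toENNReal (EReal.sub_le_sub le_rfl h)

@[simp] theorem gap_coe (C b : ℝ) : gap C b = ENNReal.ofReal (C - b) := by
  rw [gap, ← EReal.coe_sub, EReal.real_coe_toENNReal]

@[simp] theorem gap_bot (C : ℝ) : gap C ⊥ = ⊤ := by simp [gap]

theorem coe_sub_gap {a : EReal} (h : a ≤ C) : (C : EReal) - (gap C a : EReal) = a := by
  induction a with
  | bot => simp
  | top => simp at h
  | coe b =>
    have hb : b ≤ C := by exact_mod_cast h
    rw [gap_coe, EReal.coe_ennreal_ofReal, max_eq_left (by linarith), ← EReal.coe_sub]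
    congr 1; ring

theorem gap_coe_sub (C : ℝ) (w : ENNReal) : gap C ((C : EReal) - (w : EReal)) = w := by
  induction w with
  | top => simp
  | coe w =>
    have : ((w : ENNReal) : EReal) = ((w : ℝ) : EReal) := rfl
    rw [this, ← EReal.coe_sub, gap_coe]
    simp

theorem coe_sub_le (C : ℝ) (w : ENNReal) : (C : EReal) - (w : EReal) ≤ C := by
  have := EReal.sub_le_sub (le_refl (C : EReal)) (EReal.coe_ennreal_nonneg w)
  simpa using this

theorem coe_sub_antitone (C : ℝ) : Antitone fun w : ENNReal => (C : EReal) - (w : EReal) :=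
  fun _ _ h => EReal.sub_le_sub le_rfl (EReal.coe_ennreal_le_coe_ennreal_iff.2 h)

theorem le_of_ofReal_le_gap {a : EReal} {t : ℝ} (h : a ≤ C) (ht : 0 ≤ t)
    (hg : ENNReal.ofReal t ≤ gap C a) : a ≤ ((C - t : ℝ) : EReal) := by
  have := coe_sub_antitone C hg
  simp only [coe_sub_gap h, EReal.coe_ennreal_ofReal, max_eq_left ht] at this
  exact_mod_cast this

theorem continuous_gap (C : ℝ) : Continuous (gap C) := by
  refine EReal.continuous_toENNReal.comp ?_
  refine continuous_iff_continuousAt.2 fun a => ?_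
  have h : ContinuousAt (fun q : EReal × EReal => q.1 + q.2) ((C : EReal), -a) :=
    EReal.continuousAt_add (Or.inl (EReal.coe_ne_top C)) (Or.inl (EReal.coe_ne_bot C))
  have h2 : ContinuousAt (fun a : EReal => ((C : EReal), -a)) a :=
    (continuous_const.prodMk continuous_neg).continuousAt
  exact Tendsto.comp (g := fun q : EReal × EReal => q.1 + q.2) h h2

theorem continuous_coe_sub (C : ℝ) : Continuous fun w : ENNReal => (C : EReal) - (w : EReal) := by
  refine continuous_iff_continuousAt.2 fun a => ?_
  have h : ContinuousAt (fun q : EReal × EReal => q.1 + q.2) ((C : EReal), -(a : EReal)) :=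
    EReal.continuousAt_add (Or.inl (EReal.coe_ne_top C)) (Or.inl (EReal.coe_ne_bot C))
  have h2 : ContinuousAt (fun a : ENNReal => ((C : EReal), -(a : EReal))) a :=
    (continuous_const.prodMk
      (continuous_neg.comp continuous_coe_ennreal_ereal)).continuousAt
  exact Tendsto.comp (g := fun q : EReal × EReal => q.1 + q.2) h h2

theorem measurable_gap (C : ℝ) : Measurable (gap C) := (continuous_gap C).measurable

end Gap

/-! ### Integrals of lower semi-continuous functions via continuous minorants. -/

section LowerSemicontinuous

/-- A lower semicontinuous function on a compact metric space is, as far as its integral is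
concerned, a limit of continuous minorants. -/
theorem lintegral_le_of_forall_continuous {S : Type*} [MetricSpace S] [CompactSpace S]
    [MeasurableSpace S] [BorelSpace S] (ν : Measure S) {W : S → ENNReal}
    (hW : LowerSemicontinuous W) {c : ENNReal}
    (h : ∀ f : C(S, ℝ), 0 ≤ f → (∀ σ, ENNReal.ofReal (f σ) ≤ W σ) →
      ∫⁻ σ, ENNReal.ofReal (f σ) ∂ν ≤ c) :
    ∫⁻ σ, W σ ∂ν ≤ c := by
  set T : ℕ → S → ℝ := fun k τ => (min (W τ) k).toReal with hT
  have hT0 : ∀ k τ, 0 ≤ T k τ := fun k τ => ENNReal.toReal_nonneg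
  have hTW : ∀ k τ, ENNReal.ofReal (T k τ) ≤ W τ := fun k τ => by
    rw [hT, ENNReal.ofReal_toReal (ne_top_of_le_ne_top (ENNReal.natCast_ne_top k)
      (min_le_right _ _))]
    exact min_le_left _ _
  -- Inf-convolution of the truncation with k times the distance: a k-Lipschitz minorant of W.
  set f : ℕ → S → ℝ := fun k σ => ⨅ τ, (T k τ + k * dist σ τ) with hf
  have hbdd : ∀ k σ, BddBelow (Set.range fun τ => T k τ + k * dist σ τ) := fun k σ =>
    ⟨0, by
      rintro _ ⟨τ, rfl⟩
      have := hT0 k τ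
      positivity⟩
  have hf0 : ∀ k σ, 0 ≤ f k σ := fun k σ => Real.iInf_nonneg fun τ => by
    have := hT0 k τ
    positivity
  have hfT : ∀ k σ, f k σ ≤ T k σ := fun k σ => by
    have := ciInf_le (hbdd k σ) σ
    simpa using this
  have hlip : ∀ k : ℕ, LipschitzWith (k : NNReal) (f k) := by
    intro k
    refine LipschitzWith.of_le_add_mul _ fun σ σ' => ?_
    have : Nonempty S := ⟨σ⟩
    rw [← sub_le_iff_le_add]
    refine le_ciInf fun τ => ?_
    have h1 := ciInf_le (hbdd k σ) τ
    have h2 := dist_triangle σ σ' τ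
    have h3 : (k : ℝ) * dist σ τ ≤ k * (dist σ σ' + dist σ' τ) := by gcongr
    simp only [NNReal.coe_natCast, hf] at *
    linarith
  have hint : ∀ k, ∫⁻ σ, ENNReal.ofReal (f k σ) ∂ν ≤ c := fun k =>
    h ⟨f k, (hlip k).continuous⟩ (fun σ => hf0 k σ) fun σ =>
      (ENNReal.ofReal_le_ofReal (hfT k σ)).trans (hTW k σ)
  have hlim : ∀ σ, W σ ≤ liminf (fun k => ENNReal.ofReal (f k σ)) atTop := by
    intro σ
    refine le_of_forall_lt fun a ha => ?_
    obtain ⟨b, hab, hbW⟩ := exists_between ha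
    lift b to NNReal using hbW.ne_top
    refine hab.trans_le (le_liminf_of_le (by isBoundedDefault) ?_)
    obtain ⟨δ, hδ, hball⟩ := Metric.eventually_nhds_iff_ball.1 (hW σ b hbW)
    -- Within δ of σ lower semi-continuity gives W > b, and k ≥ b keeps the truncation above b;
    -- beyond δ the penalty k δ is already at least b.
    obtain ⟨k₀, hk₀⟩ := exists_nat_ge (max (b : ℝ) (b / δ))
    filter_upwards [eventually_ge_atTop k₀] with k hk
    have : Nonempty S := ⟨σ⟩
    have hk' : max (b : ℝ) (b / δ) ≤ k := hk₀.trans (by exact_mod_cast hk)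
    have hkb : (b : ℝ) ≤ k := (le_max_left _ _).trans hk'
    have hkδ : (b : ℝ) ≤ k * δ := (div_le_iff₀ hδ).1 ((le_max_right _ _).trans hk')
    have : (b : ℝ) ≤ f k σ := by
      refine le_ciInf fun τ => ?_
      rcases lt_or_ge (dist τ σ) δ with hτ | hτ
      · have h1 : (b : ENNReal) ≤ min (W τ) k :=
          le_min (hball τ hτ).le (by exact_mod_cast hkb)
        have h2 := ENNReal.toReal_mono (ne_top_of_le_ne_top (ENNReal.natCast_ne_top k)
          (min_le_right (W τ) _)) h1
        have h3 : (b : ℝ) ≤ T k τ := h2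
        have h4 : 0 ≤ (k : ℝ) * dist σ τ := by positivity
        linarith
      · rw [dist_comm] at hτ
        have h4 : (k : ℝ) * δ ≤ k * dist σ τ := by gcongr
        linarith [hT0 k τ]
    rw [← ENNReal.ofReal_coe_nnreal]
    exact ENNReal.ofReal_le_ofReal this
  calc ∫⁻ σ, W σ ∂ν ≤ ∫⁻ σ, liminf (fun k => ENNReal.ofReal (f k σ)) atTop ∂ν :=
        lintegral_mono hlim
    _ ≤ liminf (fun k => ∫⁻ σ, ENNReal.ofReal (f k σ) ∂ν) atTop :=
        lintegral_liminf_le fun k => ((hlip k).continuous.measurable).ennreal_ofReal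
    _ ≤ c := liminf_le_of_le (by isBoundedDefault) fun b hb => by
        obtain ⟨k, hk⟩ := hb.exists
        exact hk.trans (hint k)

end LowerSemicontinuous

/-! ### Invariance of subharmonicity under similarities. -/

section AffineChange

variable {n : ℕ} {F : Set (Matrix (Fin n) (Fin n) ℝ)} {X : Set (E n)} {u : E n → EReal}

/-- The action of a matrix on Euclidean space. -/
noncomputable abbrev matMap (g : Matrix (Fin n) (Fin n) ℝ) : E n →L[ℝ] E n :=
  Matrix.toEuclideanCLM (𝕜 := ℝ) g

theorem matMap_mul_apply (g h : Matrix (Fin n) (Fin n) ℝ) (y : E n) :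
    matMap (g * h) y = matMap g (matMap h y) := by
  rw [matMap, map_mul]; rfl

theorem norm_matMap {g : Matrix (Fin n) (Fin n) ℝ} (hg : g.transpose * g = 1) (y : E n) :
    ‖matMap g y‖ = ‖y‖ := by
  rw [← sq_eq_sq₀ (norm_nonneg _) (norm_nonneg _), norm_sq_eq_dotProduct, norm_sq_eq_dotProduct,
    Matrix.ofLp_toEuclideanCLM, Matrix.dotProduct_mulVec, Matrix.vecMul_mulVec, hg,
    Matrix.vecMul_one]

theorem isSubharmonicOn_const (hF : IsSTConeSubequation F) {c : EReal} (hc : c ≠ ⊤) :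
    IsSubharmonicOn F X fun _ => c where
  usc := upperSemicontinuousOn_const
  ne_top _ _ := hc
  viscosity x _ φ hφ h1 h2 := by
    refine hF.mem_of_posSemidef (posSemidef_hessian_of_isLocalMin hφ ?_)
    filter_upwards [h2] with y hy
    rw [h1] at hy
    exact_mod_cast hy

/-- A test function for the composite is transported by the inverse similarity to one for u. The
rotation in the resulting Hessian is undone by `hinv` and the factor a⁻² by the cone property. -/
theorem IsSubharmonicOn.comp_affine (hF : IsSTConeSubequation F) (hu : IsSubharmonicOn F X u)
    {g : Matrix (Fin n) (Fin n) ℝ} (hg : g * g.transpose = 1)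
    (hinv : ∀ A ∈ F, g.transpose * A * g ∈ F) {a : ℝ} (ha : 0 < a) (x : E n) :
    IsSubharmonicOn F {y | x + a • matMap g y ∈ X} fun y => u (x + a • matMap g y) where
  usc := by
    have hc : Continuous fun y : E n => x + a • matMap g y := by fun_prop
    exact hu.usc.comp hc.continuousOn fun y hy => hy
  ne_top y hy := hu.ne_top _ hy
  viscosity y hy φ hφ h1 h2 := by
    have hg' : g.transpose * g = 1 := mul_eq_one_comm.1 hg
    set L : E n →L[ℝ] E n := a⁻¹ • matMap g.transpose with hL
    have hLM : ∀ v : E n, (L v).ofLp = (a⁻¹ • g.transpose).mulVec v.ofLp := fun v => by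
      rw [hL, Matrix.smul_mulVec]
      simp
    have hLinv : ∀ z : E n, L (a • matMap g z) = z := fun z => by
      rw [hL, smul_apply, map_smul, smul_smul, inv_mul_cancel₀ ha.ne', one_smul,
        ← matMap_mul_apply, hg', matMap, map_one]
      rfl
    have hinvL : ∀ w : E n, a • matMap g (L w) = w := fun w => by
      rw [hL, smul_apply, map_smul, smul_smul, mul_inv_cancel₀ ha.ne', one_smul,
        ← matMap_mul_apply, hg, matMap, map_one]
      rfl
    set w₀ := x + a • matMap g y with hw₀
    have hpt : L w₀ + -L x = y := by rw [hw₀, map_add, hLinv]; abel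
    have hφ' : ContDiffAt ℝ 2 φ (L w₀ + -L x) := by rwa [hpt]
    have hLc : ContDiff ℝ 2 fun w => L w + -L x := L.contDiff.add contDiff_const
    have hmem := hu.viscosity w₀ hy (fun w => φ (L w + -L x))
      (ContDiffAt.comp (g := φ) w₀ hφ' hLc.contDiffAt) (by rw [hpt]; exact h1) (by
        have ht : Tendsto (fun w => L w + -L x) (𝓝 w₀) (𝓝 y) := by
          have := hLc.continuous.tendsto w₀
          rwa [hpt] at this
        filter_upwards [ht.eventually h2] with w hw
        rw [← sub_eq_add_neg, ← map_sub, hinvL, add_sub_cancel] at hw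
        rwa [← sub_eq_add_neg, ← map_sub])
    rw [hessian_comp_affine (a⁻¹ • g.transpose) L hLM (-L x) w₀ hφ', hpt] at hmem
    have h3 := hF.cone _ (hinv _ hmem) (a ^ 2) (by positivity)
    have h4 : a ^ 2 • (g.transpose * ((a⁻¹ • g.transpose).transpose * hessian φ y *
        (a⁻¹ • g.transpose)) * g) = hessian φ y := by
      simp only [Matrix.transpose_smul, Matrix.transpose_transpose, Matrix.smul_mul,
        Matrix.mul_smul, smul_smul]
      have e1 : g.transpose * (g * hessian φ y * g.transpose) * g =
          (g.transpose * g) * hessian φ y * (g.transpose * g) := by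
        simp only [Matrix.mul_assoc]
      rw [e1, hg', one_mul, mul_one]
      have : a ^ 2 * (a⁻¹ * a⁻¹) = 1 := by field_simp
      rw [this, one_smul]
    rwa [h4] at h3

end AffineChange

/-! ### Separating a matrix from F by an elliptic functional. -/

section Separation

variable {n : ℕ} {F : Set (Matrix (Fin n) (Fin n) ℝ)}

theorem exists_posSemidef_add_smul_one {A : Matrix (Fin n) (Fin n) ℝ} (hA : A.IsSymm) :
    ∃ t : ℝ, (A + t • (1 : Matrix (Fin n) (Fin n) ℝ)).PosSemidef := by
  refine ⟨∑ i, ∑ j, |A i j|, Matrix.PosSemidef.of_dotProduct_mulVec_nonneg ?_ fun v => ?_⟩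
  · refine Matrix.IsHermitian.add ?_ ?_
    · rw [Matrix.IsHermitian, Matrix.conjTranspose_eq_transpose_of_trivial]; exact hA
    · rw [Matrix.IsHermitian, Matrix.conjTranspose_smul, Matrix.conjTranspose_one, star_trivial]
  · have h1 : star v ⬝ᵥ (A + (∑ i, ∑ j, |A i j|) • (1 : Matrix (Fin n) (Fin n) ℝ)).mulVec v =
        ∑ i, ∑ j, (v i * A i j * v j + |A i j| * ∑ k, v k * v k) := by
      rw [star_trivial, Matrix.add_mulVec, Matrix.smul_mulVec, Matrix.one_mulVec, dotProduct_add,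
        dotProduct_smul, smul_eq_mul]
      simp only [dotProduct, Matrix.mulVec, Finset.sum_add_distrib, ← Finset.sum_mul]
      simp only [Finset.mul_sum, mul_assoc]
    rw [h1]
    refine Finset.sum_nonneg fun i _ => Finset.sum_nonneg fun j _ => ?_
    have h2 : ∀ i, v i * v i ≤ ∑ k, v k * v k := fun i =>
      Finset.single_le_sum (f := fun k => v k * v k) (fun k _ => mul_self_nonneg (v k))
        (Finset.mem_univ i)
    have h3 : |v i * v j| ≤ ∑ k, v k * v k := by
      rw [abs_mul]
      nlinarith [h2 i, h2 j, sq_nonneg (|v i| - |v j|), abs_mul_abs_self (v i),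
        abs_mul_abs_self (v j)]
    have h4 : |v i * A i j * v j| ≤ |A i j| * ∑ k, v k * v k := by
      rw [show v i * A i j * v j = A i j * (v i * v j) by ring, abs_mul]
      gcongr
    linarith [neg_abs_le (v i * A i j * v j)]

/-- A closed convex cone subequation is an intersection of linear elliptic half spaces. -/
theorem IsSTConeSubequation.exists_isElliptic (hF : IsSTConeSubequation F) (hconv : Convex ℝ F)
    {A : Matrix (Fin n) (Fin n) ℝ} (hA : A.IsSymm) (hAF : A ∉ F) :
    ∃ ℓ : Matrix (Fin n) (Fin n) ℝ →ₗ[ℝ] ℝ, IsElliptic ℓ ∧ (∀ B ∈ F, 0 ≤ ℓ B) ∧ ℓ A < 0 := by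
  have : LocallyConvexSpace ℝ (Matrix (Fin n) (Fin n) ℝ) :=
    inferInstanceAs (LocallyConvexSpace ℝ (Fin n → Fin n → ℝ))
  obtain ⟨f, s, hfA, hfF⟩ := geometric_hahn_banach_point_closed hconv hF.isClosed hAF
  -- A functional bounded below on a cone is nonnegative on it, since a negative value could be
  -- scaled down to s.
  have hs : s < 0 := by simpa using hfF 0 hF.zero_mem
  have hnonneg : ∀ B ∈ F, 0 ≤ f B := by
    intro B hB
    by_contra! hneg
    have h1 := hfF _ (hF.cone B hB (s / f B) (div_nonneg_of_nonpos hs.le hneg.le))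
    rw [map_smul, smul_eq_mul, div_mul_cancel₀ _ hneg.ne] at h1
    exact lt_irrefl _ h1
  have hP : ∀ P : Matrix (Fin n) (Fin n) ℝ, P.PosSemidef → 0 ≤ f P := fun P hP =>
    hnonneg P (hF.mem_of_posSemidef hP)
  refine ⟨f, ⟨hP, ?_⟩, hnonneg, hfA.trans hs⟩
  -- If f vanished at I, positivity on A + t I would give f(A) ≥ 0.
  obtain ⟨t, ht⟩ := exists_posSemidef_add_smul_one hA
  have h1 := hP _ ht
  have h2 := hP 1 Matrix.PosSemidef.one
  rw [map_add, map_smul, smul_eq_mul] at h1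
  refine lt_of_le_of_ne h2 fun h0 => ?_
  simp only [ContinuousLinearMap.coe_coe] at h0
  rw [← h0, mul_zero] at h1
  linarith

end Separation

/-! ### Mean value inequalities against harmonic measure. -/

section MeanValue

open MvPolynomial

variable {n : ℕ} {F : Set (Matrix (Fin n) (Fin n) ℝ)} {X : Set (E n)} {u : E n → EReal}
  {ℓ : Matrix (Fin n) (Fin n) ℝ →ₗ[ℝ] ℝ} {ν : Measure (Metric.sphere (0 : E n) 1)}

/-- Approximate g by a polynomial, solve the Dirichlet problem and compare u with the solution plus
ε(1 - |y|²), whose Hessian has negative ℓ and so lies outside F. The errors are 2ε on the boundary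
and ε at the centre, hence the constant 3. -/
theorem IsSubharmonicOn.le_integral_of_le (hu : IsSubharmonicOn F X u)
    (hX : Metric.closedBall (0 : E n) 1 ⊆ X) (hℓ : IsElliptic ℓ) (hℓF : ∀ B ∈ F, 0 ≤ ℓ B)
    [IsProbabilityMeasure ν]
    (hν : ∀ h, polyOp ℓ h = 0 → ∫ σ, polyEval h (σ : E n) ∂ν = polyEval h 0)
    (g : C(Metric.sphere (0 : E n) 1, ℝ)) 
    (hg : ∀ σ : Metric.sphere (0 : E n) 1, u (σ : E n) ≤ g σ) :
    u 0 ≤ ((∫ σ, g σ ∂ν : ℝ) : EReal) := by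
  refine ereal_le_coe_of_forall_pos 3 fun ε hε => ?_
  obtain ⟨q, hq⟩ := exists_polynomial_near g hε
  obtain ⟨h, hLh, hhq⟩ := hℓ.exists_dirichlet (q + C ε)
  have hqe : ∀ y : E n, polyEval (q + C ε) y = polyEval q y + ε := fun y => by simp [polyEval]
  have hhc := contDiff_polyEval h
  have hsq : ContDiff ℝ 2 (fun y : E n => ‖y‖ ^ 2) := contDiff_norm_sq ℝ
  set b : E n → ℝ := fun y => (polyEval h y + (-ε) * ‖y‖ ^ 2) + ε with hb
  have hbc : ContDiff ℝ 2 b := (hhc.add (contDiff_const.mul hsq)).add contDiff_const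
  have hcmp := hu.le_of_hessian_notMem (isCompact_closedBall (0 : E n) 1) hX
    Metric.isOpen_ball Metric.ball_subset_closedBall hbc.continuous.continuousOn
    (fun y _ => hbc.contDiffAt)
    (fun y _ hmem => by
      have h1 := hℓF _ hmem
      rw [hb, hessian_add_const, hessian_add hhc.contDiffAt (contDiff_const.mul hsq).contDiffAt,
        hessian_const_mul hsq.contDiffAt, hessian_norm_sq, map_add, ← polyEval_polyOp, hLh,
        map_smul, map_smul] at h1
      have h2 := hℓ.one_pos
      simp only [polyEval, map_zero, smul_eq_mul] at h1
      nlinarith [mul_pos hε h2])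
    (fun y hy hyO => by
      have hy1 : ‖y‖ = 1 := by
        have h1 := mem_closedBall_zero_iff.1 hy
        rw [mem_ball_zero_iff, not_lt] at hyO
        exact le_antisymm h1 hyO
      refine (hg ⟨y, by simpa using hy1⟩).trans (EReal.coe_le_coe_iff.2 ?_)
      have h1 := (abs_lt.1 (hq ⟨y, by simpa using hy1⟩)).1
      simp only [hb, hhq y hy1, hqe, hy1]
      linarith)
    0 (by simp)
  refine hcmp.trans (EReal.coe_le_coe_iff.2 ?_)
  have h0 : b 0 = polyEval h 0 + ε := by simp [hb]
  have hgi : Integrable (fun σ => g σ) ν := g.continuous.integrable_of_hasCompactSupport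
    (HasCompactSupport.of_compactSpace _)
  have hhi : Integrable (fun σ : Metric.sphere (0 : E n) 1 => polyEval h (σ : E n)) ν :=
    (hhc.continuous.comp continuous_subtype_val).integrable_of_hasCompactSupport
      (HasCompactSupport.of_compactSpace _)
  have h1 : ∫ σ, polyEval h (σ : E n) ∂ν ≤ ∫ σ, (g σ + 2 * ε) ∂ν := by
    refine integral_mono hhi (hgi.add (integrable_const _)) fun σ => ?_
    have h2 := (abs_lt.1 (hq σ)).2
    simp only [hhq σ (by simp), hqe]
    linarith
  rw [integral_add hgi (integrable_const _), hν h hLh] at h1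
  simp only [integral_const, probReal_univ, one_smul] at h1
  rw [h0]
  linarith

/-- The super mean value inequality for the defect `C - u`. -/
theorem IsSubharmonicOn.lintegral_gap_le (hF : IsSTConeSubequation F)
    (hu : IsSubharmonicOn F X u) (hℓ : IsElliptic ℓ) (hℓF : ∀ B ∈ F, 0 ≤ ℓ B)
    [IsProbabilityMeasure ν]
    (hν : ∀ h, polyOp ℓ h = 0 → ∫ σ, polyEval h (σ : E n) ∂ν = polyEval h 0)
    {y : E n} {r : ℝ} (hr : 0 < r) (hX : Metric.closedBall y r ⊆ X) {C : ℝ}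
    (hC : ∀ z ∈ Metric.closedBall y r, u z ≤ C) :
    ∫⁻ σ : Metric.sphere (0 : E n) 1, gap C (u (y + r • (σ : E n))) ∂ν ≤ gap C (u y) := by
  have hball : ∀ z ∈ Metric.closedBall (0 : E n) 1, y + r • z ∈ Metric.closedBall y r := by
    intro z hz
    rw [mem_closedBall_zero_iff] at hz
    rw [Metric.mem_closedBall, dist_eq_norm, add_sub_cancel_left, norm_smul, Real.norm_eq_abs,
      abs_of_pos hr]
    nlinarith
  have hu' := hu.comp_affine hF (g := 1) (by simp) (by simp) hr y
  simp only [map_one, one_apply_eq_self] at hu'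
  have hX' : Metric.closedBall (0 : E n) 1 ⊆ {z | y + r • z ∈ X} := fun z hz => hX (hball z hz)
  have husc : UpperSemicontinuous fun σ : Metric.sphere (0 : E n) 1 => u (y + r • (σ : E n)) := by
    refine upperSemicontinuousOn_univ_iff.1 ?_
    exact hu'.usc.comp continuous_subtype_val.continuousOn
      fun σ _ => hX' (Metric.sphere_subset_closedBall σ.2)
  -- The defect of u is lower semi-continuous, so continuous f below it suffice; then C - f is a
  -- continuous majorant of u on the sphere.
  refine lintegral_le_of_forall_continuous ν
    ((continuous_gap C).comp_upperSemicontinuous_antitone husc (gap_antitone C)) fun f hf hfW => ?_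
  have hfi : Integrable (fun σ => f σ) ν := f.continuous.integrable_of_hasCompactSupport
    (HasCompactSupport.of_compactSpace _)
  have h1 := hu'.le_integral_of_le hX' hℓ hℓF hν (ContinuousMap.const _ C - f) fun σ =>
    le_of_ofReal_le_gap (hC _ (hball _ (Metric.sphere_subset_closedBall σ.2))) (hf σ) (hfW σ)
  have h2 : ∫ σ, (ContinuousMap.const (Metric.sphere (0 : E n) 1) C - f) σ ∂ν =
      C - ∫ σ, f σ ∂ν := by
    have := integral_sub (integrable_const C) hfi (μ := ν)
    simpa using this
  rw [h2, smul_zero, add_zero] at h1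
  have h3 := gap_antitone C h1
  rw [gap_coe, sub_sub_cancel] at h3
  rwa [← ofReal_integral_eq_lintegral_ofReal hfi (Eventually.of_forall fun σ => hf σ)]

theorem ofReal_integral_le_lintegral {α : Type*} [MeasurableSpace α] {μ : Measure α} {f : α → ℝ}
    (hf : Integrable f μ) : ENNReal.ofReal (∫ a, f a ∂μ) ≤ ∫⁻ a, ENNReal.ofReal (f a) ∂μ := by
  refine ENNReal.ofReal_le_of_le_toReal ?_
  rw [integral_eq_lintegral_pos_part_sub_lintegral_neg_part hf]
  exact sub_le_self _ ENNReal.toReal_nonneg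

/-- Conversely, the super mean value inequality yields the linear viscosity inequality. -/
theorem IsElliptic.nonneg_hessian_of_lintegral_gap_le (hℓ : IsElliptic ℓ)
    [IsProbabilityMeasure ν]
    (hν : ∀ h, polyOp ℓ h = 0 → ∫ σ, polyEval h (σ : E n) ∂ν = polyEval h 0)
    {v : E n → EReal} {C : ℝ} {x : E n} {φ : E n → ℝ} (hφ : ContDiffAt ℝ 2 φ x)
    (hx : v x = φ x) (hC : φ x ≤ C) (hle : ∀ᶠ y in 𝓝 x, v y ≤ φ y)
    (hmean : ∀ᶠ r in 𝓝[>] (0 : ℝ),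
      ∫⁻ σ : Metric.sphere (0 : E n) 1, gap C (v (x + r • (σ : E n))) ∂ν ≤ gap C (v x)) :
    0 ≤ ℓ (hessian φ x) := by
  set b := fderiv ℝ φ x with hb
  set B := fderiv ℝ (fderiv ℝ φ) x with hB
  have hsymm : ∀ v w, B v w = B w v := hφ.isSymmSndFDerivAt (by simp)
  suffices h : ∀ ε : ℝ, 0 < ε → 0 ≤ ℓ (hessian φ x) / (2 * ℓ 1) + ε by
    have h1 : 0 ≤ ℓ (hessian φ x) / (2 * ℓ 1) := le_of_forall_pos_le_add h
    have h2 := hℓ.one_pos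
    have h3 := mul_nonneg h1 (by positivity : 0 ≤ 2 * ℓ 1)
    rwa [div_mul_cancel₀ _ (by positivity)] at h3
  intro ε hε
  obtain ⟨δ, hδ, hball⟩ := Metric.eventually_nhds_iff_ball.1 ((taylor_two hφ hε).and hle)
  obtain ⟨r, hmr, hr⟩ := (hmean.and (Ioo_mem_nhdsGT hδ)).exists
  have hr0 : 0 < r := hr.1
  set Q : C(Metric.sphere (0 : E n) 1, ℝ) :=
    ⟨fun σ => (r • b) (σ : E n) + 1 / 2 * (r ^ 2 • B) (σ : E n) (σ : E n), by fun_prop⟩ with hQ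
  have hQi : Integrable (fun σ => Q σ) ν := Q.continuous.integrable_of_hasCompactSupport
    (HasCompactSupport.of_compactSpace _)
  have hQint : ∫ σ, Q σ ∂ν = r ^ 2 * (ℓ (hessian φ x) / (2 * ℓ 1)) := by
    have := integral_quadratic hℓ hν (r • b) (B := r ^ 2 • B) (A := r ^ 2 • hessian φ x)
      (fun v w => by simp [hsymm v w]) (fun v w => by
        rw [Matrix.smul_mulVec, dotProduct_smul, dotProduct_hessian_mulVec]; rfl)
    rw [map_smul, smul_eq_mul, mul_div_assoc] at this
    exact this
  have hfi : Integrable (fun σ => (C - φ x - ε * r ^ 2) - Q σ) ν :=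
    (integrable_const _).sub hQi
  -- Taylor's formula bounds v(x + rσ) by φ(x) + Q(σ) + ε r². Inserted into the mean value
  -- inequality this gives ∫ Q + ε r² ≥ 0, and ∫ Q is r² ℓ(D²φ)/(2ℓ(I)).
  have h1 : ENNReal.ofReal (∫ σ, ((C - φ x - ε * r ^ 2) - Q σ) ∂ν) ≤
      ENNReal.ofReal (C - φ x) := by
    refine (ofReal_integral_le_lintegral hfi).trans (le_trans (lintegral_mono fun σ => ?_)
      (hmr.trans (by rw [hx, gap_coe])))
    rw [show C - φ x - ε * r ^ 2 - Q σ = C - (φ x + (Q σ + ε * r ^ 2)) by ring, ← gap_coe]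
    refine gap_antitone C ?_
    have hσ : ‖(σ : E n)‖ = 1 := mem_sphere_zero_iff_norm.1 σ.2
    have hrσ : ‖r • (σ : E n)‖ = r := by
      rw [norm_smul, hσ, mul_one, Real.norm_eq_abs, abs_of_pos hr0]
    obtain ⟨h2, h3⟩ := hball (x + r • (σ : E n)) (by
      rw [Metric.mem_ball, dist_eq_norm, add_sub_cancel_left, hrσ]; exact hr.2)
    refine h3.trans (EReal.coe_le_coe_iff.2 ?_)
    have h4 := (abs_le.1 h2).2
    rw [add_sub_cancel_left, hrσ] at h4
    simp only [hQ, ContinuousMap.coe_mk, map_smul, smul_apply, smul_eq_mul] at h4 ⊢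
    linarith
  rw [ENNReal.ofReal_le_ofReal_iff (by linarith), integral_sub (integrable_const _) hQi,
    hQint] at h1
  simp only [integral_const, probReal_univ, one_smul] at h1
  have h5 : 0 ≤ r ^ 2 * (ℓ (hessian φ x) / (2 * ℓ 1) + ε) := by linarith
  exact nonneg_of_mul_nonneg_right h5 (by positivity)

end MeanValue

/-! ### Averages of subharmonic functions are subharmonic. -/

section Average

variable {n : ℕ} {F : Set (Matrix (Fin n) (Fin n) ℝ)} {X : Set (E n)}

/-- Fatou's lemma along the neighbourhood filter, which first countability makes countably
generated. -/
theorem lowerSemicontinuousOn_lintegral {Y Ω : Type*} [TopologicalSpace Y]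
    [FirstCountableTopology Y] [MeasurableSpace Ω] (μ : Measure Ω) {s : Set Y}
    {w : Ω → Y → ENNReal} (hw : ∀ ω, LowerSemicontinuousOn (w ω) s)
    (hm : ∀ y, Measurable fun ω => w ω y) :
    LowerSemicontinuousOn (fun y => ∫⁻ ω, w ω y ∂μ) s := by
  intro y hy
  refine lowerSemicontinuousWithinAt_iff_le_liminf.2 ?_
  calc ∫⁻ ω, w ω y ∂μ ≤ ∫⁻ ω, liminf (w ω) (𝓝[s] y) ∂μ :=
        lintegral_mono fun ω => lowerSemicontinuousWithinAt_iff_le_liminf.1 (hw ω y hy)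
    _ ≤ liminf (fun z => ∫⁻ ω, w ω z ∂μ) (𝓝[s] y) := by
        exact lintegral_liminf_le fun z => hm z

/-- Averages of `F`-subharmonic functions that are uniformly bounded above are `F`-subharmonic
when `F` is convex. -/
theorem isSubharmonicOn_average (hF : IsSTConeSubequation F) (hconv : Convex ℝ F)
    (hX : IsOpen X) {Ω : Type*} [MeasurableSpace Ω] (μ : Measure Ω) [IsProbabilityMeasure μ]
    {U : Ω → E n → EReal} (hU : ∀ ω, IsSubharmonicOn F X (U ω)) {C : ℝ}
    (hC : ∀ ω, ∀ y ∈ X, U ω y ≤ C) (hm : Measurable fun q : Ω × E n => U q.1 q.2) :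
    IsSubharmonicOn F X fun y => (C : EReal) - ((∫⁻ ω, gap C (U ω y) ∂μ : ENNReal) : EReal) where
  usc := by
    refine (continuous_coe_sub C).comp_lowerSemicontinuousOn_antitone ?_ (coe_sub_antitone C)
    refine lowerSemicontinuousOn_lintegral μ (fun ω => ?_) fun y => ?_
    · exact (continuous_gap C).comp_upperSemicontinuousOn_antitone (hU ω).usc (gap_antitone C)
    · exact (measurable_gap C).comp (hm.comp measurable_prodMk_right)
  ne_top y _ := ne_top_of_le_ne_top (EReal.coe_ne_top C) (coe_sub_le C _)
  viscosity x hx φ hφ h1 h2 := by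
    by_contra hnot
    obtain ⟨ℓ, hℓ, hℓF, hneg⟩ := hF.exists_isElliptic hconv (isSymm_hessian hφ) hnot
    obtain ⟨ν, hνp, hν⟩ := hℓ.exists_harmonicMeasure
    refine not_le.2 hneg (hℓ.nonneg_hessian_of_lintegral_gap_le hν hφ h1 ?_ h2 ?_ (C := C))
    · have := coe_sub_le C (∫⁻ ω, gap C (U ω x) ∂μ)
      rw [h1] at this
      exact_mod_cast this
    · obtain ⟨R, hR, hball⟩ := Metric.nhds_basis_closedBall.mem_iff.1 (hX.mem_nhds hx)
      filter_upwards [Ioo_mem_nhdsGT hR] with r hr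
      simp only [gap_coe_sub]
      -- Tonelli reduces the mean value inequality for the average to the one for each member. The
      -- measure depends only on ℓ, not on ω.
      rw [lintegral_lintegral_swap]
      · refine lintegral_mono fun ω => ?_
        have hsub : Metric.closedBall x r ⊆ X :=
          (Metric.closedBall_subset_closedBall hr.2.le).trans hball
        exact (hU ω).lintegral_gap_le hF hℓ hℓF hν hr.1 hsub fun z hz => hC ω z (hsub hz)
      · have h3 : Measurable fun q : Metric.sphere (0 : E n) 1 × Ω => x + r • (q.1 : E n) := by
          fun_prop
        exact ((measurable_gap C).comp (hm.comp (measurable_snd.prodMk h3))).aemeasurable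

end Average

/-! ### Averaging over rotations that preserve F. -/

section RotationAverage

variable {n : ℕ} {F : Set (Matrix (Fin n) (Fin n) ℝ)}

instance compactSpace_orthogonalGroup : CompactSpace (Matrix.orthogonalGroup (Fin n) ℝ) := by
  have hK : IsCompact (Set.univ.pi fun _ : Fin n => Set.univ.pi fun _ : Fin n =>
      Set.Icc (-1 : ℝ) 1) :=
    isCompact_univ_pi fun _ => isCompact_univ_pi fun _ => isCompact_Icc
  have hc : IsClosed ((Matrix.orthogonalGroup (Fin n) ℝ : Submonoid _) :
      Set (Matrix (Fin n) (Fin n) ℝ)) := isClosed_unitary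
  refine isCompact_iff_compactSpace.1 (hK.of_isClosed_subset hc ?_)
  intro g hg i _ j _
  exact abs_le.1 (entry_norm_bound_of_unitary hg i j)

theorem continuous_matMap_apply : Continuous fun q : Matrix (Fin n) (Fin n) ℝ × E n =>
    matMap q.1 q.2 := by
  have : Continuous fun q : Matrix (Fin n) (Fin n) ℝ × E n => q.1.mulVec q.2.ofLp :=
    continuous_fst.matrix_mulVec ((PiLp.continuous_ofLp 2 _).comp continuous_snd)
  exact (PiLp.continuous_toLp 2 _).comp this

theorem isOrthogonal_of_mem {g : Matrix (Fin n) (Fin n) ℝ}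
    (hg : g ∈ Matrix.orthogonalGroup (Fin n) ℝ) : g * g.transpose = 1 := by
  simpa [Matrix.star_eq_conjTranspose] using (Matrix.mem_orthogonalGroup_iff (Fin n) ℝ).1 hg

theorem exists_invariant_probability (H : Type) [Group H] [TopologicalSpace H]
    [IsTopologicalGroup H] [CompactSpace H] [MeasurableSpace H] [BorelSpace H] :
    ∃ μ : Measure H, IsProbabilityMeasure μ ∧
      ∀ (f : H → ENNReal) (h : H), ∫⁻ ω, f (h * ω) ∂μ = ∫⁻ ω, f ω ∂μ := by
  have : NeZero (Measure.haar : Measure H) := inferInstance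
  exact ⟨(Measure.haar (G := H) Set.univ)⁻¹ • Measure.haar, inferInstance, fun f h =>
    lintegral_mul_left_eq_self f h⟩

/-- A random rotation preserving `F` and acting transitively on spheres. -/
structure IsRandomRotation (F : Set (Matrix (Fin n) (Fin n) ℝ)) {Ω : Type} [MeasurableSpace Ω]
    (μ : Measure Ω) (M : Ω → Matrix (Fin n) (Fin n) ℝ) : Prop where
  isProb : IsProbabilityMeasure μ
  orth : ∀ ω, M ω * (M ω).transpose = 1
  mem : ∀ ω, ∀ A ∈ F, (M ω).transpose * A * M ω ∈ F
  measurable : Measurable fun q : Ω × E n => matMap (M q.1) q.2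
  lintegral_eq : ∀ (f : E n → ENNReal) (y y' : E n), ‖y‖ = ‖y'‖ →
    ∫⁻ ω, f (matMap (M ω) y) ∂μ = ∫⁻ ω, f (matMap (M ω) y') ∂μ

/-- Normalized Haar measure on the closure of G. The closure is compact, and still preserves F
because F is closed. -/
theorem IsSTConeSubequation.exists_isRandomRotation (hF : IsSTConeSubequation F) :
    ∃ (Ω : Type) (_ : MeasurableSpace Ω) (μ : Measure Ω) (M : Ω → Matrix (Fin n) (Fin n) ℝ),
      IsRandomRotation F μ M := by
  obtain ⟨G, hG, hinv⟩ := hF.invariant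
  set H := G.topologicalClosure with hH
  have hHF : ∀ g ∈ H, ∀ A ∈ F, (g : Matrix (Fin n) (Fin n) ℝ) * A *
      (g : Matrix (Fin n) (Fin n) ℝ).transpose ∈ F := by
    intro g hg A hA
    have hc : Continuous fun g : Matrix.orthogonalGroup (Fin n) ℝ =>
        (g : Matrix (Fin n) (Fin n) ℝ) * A * (g : Matrix (Fin n) (Fin n) ℝ).transpose := by
      have : Continuous fun g : Matrix.orthogonalGroup (Fin n) ℝ =>
        (g : Matrix (Fin n) (Fin n) ℝ) := continuous_subtype_val
      fun_prop
    have hcl : IsClosed {g : Matrix.orthogonalGroup (Fin n) ℝ |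
        (g : Matrix (Fin n) (Fin n) ℝ) * A * (g : Matrix (Fin n) (Fin n) ℝ).transpose ∈ F} :=
      hF.isClosed.preimage hc
    exact closure_minimal (fun g hg => hinv g hg A hA) hcl hg
  have hHc : IsClosed (H : Set (Matrix.orthogonalGroup (Fin n) ℝ)) :=
    G.isClosed_topologicalClosure
  have : CompactSpace H := isCompact_iff_compactSpace.1 hHc.isCompact
  let mH : MeasurableSpace H := borel H
  have : BorelSpace H := ⟨rfl⟩
  obtain ⟨μ, hμ, hμinv⟩ := exists_invariant_probability H
  have horth : ∀ g : H, ((g⁻¹ : H) : Matrix (Fin n) (Fin n) ℝ) *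
      ((g⁻¹ : H) : Matrix (Fin n) (Fin n) ℝ).transpose = 1 := fun g =>
    isOrthogonal_of_mem (g⁻¹ : H).1.2
  -- With inverses, left translation of the group element becomes multiplication next to the vector:
  -- (h⁻¹ω)⁻¹ y = ω⁻¹ h y. Left invariance therefore makes the average depend only on |y|.
  refine ⟨H, mH, μ, fun g => ((g⁻¹ : H) : Matrix (Fin n) (Fin n) ℝ),
    ⟨hμ, horth, fun g A hA => ?_, ?_, fun f y y' hyy' => ?_⟩⟩
  · have h1 := hHF g.1 g.2 A hA
    have h2 : ((g⁻¹ : H) : Matrix (Fin n) (Fin n) ℝ) =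
        ((g : H) : Matrix (Fin n) (Fin n) ℝ).transpose := by
      simp [Matrix.star_eq_conjTranspose]
    rw [h2, Matrix.transpose_transpose]
    exact h1
  · have h1 : Continuous fun g : H => ((g⁻¹ : H) : Matrix (Fin n) (Fin n) ℝ) :=
      continuous_subtype_val.comp (continuous_subtype_val.comp continuous_inv)
    have h2 : Continuous fun q : H × E n =>
        (((q.1⁻¹ : H) : Matrix (Fin n) (Fin n) ℝ), q.2) :=
      (h1.comp continuous_fst).prodMk continuous_snd
    exact (Continuous.comp' (g := fun q : Matrix (Fin n) (Fin n) ℝ × E n => matMap q.1 q.2)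
      continuous_matMap_apply h2).measurable
  · obtain ⟨h, hh⟩ : ∃ h : H, matMap (h : Matrix (Fin n) (Fin n) ℝ) y = y' := by
      rcases eq_or_ne ‖y‖ 0 with h0 | h0
      · rw [norm_eq_zero.1 h0, norm_eq_zero.1 (hyy' ▸ h0 : ‖y'‖ = 0)]
        exact ⟨1, by simp⟩
      · have hunit : ∀ z : E n, ‖z‖ = ‖y‖ → ‖‖y‖⁻¹ • z‖ = 1 := fun z hz => by
          rw [norm_smul, norm_inv, norm_norm, hz, inv_mul_cancel₀ h0]
        obtain ⟨g, hg, hge⟩ := hG _ _ (hunit y rfl) (hunit y' hyy'.symm)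
        refine ⟨⟨g, G.le_topologicalClosure hg⟩, ?_⟩
        have h1 : matMap (g : Matrix (Fin n) (Fin n) ℝ) (‖y‖⁻¹ • y) = ‖y‖⁻¹ • y' :=
          WithLp.ofLp_injective 2 (by rw [Matrix.ofLp_toEuclideanCLM]; exact hge)
        rw [map_smul] at h1
        exact smul_right_injective _ (inv_ne_zero h0) h1
    rw [← hh, ← hμinv (fun ω : H => f (matMap ((ω⁻¹ : H) : Matrix (Fin n) (Fin n) ℝ) y)) h⁻¹]
    refine lintegral_congr fun ω => ?_
    rw [← matMap_mul_apply, mul_inv_rev, inv_inv]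
    rfl

/-- A measure on Euclidean space invariant under all rotations. -/
def IsRotationInvariant (m : Measure (E n)) : Prop :=
  ∀ g : Matrix (Fin n) (Fin n) ℝ, g * g.transpose = 1 → m.map (matMap g) = m

namespace IsRandomRotation

variable {Ω : Type} [MeasurableSpace Ω] {μ : Measure Ω} {M : Ω → Matrix (Fin n) (Fin n) ℝ}

theorem lintegral_average (h : IsRandomRotation F μ M) {m : Measure (E n)} [SFinite m]
    (hm : IsRotationInvariant m) {f : E n → ENNReal} (hf : Measurable f) :
    ∫⁻ z, f z ∂m = ∫⁻ z, ∫⁻ ω, f (matMap (M ω) z) ∂μ ∂m := by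
  have := h.isProb
  have h1 : ∀ ω, ∫⁻ z, f (matMap (M ω) z) ∂m = ∫⁻ z, f z ∂m := fun ω => by
    rw [← lintegral_map hf (matMap (M ω)).continuous.measurable, hm _ (h.orth ω)]
  rw [lintegral_lintegral_swap]
  · simp [h1]
  · exact (hf.comp (h.measurable.comp measurable_swap)).aemeasurable

theorem lintegral_eq_sphere (h : IsRandomRotation F μ M) {m : Measure (E n)}
    [IsProbabilityMeasure m] (hm : IsRotationInvariant m) (hs : ∀ᵐ z ∂m, ‖z‖ = 1)
    {f : E n → ENNReal} (hf : Measurable f) (z : E n) :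
    ∫⁻ ω, f (matMap (M ω) z) ∂μ = ∫⁻ σ, f (‖z‖ • σ) ∂m := by
  have hf' : Measurable fun σ : E n => f (‖z‖ • σ) := hf.comp (measurable_const_smul _)
  rw [h.lintegral_average hm hf']
  have h1 : ∀ᵐ σ ∂m, ∫⁻ ω, f (‖z‖ • matMap (M ω) σ) ∂μ = ∫⁻ ω, f (matMap (M ω) z) ∂μ := by
    filter_upwards [hs] with σ hσ
    rw [h.lintegral_eq f z (‖z‖ • σ) (by rw [norm_smul, norm_norm, hσ, mul_one])]
    simp
  rw [lintegral_congr_ae h1]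
  simp

/-- Averaging over rotations and radii reproduces the average over the invariant measure. -/
theorem lintegral_prod_eq (h : IsRandomRotation F μ M) {m : Measure (E n)}
    [IsProbabilityMeasure m] (hm : IsRotationInvariant m) (hs : ∀ᵐ z ∂m, ‖z‖ ≤ 1)
    {f : E n → ENNReal} (hf : Measurable f) (y : E n) :
    ∫⁻ q : Ω × E n, f (min ‖q.2‖ 1 • matMap (M q.1) y) ∂(μ.prod m) =
      ∫⁻ z, f (‖y‖ • z) ∂m := by
  have := h.isProb
  have hf' : Measurable fun σ : E n => f (‖y‖ • σ) := hf.comp (measurable_const_smul _)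
  have hmeas : Measurable fun q : Ω × E n => f (min ‖q.2‖ 1 • matMap (M q.1) y) := by
    refine hf.comp (Measurable.fun_smul ?_ ?_)
    · exact (measurable_snd.norm).min measurable_const
    · exact Measurable.fun_comp (g := fun q : Ω × E n => matMap (M q.1) q.2)
        (f := fun q : Ω × E n => (q.1, y)) h.measurable (measurable_fst.prodMk measurable_const)
  rw [lintegral_prod_symm _ hmeas.aemeasurable, h.lintegral_average hm hf']
  refine lintegral_congr_ae ?_
  filter_upwards [hs] with z hz
  -- Both vectors have norm |y||z|, so their rotation averages agree; this exchanges the roles of y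
  -- and z.
  have e1 := h.lintegral_eq f (‖z‖ • y) (‖y‖ • z)
    (by rw [norm_smul, norm_smul, norm_norm, norm_norm, mul_comm])
  simpa [min_eq_left hz] using e1

end IsRandomRotation

end RotationAverage

/-! ### Rotation invariance of ball and sphere measures. -/

section InvariantMeasures

variable {n : ℕ}

/-- The isometry of Euclidean space defined by an orthogonal matrix. -/
noncomputable def orthIsometry {g : Matrix (Fin n) (Fin n) ℝ} (hg : g * g.transpose = 1) :
    E n ≃ₗᵢ[ℝ] E n where
  toLinearEquiv := LinearEquiv.ofLinearMap (matMap g).toLinearMap (matMap g.transpose).toLinearMap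
    (by ext1 y; simpa [hg] using (matMap_mul_apply g g.transpose y).symm)
    (by ext1 y; simpa [mul_eq_one_comm.1 hg] using (matMap_mul_apply g.transpose g y).symm)
  norm_map' y := norm_matMap (mul_eq_one_comm.1 hg) y

theorem isRotationInvariant_volume : IsRotationInvariant (volume : Measure (E n)) := fun _ hg =>
  (orthIsometry hg).measurePreserving.map_eq

theorem IsRotationInvariant.smul {m : Measure (E n)} (hm : IsRotationInvariant m) (c : ENNReal) :
    IsRotationInvariant (c • m) := fun g hg => by
  rw [Measure.map_smul, hm g hg]

theorem IsRotationInvariant.restrict {m : Measure (E n)} (hm : IsRotationInvariant m)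
    {s : Set ℝ} (hs : MeasurableSet s) : IsRotationInvariant (m.restrict {z | ‖z‖ ∈ s}) := by
  intro g hg
  have hms : MeasurableSet {z : E n | ‖z‖ ∈ s} := measurable_norm hs
  have h1 : {z : E n | ‖z‖ ∈ s} = matMap g ⁻¹' {z : E n | ‖z‖ ∈ s} := by
    ext z; simp [norm_matMap (mul_eq_one_comm.1 hg)]
  conv_lhs => rw [h1]
  rw [← Measure.restrict_map (matMap g).continuous.measurable hms, hm g hg]

theorem closedBall_eq_norm_preimage (r : ℝ) :
    Metric.closedBall (0 : E n) r = {z : E n | ‖z‖ ∈ Set.Iic r} := by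
  ext z; simp

theorem volume_closedBall_ne_zero {r : ℝ} (hr : 0 < r) :
    (volume (Metric.closedBall (0 : E n) r)) ≠ 0 :=
  (Metric.measure_closedBall_pos volume _ hr).ne'

theorem volume_closedBall_ne_top (r : ℝ) : (volume (Metric.closedBall (0 : E n) r)) ≠ ⊤ :=
  measure_closedBall_lt_top.ne

instance isProbabilityMeasure_ballMeasure : IsProbabilityMeasure (ballMeasure n) := by
  refine ⟨?_⟩
  rw [ballMeasure, Measure.smul_apply, Measure.restrict_apply_univ, smul_eq_mul,
    ENNReal.inv_mul_cancel (volume_closedBall_ne_zero one_pos) (volume_closedBall_ne_top 1)]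

theorem isRotationInvariant_ballMeasure : IsRotationInvariant (ballMeasure n) := by
  refine IsRotationInvariant.smul ?_ _
  rw [closedBall_eq_norm_preimage]
  exact isRotationInvariant_volume.restrict measurableSet_Iic

theorem ae_norm_le_ballMeasure : ∀ᵐ z ∂(ballMeasure n), ‖z‖ ≤ 1 := by
  refine Measure.ae_smul_measure ?_ _
  filter_upwards [ae_restrict_mem Metric.isClosed_closedBall.measurableSet] with z hz
  exact mem_closedBall_zero_iff.1 hz

theorem isProbabilityMeasure_sphereMeasure (hn : 1 ≤ n) :
    IsProbabilityMeasure (sphereMeasure n) := by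
  have : Nonempty (Fin n) := ⟨⟨0, hn⟩⟩
  have h0 : NeZero (volume : Measure (E n)).toSphere := ⟨Measure.toSphere_ne_zero _⟩
  unfold sphereMeasure
  infer_instance

/-- The normalized surface measure of the unit sphere as a measure on Euclidean space. -/
noncomputable def sphereMeasureE (n : ℕ) : Measure (E n) := (sphereMeasure n).map Subtype.val

theorem isProbabilityMeasure_sphereMeasureE (hn : 1 ≤ n) :
    IsProbabilityMeasure (sphereMeasureE n) := by
  have := isProbabilityMeasure_sphereMeasure hn
  exact Measure.isProbabilityMeasure_map measurable_subtype_coe.aemeasurable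

theorem ae_norm_eq_sphereMeasureE : ∀ᵐ z ∂(sphereMeasureE n), ‖z‖ = 1 := by
  rw [sphereMeasureE, ae_map_iff measurable_subtype_coe.aemeasurable
    (measurableSet_eq_fun measurable_norm measurable_const)]
  exact Eventually.of_forall fun σ => mem_sphere_zero_iff_norm.1 σ.2

-- Surface measure of a set is proportional to the volume of the cone over it. Cones commute with
-- orthogonal maps, and volume is preserved.
open scoped Pointwise in
theorem isRotationInvariant_sphereMeasureE : IsRotationInvariant (sphereMeasureE n) := by
  intro g hg
  have hgm : Measurable (matMap g) := (matMap g).continuous.measurable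
  rw [sphereMeasureE, sphereMeasure, Measure.map_smul, Measure.map_smul]
  congr 1
  ext s hs
  rw [Measure.map_apply hgm hs, Measure.map_apply measurable_subtype_coe (hgm hs),
    Measure.map_apply measurable_subtype_coe hs,
    Measure.toSphere_apply' _ (measurable_subtype_coe (hgm hs)),
    Measure.toSphere_apply' _ (measurable_subtype_coe hs)]
  congr 1
  set T := Set.Ioo (0 : ℝ) 1 • ((↑) '' ((Subtype.val : Metric.sphere (0 : E n) 1 → E n) ⁻¹' s) :
    Set (E n)) with hT
  have hpre : Set.Ioo (0 : ℝ) 1 •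
      ((↑) '' ((Subtype.val : Metric.sphere (0 : E n) 1 → E n) ⁻¹' (matMap g ⁻¹' s)) :
        Set (E n)) = (orthIsometry hg) ⁻¹' T := by
    have hg' : g.transpose * g = 1 := mul_eq_one_comm.1 hg
    have hval : ∀ y, orthIsometry hg y = matMap g y := fun y => rfl
    ext y
    simp only [hT, Set.mem_smul, Set.mem_image, Set.mem_preimage, Subtype.exists, hval]
    constructor
    · rintro ⟨a, ha, _, ⟨σ, hσ, hσs, rfl⟩, rfl⟩
      refine ⟨a, ha, matMap g σ, ⟨matMap g σ, ?_, hσs, rfl⟩, by simp⟩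
      simpa [norm_matMap hg'] using hσ
    · rintro ⟨a, ha, _, ⟨σ, hσ, hσs, rfl⟩, hy⟩
      have hτ : matMap g (matMap g.transpose σ) = σ := by
        rw [← matMap_mul_apply, hg]; simp
      refine ⟨a, ha, matMap g.transpose σ, ⟨matMap g.transpose σ, ?_, by rwa [hτ], rfl⟩, ?_⟩
      · simpa [norm_matMap (g := g.transpose) (by simpa using hg)] using hσ
      · apply (orthIsometry hg).injective
        rw [hval, hval, map_smul, hτ, hy]
  rw [hpre]
  -- For a measurable equivalence the cone T need not be shown measurable.
  exact MeasurePreserving.measure_preimage_equiv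
    (f := (orthIsometry hg).toHomeomorph.toMeasurableEquiv) (orthIsometry hg).measurePreserving T

end InvariantMeasures

/-! ### Extended integrals in terms of the defect. -/

section ExtIntegral

theorem extIntegral_eq_sub {α : Type*} [MeasurableSpace α] {μ : Measure α}
    [IsProbabilityMeasure μ] {f : α → EReal} (hf : Measurable f) {C : ℝ} (hC : 0 ≤ C)
    (hfC : ∀ a, f a ≤ C) :
    extIntegral μ f = (C : EReal) - ((∫⁻ a, gap C (f a) ∂μ : ENNReal) : EReal) := by
  have hg : Measurable fun a => gap C (f a) := (measurable_gap C).comp hf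
  have hpos : Measurable fun a => (f a).toENNReal := measurable_ereal_toENNReal.comp hf
  -- The identity (C - f) + f⁺ = C + f⁻ involves nonnegative terms only, so it can be integrated
  -- even when f⁻ has infinite integral.
  have hpt : ∀ a, gap C (f a) + (f a).toENNReal = ENNReal.ofReal C + (-f a).toENNReal := by
    intro a
    have ha := hfC a
    generalize f a = b at ha ⊢
    induction b with
    | bot => simp
    | top => simp at ha
    | coe b =>
      have hb : b ≤ C := by exact_mod_cast ha
      rw [gap_coe, ← EReal.coe_neg, EReal.real_coe_toENNReal, EReal.real_coe_toENNReal]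
      rcases le_total 0 b with h0 | h0
      · rw [ENNReal.ofReal_of_nonpos (by linarith : -b ≤ 0), add_zero,
          ← ENNReal.ofReal_add (by linarith) h0]
        congr 1; ring
      · rw [ENNReal.ofReal_of_nonpos h0, add_zero, ← ENNReal.ofReal_add hC (by linarith)]
        congr 1
  have hint : ∫⁻ a, gap C (f a) ∂μ + ∫⁻ a, (f a).toENNReal ∂μ =
      ENNReal.ofReal C + ∫⁻ a, (-f a).toENNReal ∂μ := by
    rw [← lintegral_add_left hg, lintegral_congr hpt, lintegral_add_left measurable_const]
    simp
  have hfin : ∫⁻ a, (f a).toENNReal ∂μ ≠ ⊤ := by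
    refine ne_top_of_le_ne_top (ENNReal.ofReal_ne_top (r := C)) ?_
    calc ∫⁻ a, (f a).toENNReal ∂μ ≤ ∫⁻ _, ENNReal.ofReal C ∂μ := lintegral_mono fun a => by
          have := EReal.toENNReal_le_toENNReal (hfC a)
          rwa [EReal.real_coe_toENNReal] at this
      _ = ENNReal.ofReal C := by simp
  rw [extIntegral]
  generalize ∫⁻ a, gap C (f a) ∂μ = G at *
  generalize ∫⁻ a, (f a).toENNReal ∂μ = P at *
  generalize ∫⁻ a, (-f a).toENNReal ∂μ = N at *
  lift P to NNReal using hfin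
  induction N with
  | top =>
    have hG : G = ⊤ := by
      have h1 : G + P = ⊤ := by rw [hint]; simp
      rcases ENNReal.add_eq_top.1 h1 with h | h
      · exact h
      · exact absurd h ENNReal.coe_ne_top
    rw [hG, EReal.coe_ennreal_top, EReal.sub_top, EReal.sub_top]
  | coe N =>
    have hGt : G ≠ ⊤ := by
      intro h
      rw [h, top_add] at hint
      exact ENNReal.add_ne_top.2 ⟨ENNReal.ofReal_ne_top, ENNReal.coe_ne_top⟩ hint.symm
    lift G to NNReal using hGt
    have h1 := congrArg ENNReal.toReal hint
    rw [ENNReal.toReal_add ENNReal.coe_ne_top ENNReal.coe_ne_top,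
      ENNReal.toReal_add ENNReal.ofReal_ne_top ENNReal.coe_ne_top, ENNReal.toReal_ofReal hC] at h1
    simp only [ENNReal.coe_toReal] at h1
    have hc : ∀ w : NNReal, ((w : ENNReal) : EReal) = ((w : ℝ) : EReal) := fun _ => rfl
    rw [hc, hc, hc, ← EReal.coe_sub, ← EReal.coe_sub]
    congr 1
    linarith

theorem extIntegral_congr_ae {α : Type*} [MeasurableSpace α] {μ : Measure α} {f g : α → EReal}
    (h : f =ᵐ[μ] g) : extIntegral μ f = extIntegral μ g := by
  have h1 : ∫⁻ a, (f a).toENNReal ∂μ = ∫⁻ a, (g a).toENNReal ∂μ :=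
    lintegral_congr_ae (h.mono fun a ha => by simp only [ha])
  have h2 : ∫⁻ a, (-f a).toENNReal ∂μ = ∫⁻ a, (-g a).toENNReal ∂μ :=
    lintegral_congr_ae (h.mono fun a ha => by simp only [ha])
  rw [extIntegral, extIntegral, h1, h2]

end ExtIntegral

/-! ### Radial averages as subharmonic functions. -/

section RadialAverage

variable {n : ℕ} {F : Set (Matrix (Fin n) (Fin n) ℝ)} {X K : Set (E n)} {u : E n → EReal}
  {C p R : ℝ} {x : E n} {m : Measure (E n)}

open Classical in
/-- The function `u` on `K`, extended by `-∞`. -/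
noncomputable def cutoff (K : Set (E n)) (u : E n → EReal) (y : E n) : EReal :=
  if y ∈ K then u y else ⊥

theorem cutoff_of_mem {y : E n} (h : y ∈ K) : cutoff K u y = u y := if_pos h

theorem cutoff_le (hC : ∀ y ∈ K, u y ≤ C) (y : E n) : cutoff K u y ≤ C := by
  unfold cutoff
  split_ifs with h
  · exact hC y h
  · exact bot_le

theorem upperSemicontinuous_cutoff (hK : IsClosed K) (hu : UpperSemicontinuousOn u K) :
    UpperSemicontinuous (cutoff K u) := by
  intro y c hc
  by_cases hy : y ∈ K
  · rw [cutoff_of_mem hy] at hc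
    have := mem_nhdsWithin_iff_eventually.1 (hu y hy c hc)
    filter_upwards [this] with z hz
    by_cases hzK : z ∈ K
    · rw [cutoff_of_mem hzK]; exact hz hzK
    · rw [cutoff, if_neg hzK]; exact bot_le.trans_lt hc
  · have hc' : ⊥ < c := by rwa [cutoff, if_neg hy] at hc
    filter_upwards [hK.isOpen_compl.mem_nhds hy] with z hz
    rw [cutoff, if_neg hz]
    exact hc'

/-- The defect of `u` on `K`. -/
noncomputable def defect (C : ℝ) (K : Set (E n)) (u : E n → EReal) (y : E n) : ENNReal :=
  gap C (cutoff K u y)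

theorem defect_of_mem {y : E n} (h : y ∈ K) : defect C K u y = gap C (u y) := by
  rw [defect, cutoff_of_mem h]

theorem IsSubharmonicOn.measurable_cutoff (hu : IsSubharmonicOn F X u) (hK : IsClosed K)
    (hKX : K ⊆ X) : Measurable (cutoff K u) :=
  (upperSemicontinuous_cutoff hK (hu.usc.mono hKX)).measurable

theorem IsSubharmonicOn.measurable_defect (hu : IsSubharmonicOn F X u) (hK : IsClosed K)
    (hKX : K ⊆ X) (C : ℝ) : Measurable (defect C K u) :=
  (measurable_gap C).comp (hu.measurable_cutoff hK hKX)

/-- The average of `u(x + r z)` over a probability measure, expressed through the defect. -/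
noncomputable def radialAvg (C : ℝ) (K : Set (E n)) (u : E n → EReal) (m : Measure (E n))
    (x : E n) (r : ℝ) : EReal :=
  (C : EReal) - ((∫⁻ z, defect C K u (x + r • z) ∂m : ENNReal) : EReal)

theorem add_smul_mem_closedBall {r : ℝ} (hr : 0 ≤ r) (hrR : r ≤ R) {z : E n} (hz : ‖z‖ ≤ 1) :
    x + r • z ∈ Metric.closedBall x R := by
  rw [Metric.mem_closedBall, dist_eq_norm, add_sub_cancel_left, norm_smul, Real.norm_eq_abs,
    abs_of_nonneg hr]
  nlinarith

/-- The spherically symmetric average of `u` about `x` is `F`-subharmonic. -/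
theorem IsSubharmonicOn.radialAvg (hF : IsSTConeSubequation F) (hconv : Convex ℝ F)
    (hu : IsSubharmonicOn F X u) (hK : IsClosed K) (hKX : K ⊆ X) (hC : ∀ y ∈ K, u y ≤ C)
    (hx : Metric.closedBall x R ⊆ K) [IsProbabilityMeasure m] (hm : IsRotationInvariant m)
    (hs : ∀ᵐ z ∂m, ‖z‖ ≤ 1) :
    IsSubharmonicOn F (Metric.ball 0 R) fun y => radialAvg C K u m x ‖y‖ := by
  obtain ⟨Ω, mΩ, μ, M, h⟩ := hF.exists_isRandomRotation
  have := h.isProb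
  have hmem : ∀ ω, ∀ a : ℝ, 0 ≤ a → a ≤ 1 → ∀ y ∈ Metric.ball (0 : E n) R,
      x + a • matMap (M ω) y ∈ K := by
    intro ω a ha ha1 y hy
    refine hx ?_
    rw [mem_ball_zero_iff] at hy
    rw [Metric.mem_closedBall, dist_eq_norm, add_sub_cancel_left, norm_smul,
      norm_matMap (mul_eq_one_comm.1 (h.orth ω)), Real.norm_eq_abs, abs_of_nonneg ha]
    nlinarith [norm_nonneg y]
  -- Truncating the radius at 1 keeps the arguments in K for every z, as the averaging theorem
  -- requires subharmonicity for each parameter; m-almost everywhere the truncation has no effect.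
  have hmin : ∀ z : E n, 0 ≤ min ‖z‖ 1 := fun z => le_min (norm_nonneg z) zero_le_one
  have hsub : ∀ q : Ω × E n, IsSubharmonicOn F (Metric.ball 0 R) fun y =>
      cutoff K u (x + min ‖q.2‖ 1 • matMap (M q.1) y) := by
    intro q
    have heq : ∀ y ∈ Metric.ball (0 : E n) R,
        cutoff K u (x + min ‖q.2‖ 1 • matMap (M q.1) y) =
          u (x + min ‖q.2‖ 1 • matMap (M q.1) y) := fun y hy =>
      cutoff_of_mem (hmem q.1 _ (hmin _) (min_le_right _ _) y hy)
    have hbase : IsSubharmonicOn F (Metric.ball 0 R) fun y =>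
        u (x + min ‖q.2‖ 1 • matMap (M q.1) y) := by
      -- At radius 0 the similarity degenerates and the function is the constant u(x).
      rcases (hmin q.2).eq_or_lt with h0 | h0
      · rw [← h0]
        simp only [zero_smul, add_zero]
        by_cases hxX : x ∈ X
        · exact isSubharmonicOn_const hF (hu.ne_top x hxX)
        · have hempty : Metric.ball (0 : E n) R = ∅ := by
            rw [Metric.ball_eq_empty]
            by_contra! hR
            exact hxX (hKX (hx (Metric.mem_closedBall_self hR.le)))
          rw [hempty]
          exact ⟨fun y hy => absurd hy (Set.notMem_empty y), by simp, by simp⟩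
      · have h1 := hu.comp_affine hF (h.orth q.1) (h.mem q.1) h0 x
        have hss : Metric.ball (0 : E n) R ⊆ {y | x + min ‖q.2‖ 1 • matMap (M q.1) y ∈ X} :=
          fun y hy => hKX (hmem q.1 _ (hmin _) (min_le_right _ _) y hy)
        exact ⟨h1.usc.mono hss, fun y hy => h1.ne_top y (hss hy),
          fun y hy => h1.viscosity y (hss hy)⟩
    refine ⟨fun y hy => ?_, fun y hy => ?_, fun y hy φ hφ h1 h2 => ?_⟩
    · intro c hc
      rw [heq y hy] at hc
      filter_upwards [hbase.usc y hy c hc, self_mem_nhdsWithin] with z hz hzm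
      rwa [heq z hzm]
    · rw [heq y hy]; exact hbase.ne_top y hy
    · refine hbase.viscosity y hy φ hφ (by rw [← heq y hy]; exact h1) ?_
      filter_upwards [h2, Metric.isOpen_ball.mem_nhds hy] with z hz hzm
      rwa [← heq z hzm]
  have hmeas : Measurable fun q : (Ω × E n) × E n =>
      cutoff K u (x + min ‖q.1.2‖ 1 • matMap (M q.1.1) q.2) := by
    refine (hu.measurable_cutoff hK hKX).comp (measurable_const.add (Measurable.fun_smul ?_ ?_))
    · exact measurable_fst.snd.norm.min measurable_const
    · exact Measurable.fun_comp (g := fun q : Ω × E n => matMap (M q.1) q.2)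
        (f := fun q : (Ω × E n) × E n => (q.1.1, q.2)) h.measurable
        (measurable_fst.fst.prodMk measurable_snd)
  have hav := isSubharmonicOn_average hF hconv Metric.isOpen_ball (μ.prod m) hsub
    (C := C) (fun q y _ => cutoff_le hC _) hmeas
  convert hav using 3 with y
  rw [RieszDensity.radialAvg]
  congr 2
  exact (h.lintegral_prod_eq hm hs (f := fun z => defect C K u (x + z))
    ((hu.measurable_defect hK hKX C).comp (measurable_const_add x)) y).symm

theorem sphereMax_radial (hn : 1 ≤ n) {ψ : ℝ → EReal} {r : ℝ} (hr : 0 < r) :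
    sphereMax (fun y : E n => ψ ‖y‖) 0 r = ψ r := by
  refine le_antisymm (sphereMax_le hr.le fun y hy => ?_) ?_
  · rw [sub_zero] at hy; simp [hy]
  · have hy : ‖(EuclideanSpace.single (⟨0, hn⟩ : Fin n) r : E n)‖ = r := by
      simp [abs_of_pos hr]
    have := le_sphereMax (x := 0) (fun y : E n => ψ ‖y‖) hr
      (y := EuclideanSpace.single ⟨0, hn⟩ r) (by rw [sub_zero, hy])
    simpa only [hy] using this

/-- The maximum principle for the radial average: its value at the centre is u(x), and its maximum
over a sphere is the average itself. -/
theorem IsSubharmonicOn.le_radialAvg (hF : IsSTConeSubequation F) (hconv : Convex ℝ F)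
    (hp : rieszChar F = (p : EReal)) (hn : 1 ≤ n)
    (hu : IsSubharmonicOn F X u) (hK : IsClosed K) (hKX : K ⊆ X) (hC : ∀ y ∈ K, u y ≤ C)
    (hx : Metric.closedBall x R ⊆ K) [IsProbabilityMeasure m] (hm : IsRotationInvariant m)
    (hs : ∀ᵐ z ∂m, ‖z‖ ≤ 1) {r : ℝ} (hr : 0 < r) (hrR : r < R) :
    u x ≤ RieszDensity.radialAvg C K u m x r := by
  have hv := hu.radialAvg hF hconv hK hKX hC hx hm hs
  have h1 := hv.le_sphereMax_of_norm_le hF hp hn (x := 0) (r := r)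
    (Metric.closedBall_subset_ball hrR) hr (y := 0) (by simpa using hr.le)
  rw [sphereMax_radial hn hr] at h1
  refine le_trans (le_of_eq ?_) h1
  have hxK : x ∈ K := hx (Metric.mem_closedBall_self (hr.trans hrR).le)
  simp [RieszDensity.radialAvg, defect_of_mem hxK, coe_sub_gap (hC x hxK)]

/-- A radial function coincides with its spherical maximum about 0, so the results on maxima apply.
Subharmonicity is known on the open ball only, hence the detour through radii R' < R, taken larger
than the radius r₀ of a finite value. -/
theorem IsSubharmonicOn.radialAvg_spec (hF : IsSTConeSubequation F) (hconv : Convex ℝ F)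
    (hp : rieszChar F = (p : EReal)) (hn : 1 ≤ n)
    (hu : IsSubharmonicOn F X u) (hK : IsClosed K) (hKX : K ⊆ X) (hC : ∀ y ∈ K, u y ≤ C)
    (hx : Metric.closedBall x R ⊆ K) [IsProbabilityMeasure m] (hm : IsRotationInvariant m)
    (hs : ∀ᵐ z ∂m, ‖z‖ ≤ 1)
    (hne : ∃ r, 0 ≤ r ∧ r < R ∧ RieszDensity.radialAvg C K u m x r ≠ ⊥) :
    (∀ r, 0 < r → r < R → RieszDensity.radialAvg C K u m x r ≠ ⊥) ∧
      IsKernelConvex p R fun r => (RieszDensity.radialAvg C K u m x r).toReal := by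
  have hv := hu.radialAvg hF hconv hK hKX hC hx hm hs
  obtain ⟨r₀, hr₀, hr₀R, hr₀b⟩ := hne
  have hne' : ∀ R', r₀ < R' → ∃ y : E n, ‖y - 0‖ < R' ∧
      RieszDensity.radialAvg C K u m x ‖y‖ ≠ ⊥ := by
    intro R' hR'
    have hy : ‖(EuclideanSpace.single (⟨0, hn⟩ : Fin n) r₀ : E n)‖ = r₀ := by
      simp [abs_of_nonneg hr₀]
    exact ⟨EuclideanSpace.single ⟨0, hn⟩ r₀, by rwa [sub_zero, hy], by rwa [hy]⟩
  have hkc : ∀ R', r₀ < R' → R' < R →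
      IsKernelConvex p R' fun r => (RieszDensity.radialAvg C K u m x r).toReal := by
    intro R' h1 h2
    have h3 := hv.isKernelConvex_sphereMax hF hp hn (x := 0) (R := R')
      (Metric.closedBall_subset_ball h2) (hne' R' h1)
    refine ⟨fun s t hs hst ht => ?_, fun r₁ r r₂ hr₁ h4 h5 h6 => ?_⟩
    · have := h3.mono s t hs hst ht
      rwa [sphereMax_radial hn hs, sphereMax_radial hn (hs.trans_le hst)] at this
    · have := h3.conv r₁ r r₂ hr₁ h4 h5 h6
      rwa [sphereMax_radial hn hr₁, sphereMax_radial hn (hr₁.trans h4),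
        sphereMax_radial hn ((hr₁.trans h4).trans h5)] at this
  refine ⟨fun r hr hrR => ?_, fun s t hs hst ht => ?_, fun r₁ r r₂ hr₁ h4 h5 h6 => ?_⟩
  · obtain ⟨R', h1, h2⟩ := exists_between (max_lt hr₀R hrR)
    have h3 := hv.sphereMax_ne_bot hF hp hn (x := 0) (R := R')
      (Metric.closedBall_subset_ball h2) (hne' R' ((le_max_left _ _).trans_lt h1)) hr
      ((le_max_right _ _).trans_lt h1)
    rwa [sphereMax_radial hn hr] at h3
  · obtain ⟨R', h1, h2⟩ := exists_between (max_lt hr₀R ht)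
    exact (hkc R' ((le_max_left _ _).trans_lt h1) h2).mono s t hs hst
      ((le_max_right _ _).trans_lt h1)
  · obtain ⟨R', h1, h2⟩ := exists_between (max_lt hr₀R h6)
    exact (hkc R' ((le_max_left _ _).trans_lt h1) h2).conv r₁ r r₂ hr₁ h4 h5
      ((le_max_right _ _).trans_lt h1)

theorem ballAvg_eq_radialAvg (hu : IsSubharmonicOn F X u) (hK : IsClosed K) (hKX : K ⊆ X)
    (hC0 : 0 ≤ C) (hC : ∀ y ∈ K, u y ≤ C) (hx : Metric.closedBall x R ⊆ K) {r : ℝ} (hr : 0 ≤ r)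
    (hrR : r ≤ R) : ballAvg u x r = radialAvg C K u (ballMeasure n) x r := by
  have h1 : (fun z => u (x + r • z)) =ᵐ[ballMeasure n] fun z => cutoff K u (x + r • z) := by
    filter_upwards [ae_norm_le_ballMeasure] with z hz
    exact (cutoff_of_mem (hx (add_smul_mem_closedBall hr hrR hz))).symm
  rw [ballAvg, extIntegral_congr_ae h1, extIntegral_eq_sub _ hC0 fun z => cutoff_le hC _]
  · rfl
  · exact (hu.measurable_cutoff hK hKX).comp
      (measurable_const.add (measurable_const_smul r))

theorem sphereAvg_eq_radialAvg (hn : 1 ≤ n) (hu : IsSubharmonicOn F X u) (hK : IsClosed K)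
    (hKX : K ⊆ X) (hC0 : 0 ≤ C) (hC : ∀ y ∈ K, u y ≤ C) (hx : Metric.closedBall x R ⊆ K)
    {r : ℝ} (hr : 0 ≤ r) (hrR : r ≤ R) :
    sphereAvg u x r = radialAvg C K u (sphereMeasureE n) x r := by
  have := isProbabilityMeasure_sphereMeasure hn
  have h1 : (fun σ : Metric.sphere (0 : E n) 1 => u (x + r • (σ : E n))) =
      fun σ : Metric.sphere (0 : E n) 1 => cutoff K u (x + r • (σ : E n)) := by
    ext σ
    exact (cutoff_of_mem (hx (add_smul_mem_closedBall hr hrR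
      (mem_sphere_zero_iff_norm.1 σ.2).le))).symm
  have hm : Measurable fun z : E n => x + r • z :=
    measurable_const.add (measurable_const_smul r)
  have hd : Measurable fun z : E n => defect C K u (x + r • z) :=
    (hu.measurable_defect hK hKX C).comp hm
  rw [sphereAvg, h1, extIntegral_eq_sub _ hC0 fun z => cutoff_le hC _, radialAvg, sphereMeasureE,
    lintegral_map hd measurable_subtype_coe]
  · rfl
  · exact (hu.measurable_cutoff hK hKX).comp (hm.comp measurable_subtype_coe)

end RadialAverage

/-! ### Shell averages, their continuity, and integration over spheres. -/

section Shell

variable {n : ℕ} {a b : ℝ} {w : E n → ENNReal} {x : E n}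

/-- The shell `{a < ‖z‖ ≤ b}`, a closed ball if `a < 0`. -/
def shell (n : ℕ) (a b : ℝ) : Set (E n) := {z | ‖z‖ ∈ Set.Ioc a b}

theorem measurableSet_shell : MeasurableSet (shell n a b) := measurable_norm measurableSet_Ioc

theorem shell_subset_closedBall : shell n a b ⊆ Metric.closedBall 0 b := fun _ hz =>
  mem_closedBall_zero_iff.2 hz.2

theorem volume_shell_ne_top : volume (shell n a b) ≠ ⊤ :=
  measure_ne_top_of_subset shell_subset_closedBall (volume_closedBall_ne_top b)

theorem volume_shell_ne_zero (hn : 1 ≤ n) (hab : a < b) (hb : 0 < b) :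
    volume (shell n a b) ≠ 0 := by
  obtain ⟨s, hs1, hs2⟩ := exists_between (max_lt hab hb)
  have ho : IsOpen {z : E n | ‖z‖ ∈ Set.Ioo a b} := isOpen_Ioo.preimage continuous_norm
  have hne : {z : E n | ‖z‖ ∈ Set.Ioo a b}.Nonempty := by
    refine ⟨EuclideanSpace.single ⟨0, hn⟩ s, ?_⟩
    have hs : 0 < s := (le_max_right _ _).trans_lt hs1
    simp only [Set.mem_ofPred_eq, PiLp.norm_single, Real.norm_eq_abs, abs_of_pos hs]
    exact ⟨(le_max_left _ _).trans_lt hs1, hs2⟩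
  have hsub : {z : E n | ‖z‖ ∈ Set.Ioo a b} ⊆ shell n a b := fun z hz => ⟨hz.1, hz.2.le⟩
  exact fun h => ho.measure_ne_zero volume hne (measure_mono_null hsub h)

/-- The average of `w (x + z)` over a shell. -/
noncomputable def shellAvg (w : E n → ENNReal) (a b : ℝ) (x : E n) : ENNReal :=
  (volume (shell n a b))⁻¹ * ∫⁻ z in shell n a b, w (x + z)

theorem lintegral_ballMeasure {r : ℝ} (hr : 0 < r) (hw : Measurable w) (x : E n) :
    ∫⁻ z, w (x + r • z) ∂(ballMeasure n) = shellAvg w (-1) r x := by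
  have hpre : (fun z : E n => r • z) ⁻¹' shell n (-1) r = Metric.closedBall 0 1 := by
    ext z
    simp only [shell, Set.mem_preimage, Set.mem_ofPred_eq, Set.mem_Ioc, norm_smul,
      Real.norm_eq_abs, abs_of_pos hr, mem_closedBall_zero_iff]
    refine ⟨fun h => by nlinarith [h.2], fun h => ⟨?_, by nlinarith⟩⟩
    linarith [mul_nonneg hr.le (norm_nonneg z)]
  set k : ENNReal := ENNReal.ofReal |(r ^ Module.finrank ℝ (E n))⁻¹| with hk
  have hk0 : k ≠ 0 := by
    rw [hk, Ne, ENNReal.ofReal_eq_zero, not_le]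
    positivity
  have hint : ∀ f : E n → ENNReal, Measurable f →
      ∫⁻ z in Metric.closedBall 0 1, f (r • z) = k * ∫⁻ z in shell n (-1) r, f z := by
    intro f hf
    have h1 := setLIntegral_map (μ := volume) (measurableSet_shell (n := n) (a := -1) (b := r)) hf
      (measurable_const_smul r)
    rw [hpre, Measure.map_addHaar_smul volume hr.ne', Measure.restrict_smul,
      lintegral_smul_measure] at h1
    exact h1.symm
  have hvol : volume (Metric.closedBall (0 : E n) 1) = k * volume (shell n (-1) r) := by
    simpa using hint (fun _ => 1) measurable_const
  rw [ballMeasure, lintegral_smul_measure, hint (fun z => w (x + z)) (hw.comp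
    (measurable_const_add x)), hvol, shellAvg, smul_eq_mul,
    ENNReal.mul_inv (Or.inl hk0) (Or.inl ENNReal.ofReal_ne_top), ← mul_assoc]
  congr 1
  rw [mul_right_comm, ENNReal.inv_mul_cancel hk0 ENNReal.ofReal_ne_top, one_mul]

theorem setLIntegral_shell_eq (w : E n → ENNReal) (x : E n) :
    ∫⁻ z in shell n a b, w (x + z) =
      ∫⁻ y, {y | ‖y - x‖ ∈ Set.Ioc a b}.indicator w y := by
  rw [← lintegral_indicator measurableSet_shell,
    ← lintegral_add_left_eq_self ({y | ‖y - x‖ ∈ Set.Ioc a b}.indicator w) x]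
  refine lintegral_congr fun z => ?_
  simp only [Set.indicator, shell, Set.mem_ofPred_eq, add_sub_cancel_left]
  congr

theorem setLIntegral_closedBall_le_shell (ha : a < 0) :
    ∫⁻ y in Metric.closedBall x b, w y ≤ ∫⁻ z in shell n a b, w (x + z) := by
  rw [setLIntegral_shell_eq, ← lintegral_indicator Metric.isClosed_closedBall.measurableSet]
  refine lintegral_mono (Set.indicator_le_indicator_of_subset (fun y hy => ?_) fun _ => zero_le)
  rw [Metric.mem_closedBall, dist_eq_norm] at hy
  exact ⟨ha.trans_le (norm_nonneg _), hy⟩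

theorem setLIntegral_shell_le_closedBall :
    ∫⁻ z in shell n a b, w (x + z) ≤ ∫⁻ y in Metric.closedBall x b, w y := by
  rw [setLIntegral_shell_eq, ← lintegral_indicator Metric.isClosed_closedBall.measurableSet]
  refine lintegral_mono (Set.indicator_le_indicator_of_subset (fun y hy => ?_) fun _ => zero_le)
  rw [Metric.mem_closedBall, dist_eq_norm]
  exact hy.2

/-- Dominated convergence: the indicator of the moving shell converges off the two boundary spheres,
which are null sets, and nearby shells stay in one ball where w is integrable. -/
theorem continuousAt_shellAvg (hn : 1 ≤ n) (hw : Measurable w) (ha : a ≠ 0) (hab : a < b)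
    (hb : 0 < b) {ρ : ℝ} (hρ : b < ρ) (hfin : ∫⁻ y in Metric.closedBall x ρ, w y ≠ ⊤) :
    ContinuousAt (shellAvg w a b) x := by
  refine ENNReal.Tendsto.const_mul ?_
    (Or.inr (ENNReal.inv_ne_top.2 (volume_shell_ne_zero hn hab hb)))
  simp only [setLIntegral_shell_eq]
  refine tendsto_lintegral_filter_of_dominated_convergence
    ((Metric.closedBall x ρ).indicator w) (Eventually.of_forall fun x' => ?_) ?_ ?_ ?_
  · exact hw.indicator
      ((measurable_norm.comp (measurable_sub_const x')) measurableSet_Ioc)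
  · filter_upwards [Metric.ball_mem_nhds x (sub_pos.2 hρ)] with x' hx'
    refine Eventually.of_forall (Set.indicator_le_indicator_of_subset (fun y hy => ?_)
      fun _ => zero_le)
    rw [Metric.mem_ball] at hx'
    have h1 : dist y x' ≤ b := by rw [dist_eq_norm]; exact hy.2
    rw [Metric.mem_closedBall]
    linarith [dist_triangle y x' x]
  · rwa [lintegral_indicator Metric.isClosed_closedBall.measurableSet]
  · have hsph : ∀ r : ℝ, r ≠ 0 → ∀ᵐ y : E n, ‖y - x‖ ≠ r := by
      intro r hr
      have := Measure.addHaar_sphere_of_ne_zero volume x hr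
      filter_upwards [compl_mem_ae_iff.2 this] with y hy hyr
      exact hy (by rwa [Metric.mem_sphere, dist_eq_norm])
    filter_upwards [hsph a ha, hsph b hb.ne'] with y hya hyb
    have hc : ContinuousAt (fun x' : E n => ‖y - x'‖) x := by fun_prop
    refine tendsto_nhds_of_eventually_eq ?_
    by_cases hy : ‖y - x‖ ∈ Set.Ioc a b
    · filter_upwards [hc.eventually (Ioo_mem_nhds hy.1 (lt_of_le_of_ne hy.2 hyb))] with x' hx'
      rw [Set.indicator_of_mem (show y ∈ {y | ‖y - x‖ ∈ Set.Ioc a b} from hy),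
        Set.indicator_of_mem (show y ∈ {y | ‖y - x'‖ ∈ Set.Ioc a b} from ⟨hx'.1, hx'.2.le⟩)]
    · have : ‖y - x‖ ∈ (Set.Icc a b)ᶜ := fun h =>
        hy ⟨lt_of_le_of_ne h.1 hya.symm, h.2⟩
      filter_upwards [hc.eventually (isClosed_Icc.isOpen_compl.mem_nhds this)] with x' hx'
      rw [Set.indicator_of_notMem (show y ∉ {y | ‖y - x‖ ∈ Set.Ioc a b} from hy),
        Set.indicator_of_notMem (show y ∉ {y | ‖y - x'‖ ∈ Set.Ioc a b} from
          fun h => hx' ⟨h.1.le, h.2⟩)]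

/-- Replaces polar coordinates: the rotation average of w depends only on |z| and equals the mean
over the sphere of that radius. -/
theorem setLIntegral_shell_eq_sphere {F : Set (Matrix (Fin n) (Fin n) ℝ)}
    (hF : IsSTConeSubequation F) (hn : 1 ≤ n) (hw : Measurable w) (x : E n) :
    ∫⁻ z in shell n a b, w (x + z) =
      ∫⁻ z in shell n a b, ∫⁻ σ, w (x + ‖z‖ • σ) ∂(sphereMeasureE n) := by
  obtain ⟨Ω, mΩ, μ, M, h⟩ := hF.exists_isRandomRotation
  have := isProbabilityMeasure_sphereMeasureE hn
  have hf : Measurable fun z => w (x + z) := hw.comp (measurable_const_add x)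
  have hm : IsRotationInvariant (volume.restrict (shell n a b)) :=
    isRotationInvariant_volume.restrict measurableSet_Ioc
  rw [h.lintegral_average hm hf]
  exact lintegral_congr fun z => h.lintegral_eq_sphere isRotationInvariant_sphereMeasureE
    ae_norm_eq_sphereMeasureE hf z

end Shell

/-! ### Local integrability and densities of averages. -/

section Averages

variable {n : ℕ} {F : Set (Matrix (Fin n) (Fin n) ℝ)} {X K : Set (E n)} {u : E n → EReal}
  {C p R : ℝ} {x : E n}

theorem coe_sub_ne_bot_iff {v : ENNReal} : (C : EReal) - (v : EReal) ≠ ⊥ ↔ v ≠ ⊤ := by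
  refine not_congr ⟨fun h => ?_, fun h => by simp [h]⟩
  rw [← gap_coe_sub C v, h, gap_bot]

theorem coe_sub_le_coe_sub_iff {v v' : ENNReal} :
    (C : EReal) - (v : EReal) ≤ (C : EReal) - (v' : EReal) ↔ v' ≤ v := by
  refine ⟨fun h => ?_, fun h => coe_sub_antitone C h⟩
  simpa only [gap_coe_sub] using gap_antitone C h

theorem radialAvg_ne_top {m : Measure (E n)} {r : ℝ} : radialAvg C K u m x r ≠ ⊤ :=
  ne_top_of_le_ne_top (EReal.coe_ne_top C) (coe_sub_le C _)

theorem shellAvg_ne_top_iff (hn : 1 ≤ n) {w : E n → ENNReal} {a b : ℝ} (hab : a < b)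
    (hb : 0 < b) : shellAvg w a b x ≠ ⊤ ↔ ∫⁻ z in shell n a b, w (x + z) ≠ ⊤ := by
  rw [shellAvg, not_iff_not, ENNReal.mul_eq_top]
  simp [volume_shell_ne_zero hn hab hb, volume_shell_ne_top]

theorem radialAvg_ballMeasure (hu : IsSubharmonicOn F X u) (hK : IsClosed K) (hKX : K ⊆ X)
    {r : ℝ} (hr : 0 < r) : radialAvg C K u (ballMeasure n) x r =
      (C : EReal) - (shellAvg (defect C K u) (-1) r x : EReal) := by
  rw [radialAvg, lintegral_ballMeasure hr (hu.measurable_defect hK hKX C)]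

/-- Some z within R/4 of x has u(z) > -∞, and u(z) lies below the ball average about z of radius
R/2. That ball contains the ball of radius R/4 about x, so one ball average at x is finite, and
`radialAvg_spec` extends this to all radii below R. -/
theorem IsSubharmonicOn.setLIntegral_defect_ne_top (hF : IsSTConeSubequation F)
    (hconv : Convex ℝ F) (hp : rieszChar F = (p : EReal)) (hn : 1 ≤ n)
    (hu : IsSubharmonicOn F X u) (hXo : IsOpen X)
    (hfin : ∀ x ∈ X, ∃ y ∈ connectedComponentIn X x, u y ≠ ⊥) (hK : IsClosed K) (hKX : K ⊆ X)
    (hC : ∀ y ∈ K, u y ≤ C) (hx : Metric.closedBall x R ⊆ K) {r : ℝ} (hr : 0 < r) (hrR : r < R) :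
    ∫⁻ y in Metric.closedBall x r, defect C K u y ≠ ⊤ := by
  have hR : 0 < R := hr.trans hrR
  have hball : ∀ {y s}, 0 < s → (RieszDensity.radialAvg C K u (ballMeasure n) y s ≠ ⊥ ↔
      ∫⁻ z in shell n (-1) s, defect C K u (y + z) ≠ ⊤) := fun hs => by
    rw [radialAvg_ballMeasure hu hK hKX hs, coe_sub_ne_bot_iff,
      shellAvg_ne_top_iff hn (by linarith) hs]
  obtain ⟨z, hzx, hz⟩ := hu.exists_ne_bot hF hp hn hXo hfin (x := x) (R := R / 4)
    ((Metric.closedBall_subset_closedBall (by linarith)).trans (hx.trans hKX)) (by linarith)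
  have hzK : Metric.closedBall z (3 * R / 4) ⊆ K := by
    refine (Metric.closedBall_subset_closedBall' ?_).trans hx
    rw [dist_eq_norm]; linarith
  have h1 : RieszDensity.radialAvg C K u (ballMeasure n) z (R / 2) ≠ ⊥ :=
    ne_bot_of_le_ne_bot hz (hu.le_radialAvg hF hconv hp hn hK hKX hC hzK
      isRotationInvariant_ballMeasure ae_norm_le_ballMeasure (by linarith) (by linarith))
  rw [hball (by linarith)] at h1
  have h2 : ∫⁻ y in shell n (-1) (R / 4), defect C K u (x + y) ≠ ⊤ := by
    refine ne_top_of_le_ne_top h1 (setLIntegral_shell_le_closedBall.trans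
      (le_trans (lintegral_mono_set ?_) (setLIntegral_closedBall_le_shell (by norm_num))))
    refine Metric.closedBall_subset_closedBall' ?_
    rw [dist_comm, dist_eq_norm]; linarith
  have h3 := (hu.radialAvg_spec hF hconv hp hn hK hKX hC hx isRotationInvariant_ballMeasure
    ae_norm_le_ballMeasure ⟨R / 4, by linarith, by linarith, (hball (by linarith)).2 h2⟩).1 r hr hrR
  exact ne_top_of_le_ne_top ((hball hr).1 h3) (setLIntegral_closedBall_le_shell (by norm_num))

theorem eventually_closedBall_subset {r : ℝ} (hr : r < R) :
    ∀ᶠ x' in 𝓝 x, ∃ R', r < R' ∧ Metric.closedBall x' R' ⊆ Metric.closedBall x R := by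
  filter_upwards [Metric.ball_mem_nhds x (sub_pos.2 hr)] with x' h2
  obtain ⟨R', hR1, hR2⟩ := exists_between (lt_sub_comm.1 (Metric.mem_ball.1 h2))
  exact ⟨R', hR1, Metric.closedBall_subset_closedBall' (by linarith)⟩

/-- Conditions on a family of averages over a rotation invariant measure under which it has an
upper semicontinuous density. -/
theorem IsSubharmonicOn.upperSemicontinuousDensity_of_radialAvg (hF : IsSTConeSubequation F)
    (hconv : Convex ℝ F) (hp : rieszChar F = (p : EReal)) (hn : 1 ≤ n)
    (hu : IsSubharmonicOn F X u) (hXo : IsOpen X) {Ψ : E n → ℝ → EReal} {m : Measure (E n)}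
    [IsProbabilityMeasure m] (hm : IsRotationInvariant m) (hs : ∀ᵐ z ∂m, ‖z‖ ≤ 1)
    (hΨ : ∀ {C K x R}, IsClosed K → K ⊆ X → 0 ≤ C → (∀ y ∈ K, u y ≤ (C : ℝ)) →
      Metric.closedBall x R ⊆ K → ∀ r, 0 ≤ r → r ≤ R → Ψ x r = RieszDensity.radialAvg C K u m x r)
    (hne : ∀ {C K x R}, IsClosed K → K ⊆ X → (∀ y ∈ K, u y ≤ (C : ℝ)) →
      Metric.closedBall x R ⊆ K → 0 < R →
        ∃ r, 0 ≤ r ∧ r < R ∧ RieszDensity.radialAvg C K u m x r ≠ ⊥)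
    (hloc : ∀ {C K x R}, IsClosed K → K ⊆ X → (∀ y ∈ K, u y ≤ (C : ℝ)) →
      Metric.closedBall x R ⊆ K → ∀ {r r'}, 0 < r → r < r' → r' < R →
        ∃ T : E n → ENNReal, ContinuousAt T x ∧ ∀ᶠ x' in 𝓝 x,
          RieszDensity.radialAvg C K u m x' r ≤ (C : EReal) - (T x' : EReal) ∧
          (C : EReal) - (T x' : EReal) ≤ RieszDensity.radialAvg C K u m x' r') :
    UpperSemicontinuousDensity p X Ψ := by
  have hspec : ∀ x R, Metric.closedBall x R ⊆ X → 0 < R →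
      (∀ r, 0 < r → r < R → Ψ x r ≠ ⊥ ∧ Ψ x r ≠ ⊤) ∧
        IsKernelConvex p R fun r => (Ψ x r).toReal := by
    intro x R hx hR
    obtain ⟨C, hC0, hC⟩ := hu.exists_le_coe (isCompact_closedBall x R) hx
    have hK := Metric.isClosed_closedBall (x := x) (ε := R)
    obtain ⟨h1, h2⟩ := hu.radialAvg_spec hF hconv hp hn hK hx hC subset_rfl hm hs
      (hne hK hx hC subset_rfl hR)
    have heq : ∀ r, 0 < r → r < R → Ψ x r = RieszDensity.radialAvg C _ u m x r := fun r hr hrR =>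
      hΨ hK hx hC0 hC subset_rfl r hr.le hrR.le
    refine ⟨fun r hr hrR => ?_, fun s t hs hst ht => ?_, fun r₁ r r₂ hr₁ h4 h5 h6 => ?_⟩
    · rw [heq r hr hrR]
      exact ⟨h1 r hr hrR, radialAvg_ne_top⟩
    · have := h2.mono s t hs hst ht
      rwa [← heq s hs (hst.trans_lt ht), ← heq t (hs.trans_le hst) ht] at this
    · have := h2.conv r₁ r r₂ hr₁ h4 h5 h6
      rwa [← heq r₁ hr₁ ((h4.trans h5).trans h6), ← heq r (hr₁.trans h4) (h5.trans h6),
        ← heq r₂ ((hr₁.trans h4).trans h5) h6] at this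
  refine upperSemicontinuousDensity_of_isKernelConvex hXo
    (fun x R hX r hr hrR => (hspec x R hX (hr.trans hrR)).1 r hr hrR) (fun x R hX => ?_)
    fun x hx => ?_
  · rcases le_or_gt R 0 with hR | hR
    · exact ⟨fun s t hs hst ht => by linarith, fun r₁ r r₂ h1 h2 h3 h4 => by linarith⟩
    · exact (hspec x R hX hR).2
  · obtain ⟨R, hR, hball⟩ := Metric.nhds_basis_closedBall.mem_iff.1 (hXo.mem_nhds hx)
    refine ⟨R, hR, fun r r' hr hrr' hr' ε hε => ?_⟩
    obtain ⟨C, hC0, hC⟩ := hu.exists_le_coe (isCompact_closedBall x R) hball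
    have hK := Metric.isClosed_closedBall (x := x) (ε := R)
    -- A continuous function squeezed between the averages at r and r' gives both comparisons of
    -- nearby centres.
    obtain ⟨T, hT, hTe⟩ := hloc hK hball hC subset_rfl hr hrr' hr'
    have hr0 := hr.trans hrr'
    have hle : ∀ᶠ x' in 𝓝 x, Ψ x' r ≤ (C : EReal) - (T x' : EReal) ∧
        (C : EReal) - (T x' : EReal) ≤ Ψ x' r' ∧ Ψ x' r ≠ ⊥ ∧ Ψ x' r' ≠ ⊤ := by
      filter_upwards [hTe, eventually_closedBall_subset (x := x) hr'] with x' h1 ⟨R', hR1, hx'⟩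
      rw [hΨ hK hball hC0 hC hx' r hr.le (hrr'.trans hR1).le,
        hΨ hK hball hC0 hC hx' r' hr0.le hR1.le]
      refine ⟨h1.1, h1.2, ?_, radialAvg_ne_top⟩
      have := ((hspec x' R' (hx'.trans hball) (hr0.trans hR1)).1 r hr (hrr'.trans hR1)).1
      rwa [hΨ hK hball hC0 hC hx' r hr.le (hrr'.trans hR1).le] at this
    obtain ⟨hx1, hx2, hx3, hx4⟩ := hle.self_of_nhds
    have hT1 : ContinuousAt (fun x' => ((C : EReal) - (T x' : EReal)).toReal) x := by
      have h1 : ContinuousAt (fun x' => (C : EReal) - (T x' : EReal)) x :=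
        (continuous_coe_sub C).continuousAt.comp hT
      exact (EReal.tendsto_toReal (ne_top_of_le_ne_top hx4 hx2)
        (ne_bot_of_le_ne_bot hx3 hx1)).comp h1
    filter_upwards [hle, Metric.tendsto_nhds.1 hT1 ε hε] with x' ⟨h1, h2, h3, h4⟩ h5
    rw [Real.dist_eq, abs_lt] at h5
    have e1 := EReal.toReal_le_toReal h1 h3 (ne_top_of_le_ne_top h4 h2)
    have e2 := EReal.toReal_le_toReal h2 (ne_bot_of_le_ne_bot h3 h1) h4
    have e3 := EReal.toReal_le_toReal hx1 hx3 (ne_top_of_le_ne_top hx4 hx2)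
    have e4 := EReal.toReal_le_toReal hx2 (ne_bot_of_le_ne_bot hx3 hx1) hx4
    exact ⟨by linarith, by linarith⟩

theorem IsSubharmonicOn.radialAvg_mono (hF : IsSTConeSubequation F) (hconv : Convex ℝ F)
    (hp : rieszChar F = (p : EReal)) (hn : 1 ≤ n) (hu : IsSubharmonicOn F X u)
    (hK : IsClosed K) (hKX : K ⊆ X) (hC : ∀ y ∈ K, u y ≤ C) (hx : Metric.closedBall x R ⊆ K)
    {m : Measure (E n)} [IsProbabilityMeasure m] (hm : IsRotationInvariant m)
    (hs : ∀ᵐ z ∂m, ‖z‖ ≤ 1) (hne : ∃ r, 0 ≤ r ∧ r < R ∧ RieszDensity.radialAvg C K u m x r ≠ ⊥)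
    {r r' : ℝ} (hr : 0 < r) (hrr' : r ≤ r') (hr' : r' < R) :
    RieszDensity.radialAvg C K u m x r ≤ RieszDensity.radialAvg C K u m x r' := by
  obtain ⟨h1, h2⟩ := hu.radialAvg_spec hF hconv hp hn hK hKX hC hx hm hs hne
  have h3 := h2.mono r r' hr hrr' hr'
  rwa [← EReal.coe_le_coe_iff, EReal.coe_toReal radialAvg_ne_top (h1 r hr (hrr'.trans_lt hr')),
    EReal.coe_toReal radialAvg_ne_top (h1 r' (hr.trans_le hrr') hr')] at h3

theorem IsSubharmonicOn.upperSemicontinuousDensity_ballAvg (hF : IsSTConeSubequation F)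
    (hconv : Convex ℝ F) (hp : rieszChar F = (p : EReal)) (hn : 1 ≤ n)
    (hu : IsSubharmonicOn F X u) (hXo : IsOpen X)
    (hfin : ∀ x ∈ X, ∃ y ∈ connectedComponentIn X x, u y ≠ ⊥) :
    UpperSemicontinuousDensity p X (ballAvg u) := by
  have hne : ∀ {C : ℝ} {K x R}, IsClosed K → K ⊆ X → (∀ y ∈ K, u y ≤ C) →
      Metric.closedBall x R ⊆ K → 0 < R →
        ∃ r, 0 ≤ r ∧ r < R ∧ RieszDensity.radialAvg C K u (ballMeasure n) x r ≠ ⊥ := by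
    intro C K x R hK hKX hC hx hR
    refine ⟨R / 2, by linarith, by linarith, ?_⟩
    rw [radialAvg_ballMeasure hu hK hKX (by linarith), coe_sub_ne_bot_iff,
      shellAvg_ne_top_iff hn (by linarith) (by linarith)]
    exact ne_top_of_le_ne_top (hu.setLIntegral_defect_ne_top hF hconv hp hn hXo hfin hK hKX hC hx
      (half_pos hR) (by linarith)) setLIntegral_shell_le_closedBall
  refine hu.upperSemicontinuousDensity_of_radialAvg hF hconv hp hn hXo
    isRotationInvariant_ballMeasure ae_norm_le_ballMeasure
    (fun hK hKX hC0 hC hx _ hr hrR => ballAvg_eq_radialAvg hu hK hKX hC0 hC hx hr hrR) hne ?_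
  intro C K x R hK hKX hC hx r r' hr hrr' hr'
  -- The ball average at radius r is itself continuous in the centre; inner radius -1 makes the
  -- shell a closed ball.
  refine ⟨shellAvg (defect C K u) (-1) r, ?_, ?_⟩
  · exact continuousAt_shellAvg hn (hu.measurable_defect hK hKX C) (by norm_num) (by linarith) hr
      hrr' (hu.setLIntegral_defect_ne_top hF hconv hp hn hXo hfin hK hKX hC hx
        (hr.trans hrr') hr')
  · filter_upwards [eventually_closedBall_subset (x := x) hr'] with x' ⟨R', hR1, hR2⟩
    rw [← radialAvg_ballMeasure hu hK hKX hr]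
    exact ⟨le_rfl, hu.radialAvg_mono hF hconv hp hn hK hKX hC (hR2.trans hx)
      isRotationInvariant_ballMeasure ae_norm_le_ballMeasure
      (hne hK hKX hC (hR2.trans hx) ((hr.trans hrr').trans hR1)) hr hrr'.le hR1⟩

theorem IsSubharmonicOn.upperSemicontinuousDensity_sphereAvg (hF : IsSTConeSubequation F)
    (hconv : Convex ℝ F) (hp : rieszChar F = (p : EReal)) (hn : 1 ≤ n)
    (hu : IsSubharmonicOn F X u) (hXo : IsOpen X)
    (hfin : ∀ x ∈ X, ∃ y ∈ connectedComponentIn X x, u y ≠ ⊥) :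
    UpperSemicontinuousDensity p X (sphereAvg u) := by
  have := isProbabilityMeasure_sphereMeasureE hn
  have hs : ∀ᵐ z ∂(sphereMeasureE n), ‖z‖ ≤ 1 := ae_norm_eq_sphereMeasureE.mono fun _ h => h.le
  have hne : ∀ {C : ℝ} {K x R}, IsClosed K → K ⊆ X → (∀ y ∈ K, u y ≤ C) →
      Metric.closedBall x R ⊆ K → 0 < R →
        ∃ r, 0 ≤ r ∧ r < R ∧ RieszDensity.radialAvg C K u (sphereMeasureE n) x r ≠ ⊥ := by
    intro C K x R hK hKX hC hx hR
    have h1 := ne_top_of_le_ne_top (hu.setLIntegral_defect_ne_top hF hconv hp hn hXo hfin hK hKX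
      hC hx (half_pos hR) (by linarith)) (setLIntegral_shell_le_closedBall (a := -1))
    rw [setLIntegral_shell_eq_sphere hF hn (hu.measurable_defect hK hKX C)] at h1
    by_contra! hcon
    refine h1 ?_
    -- If all spherical averages were -∞, the defect would have infinite integral over the ball,
    -- against local integrability.
    have h2 : ∀ z ∈ shell n (-1) (R / 2),
        ∫⁻ σ, defect C K u (x + ‖z‖ • σ) ∂(sphereMeasureE n) = ⊤ := fun z hz => by
      by_contra h
      exact coe_sub_ne_bot_iff.2 h (hcon ‖z‖ (norm_nonneg z) (by linarith [hz.2]))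
    rw [setLIntegral_congr_fun measurableSet_shell h2, setLIntegral_const,
      ENNReal.top_mul (volume_shell_ne_zero hn (by linarith) (half_pos hR))]
  refine hu.upperSemicontinuousDensity_of_radialAvg hF hconv hp hn hXo
    isRotationInvariant_sphereMeasureE hs
    (fun hK hKX hC0 hC hx _ hr hrR => sphereAvg_eq_radialAvg hn hu hK hKX hC0 hC hx hr hrR) hne ?_
  intro C K x R hK hKX hC hx r r' hr hrr' hr'
  have hr0 := hr.trans hrr'
  have hw := hu.measurable_defect hK hKX C
  -- Spherical averages need not be visibly continuous in the centre, but the average over r < |z| ≤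
  -- r' is, and monotonicity in the radius places it between those at r and r'.
  refine ⟨shellAvg (defect C K u) r r', ?_, ?_⟩
  · obtain ⟨ρ, h1, h2⟩ := exists_between hr'
    exact continuousAt_shellAvg hn hw hr.ne' hrr' hr0 h1
      (hu.setLIntegral_defect_ne_top hF hconv hp hn hXo hfin hK hKX hC hx (hr0.trans h1) h2)
  · filter_upwards [eventually_closedBall_subset (x := x) hr'] with x' ⟨R', hR1, hR2⟩
    have hmono : ∀ s t, 0 < s → s ≤ t → t < R' →
        ∫⁻ σ, defect C K u (x' + t • σ) ∂(sphereMeasureE n) ≤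
          ∫⁻ σ, defect C K u (x' + s • σ) ∂(sphereMeasureE n) := fun s t hs0 hst ht =>
      coe_sub_le_coe_sub_iff.1 (hu.radialAvg_mono hF hconv hp hn hK hKX hC (hR2.trans hx)
        isRotationInvariant_sphereMeasureE hs
        (hne hK hKX hC (hR2.trans hx) (hr0.trans hR1)) hs0 hst ht)
    have hv0 := volume_shell_ne_zero hn hrr' hr0
    have hvt := volume_shell_ne_top (n := n) (a := r) (b := r')
    have hconst : ∀ c : ENNReal, c = (volume (shell n r r'))⁻¹ * ∫⁻ _ in shell n r r', c :=
      fun c => by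
        rw [setLIntegral_const, mul_comm c, ← mul_assoc, ENNReal.inv_mul_cancel hv0 hvt, one_mul]
    constructor
    · refine coe_sub_le_coe_sub_iff.2 ?_
      rw [shellAvg, setLIntegral_shell_eq_sphere hF hn hw,
        hconst (∫⁻ σ, defect C K u (x' + r • σ) ∂(sphereMeasureE n))]
      gcongr 1
      exact setLIntegral_mono' measurableSet_shell fun z hz =>
        hmono r ‖z‖ hr hz.1.le (hz.2.trans_lt hR1)
    · refine coe_sub_le_coe_sub_iff.2 ?_
      rw [shellAvg, setLIntegral_shell_eq_sphere hF hn hw,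
        hconst (∫⁻ σ, defect C K u (x' + r' • σ) ∂(sphereMeasureE n))]
      gcongr 1
      exact setLIntegral_mono' measurableSet_shell fun z hz =>
        hmono ‖z‖ r' (hr.trans hz.1) hz.2 hR1

end Averages

end RieszDensity

theorem theorem7p4 (n : ℕ) (hn : 1 ≤ n)
    (F : Set (Matrix (Fin n) (Fin n) ℝ)) (hF : RieszDensity.IsSTConeSubequation F)
    (p : ℝ) (hp : RieszDensity.rieszChar F = (p : EReal))
    (X : Set (RieszDensity.E n)) (hX : IsOpen X)
    (u : RieszDensity.E n → EReal) (hu : RieszDensity.IsSubharmonicOn F X u)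
    (hfin : ∀ x ∈ X, ∃ y ∈ connectedComponentIn X x, u y ≠ ⊥) :
    RieszDensity.UpperSemicontinuousDensity p X (RieszDensity.sphereMax u) ∧
      (Convex ℝ F →
        RieszDensity.UpperSemicontinuousDensity p X (RieszDensity.sphereAvg u) ∧
          RieszDensity.UpperSemicontinuousDensity p X (RieszDensity.ballAvg u)) :=
  ⟨hu.upperSemicontinuousDensity_sphereMax hF hp hn hX hfin, fun hconv =>
    ⟨hu.upperSemicontinuousDensity_sphereAvg hF hconv hp hn hX hfin,
      hu.upperSemicontinuousDensity_ballAvg hF hconv hp hn hX hfin⟩⟩
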